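/- **Conventions.** For $0<s<1$, $1\le p<\infty$, a measurable set $U\subset\mathbb R^n$ and $F\subset\mathbb R^m$, $W^{s,p}(U;F)$ is the set of measurable $u:U\to\mathbb R^m$ with $u(x)\in F$ for a.e. $x\in U$ and finite norm $$\|u\|_{W^{s,p}(U)}=\|u\|_{L^p(U)}+\Big(\int_U\int_U\frac{|u(x)-u(y)|^p}{|x-y|^{n+sp}}\,dx\,dy\Big)^{1/p}.$$ A *finite mesh* $\mathscr C$ in $\mathbb R^n$ is a finite union of closed cubes of a grid $\{T+2\varepsilon K+[-\varepsilon,\varepsilon]^n : K\in\mathbb Z^n\}$, with $T\in\mathbb R^n$, $\varepsilon>0$; its $j$-skeleton is the union of the $j$-dimensional faces of its cubes. A map $h$ on $\mathscr C$ is *piecewise $j$-homogeneous* if it is the $j$-homogeneous extension of its restriction to the $j$-skeleton, obtained by extending successively to the faces of dimension $j+1,\dots,n$: if $Q$ is a face, of dimension $>j$ and with centre $c$, of a cube of $\mathscr C$, then $$h(x)=h\Big(c+\varepsilon\frac{x-c}{|x-c|_\infty}\Big)\qquad\text{for all }x\in Q\setminus\{c\},$$ where $|\cdot|_\infty$ is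 the sup norm (the values at the centres $c$ are arbitrary). **Theorem.** Let $0<s<1$, $1\le p<\infty$ and $1\le sp<n$. Let $N\subset\mathbb R^m$ be a compact smooth embedded submanifold without boundary. Let $\Omega,\omega\subset\mathbb R^n$ be bounded open sets with $\overline\Omega\subset\omega$, let $f\in W^{s,p}(\omega;N)$, and let $j=[sp]$ be the integer part of $sp$. Then there exist a sequence $\{\mathscr C^k\}$ of finite meshes with $\overline\Omega\subset\mathscr C^k\subset\omega$ and a sequence of maps $f_k:\mathscr C^k\to N$ such that: a) each $f_k$ is piecewise $j$-homogeneous on $\mathscr C^k$; b) each $f_k$ belongs to $W^{s,p}(\mathscr C^k;N)$; c) $f_k\to f$ in $W^{s,p}(\Omega)$ as $k\to\infty$; d) for each $k$, the restriction of $f_k$ to the $j$-skeleton $\mathscr S^k$ of $\mathscr C^k$ is Lipschitz. -/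

import Mathlib

noncomputable section

namespace FracSobolev

open MeasureTheory Set
open scoped ENNReal ContDiff

/-- `ℝⁿ` with the Euclidean norm. -/
abbrev E (n : ℕ) : Type := EuclideanSpace ℝ (Fin n)

/-! ### Fractional Sobolev spaces, `0 < s < 1`, `1 ≤ p < ∞` -/

/-- The `p`-th power of the Gagliardo seminorm,
`∫_U ∫_U |u(x) - u(y)|^p / |x - y|^(n + s p) dx dy`. -/
def gagliardoEnergy {n m : ℕ} (s p : ℝ) (U : Set (E n)) (u : E n → E m) : ℝ≥0∞ :=
  ∫⁻ x in U, ∫⁻ y in U, ‖u x - u y‖ₑ ^ p / ‖x - y‖ₑ ^ ((n : ℝ) + s * p)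

/-- The norm `‖u‖_{L^p(U)} + |u|_{W^{s,p}(U)}`, with values in `[0, ∞]`. -/
def wspNorm {n m : ℕ} (s p : ℝ) (U : Set (E n)) (u : E n → E m) : ℝ≥0∞ :=
  eLpNorm u (ENNReal.ofReal p) (volume.restrict U) + gagliardoEnergy s p U u ^ (1 / p)

/-- `u` (restricted to `U`) belongs to `W^{s,p}(U ; F)`: it is measurable with finite norm, and
takes its values in `F` almost everywhere in `U`. -/
def MemWsp {n m : ℕ} (s p : ℝ) (U : Set (E n)) (F : Set (E m)) (u : E n → E m) : Prop :=
  AEStronglyMeasurable u (volume.restrict U) ∧ wspNorm s p U u < ⊤ ∧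
    ∀ᵐ x ∂(volume.restrict U), u x ∈ F

/-! ### Embedded submanifolds -/

/-- `N` is a smooth embedded submanifold without boundary, of dimension `d`, of `ℝᵐ`: around each
of its points there is a smooth diffeomorphism between open subsets of `ℝᵐ` that straightens `N`
to `{z | z_i = 0 for all i ≥ d}` (coordinates are numbered from `0`). -/
def IsSmoothSubmanifold {m : ℕ} (d : ℕ) (N : Set (E m)) : Prop :=
  ∀ x ∈ N, ∃ Φ : OpenPartialHomeomorph (E m) (E m),
    x ∈ Φ.source ∧ ContDiffOn ℝ ∞ Φ Φ.source ∧ ContDiffOn ℝ ∞ Φ.symm Φ.target ∧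
    ∀ y ∈ Φ.source, y ∈ N ↔ ∀ i : Fin m, d ≤ (i : ℕ) → Φ y i = 0

/-! ### Finite cubical meshes and homogeneous extensions -/

/-- A finite mesh of `ℝⁿ`: finitely many cubes of the grid of the cubes
`T + 2 ε K + [-ε, ε]ⁿ`, `K ∈ ℤⁿ`. -/
structure Mesh (n : ℕ) where
  /-- the centre of one of the cubes of the grid -/
  T : E n
  /-- half of the side length -/
  ε : ℝ
  ε_pos : 0 < ε
  /-- the indices of the cubes that form the mesh -/
  cells : Finset (Fin n → ℤ)

namespace Mesh

variable {n : ℕ}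

/-- The closed faces of the cube `T + 2 ε K + [-ε, ε]ⁿ` are indexed by sign vectors `e`: the
coordinates with `e i = 0` are free, the others are fixed at the end point given by the sign.
This is the centre `T + 2 ε K + ε e` of the face. -/
def faceCenter (M : Mesh n) (K : Fin n → ℤ) (e : Fin n → SignType) : E n :=
  WithLp.toLp 2 fun i => M.T i + 2 * M.ε * (K i : ℝ) + M.ε * ((e i : SignType) : ℝ)

/-- The closed face with index `e` of the cube with index `K`; for `e = 0` it is the closed cube
itself. -/
def face (M : Mesh n) (K : Fin n → ℤ) (e : Fin n → SignType) : Set (E n) :=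
  {x | ∀ i, if e i = 0 then |x i - M.faceCenter K e i| ≤ M.ε else x i = M.faceCenter K e i}

/-- The dimension of the face with index `e`. -/
def faceDim (e : Fin n → SignType) : ℕ := (Finset.univ.filter fun i => e i = 0).card

/-- The union of the closed cubes of the mesh. -/
def carrier (M : Mesh n) : Set (E n) := ⋃ K ∈ M.cells, M.face K 0

/-- The `j`-dimensional skeleton: the union of the `j`-dimensional faces of the cubes. -/
def skeleton (M : Mesh n) (j : ℕ) : Set (E n) :=
  ⋃ K ∈ M.cells, ⋃ e ∈ {e : Fin n → SignType | faceDim e = j}, M.face K e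

/-- The radial projection of the face with index `e` of the cube with index `K` onto the relative
boundary of that face, `x ↦ c + ε (x - c) / |x - c|`, where `c` is the centre of the face and
`| |` is the sup norm. -/
def radialProj (M : Mesh n) (K : Fin n → ℤ) (e : Fin n → SignType) (x : E n) : E n :=
  M.faceCenter K e +
    (M.ε / ‖WithLp.ofLp (x - M.faceCenter K e)‖) • (x - M.faceCenter K e)

/-- `f` is piecewise `j`-homogeneous on the mesh, that is, `f = H_n (⋯ (H_{j+1} (f|_{j-skeleton})))`,
where `H_ℓ` extends a map from the `(ℓ-1)`-skeleton to the `ℓ`-skeleton by homogeneity on each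
`ℓ`-dimensional face: on each face of dimension `> j`, the value of `f` at a point other than the
centre (where the homogeneous extension is not defined) is its value at the radial projection of
the point onto the boundary of the face. -/
def IsPiecewiseHomogeneous {m : ℕ} (M : Mesh n) (j : ℕ) (f : E n → E m) : Prop :=
  ∀ K ∈ M.cells, ∀ e : Fin n → SignType, j < faceDim e →
    ∀ x ∈ M.face K e, x ≠ M.faceCenter K e → f x = f (M.radialProj K e x)

end Mesh

end FracSobolev

end

/-!
Extend `f` from a neighbourhood of `Ω` to a bounded map `F` on `ℝⁿ` and smooth it: `u` is the mean of
`F` over balls of radius `ρ`. The `j`-homogeneous extension of a map from the skeleton of a grid is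
the composition with one projection onto that skeleton, singular along the dual skeleton. So the
approximation is `π ∘ u ∘ proj`, where `π` is a Lipschitz retraction of a neighbourhood of `N`, and
it remains to choose the grid. Averaging over all translates of the grid of size `ε`:

* the Gagliardo energy of `u ∘ proj` at small scales is at most a constant times that of `F`, because
  the singularity of the projection has codimension `j + 1 > s p`;
* `u ∘ proj → F` in `L^p` as first `ρ → 0`, then `ε → 0`;
* the energy of `F` in the `ρ`-neighbourhood of the `j`-skeleton is `O((ρ / ε)^(n - j))` times its
  total at scale `ρ`. At a point `x`, the `p`-th power of the distance of `u x` to `N` is at most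
  `ρ^(s p - n)` times the energy in the ball of radius `ρ`, so that `u` maps the skeleton close to `N`
  when `ρ` is small, as `j ≤ s p`.

Some translate is good for all three. For the existence of `π`: a compact submanifold has positive
reach, so that the nearest points to two points close to `N` differ by at most a constant times the
distance of these points.
-/

noncomputable section

namespace FracSobolev

open MeasureTheory Set Filter Topology
open scoped ENNReal NNReal RealInnerProductSpace

section NearestPoint

variable {V W : Type*} [NormedAddCommGroup V] [NormedAddCommGroup W]

lemma norm_image_sub_sub_fderiv_le_of_lipschitzOnWith [NormedSpace ℝ V] [NormedSpace ℝ W]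
    {Ψ : V → W} {s : Set V} (hs : Convex ℝ s) {κ : ℝ≥0} (hd : ∀ z ∈ s, DifferentiableAt ℝ Ψ z)
    (hL : LipschitzOnWith κ (fderiv ℝ Ψ) s) {b c : V} (hb : b ∈ s) (hc : c ∈ s) :
    ‖Ψ c - Ψ b - fderiv ℝ Ψ b (c - b)‖ ≤ κ * ‖c - b‖ ^ 2 := by
  have hseg : segment ℝ b c ⊆ s := hs.segment_subset hb hc
  have hderiv : ∀ z ∈ segment ℝ b c, ‖fderiv ℝ Ψ z - fderiv ℝ Ψ b‖ ≤ κ * ‖c - b‖ := fun z hz => by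
    refine (hL.norm_sub_le (hseg hz) hb).trans ?_
    gcongr
    exact norm_sub_le_of_mem_segment hz
  rw [sq, ← mul_assoc]
  exact (convex_segment b c).norm_image_sub_le_of_norm_hasFDerivWithin_le'
    (fun z hz => (hd z (hseg hz)).hasFDerivAt.hasFDerivWithinAt) hderiv
    (left_mem_segment ℝ b c) (right_mem_segment ℝ b c)

/-- `a` is a nearest point to `y` in `N`. -/
def IsNearestPoint (N : Set V) (y a : V) : Prop := a ∈ N ∧ ∀ z ∈ N, ‖y - a‖ ≤ ‖y - z‖

lemma exists_isNearestPoint {N : Set V} (hN : IsCompact N) (hne : N.Nonempty) (y : V) :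
    ∃ a, IsNearestPoint N y a := by
  obtain ⟨a, ha, hmin⟩ := hN.exists_isMinOn hne (f := fun z => ‖y - z‖) (by fun_prop)
  exact ⟨a, ha, fun _ hz => hmin hz⟩

lemma IsNearestPoint.norm_sub_le_of_mem_cthickening {N : Set V} {y a : V}
    (ha : IsNearestPoint N y a) {δ : ℝ} (hδ : 0 ≤ δ) (hy : y ∈ Metric.cthickening δ N) :
    ‖y - a‖ ≤ δ := by
  have h : ENNReal.ofReal ‖y - a‖ ≤ Metric.infEDist y N := Metric.le_infEDist.2 fun z hz => by
    rw [edist_dist, dist_eq_norm]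
    exact ENNReal.ofReal_le_ofReal (ha.2 z hz)
  exact (ENNReal.ofReal_le_ofReal_iff hδ).1 (h.trans hy)

variable [InnerProductSpace ℝ V]

lemma inner_nonpos_of_hasDerivAt_of_forall_norm_le {y v : V} {γ : ℝ → V} (hγ : HasDerivAt γ v 0)
    (hmin : ∀ t ∈ Icc (0 : ℝ) 1, ‖y - γ 0‖ ≤ ‖y - γ t‖) : ⟪y - γ 0, v⟫ ≤ 0 := by
  have hderiv : HasFDerivWithinAt (fun t => ‖y - γ t‖ ^ 2)
      (ContinuousLinearMap.toSpanSingleton ℝ (2 * ⟪y - γ 0, -v⟫)) (Icc 0 1) 0 :=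
    (hγ.const_sub y).norm_sq.hasFDerivAt.hasFDerivWithinAt
  have hloc : IsLocalMinOn (fun t => ‖y - γ t‖ ^ 2) (Icc 0 1) 0 :=
    IsMinOn.localize fun t ht => by
      simpa using pow_le_pow_left₀ (norm_nonneg _) (hmin t ht) 2
  have hcone : (1 : ℝ) ∈ posTangentConeAt (Icc (0 : ℝ) 1) 0 := by
    refine mem_posTangentConeAt_of_segment_subset ?_
    rw [zero_add, segment_eq_Icc zero_le_one]
  have h := hloc.hasFDerivWithinAt_nonneg hderiv hcone
  simp only [ContinuousLinearMap.toSpanSingleton_apply, one_smul, inner_neg_right] at h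
  linarith

/-- `N` has positive reach, in the form of Federer's inequality: the normal component of a chord
of `N` is quadratically small. -/
def HasPositiveReach (N : Set V) : Prop :=
  ∃ κ : ℝ, 0 < κ ∧ ∀ y a, IsNearestPoint N y a → ∀ b ∈ N,
    ⟪y - a, b - a⟫ ≤ κ * ‖y - a‖ * ‖b - a‖ ^ 2

/-- `N` is a Lipschitz retract of a neighbourhood of uniform width. -/
def IsLipschitzNhdRetract (N : Set V) : Prop :=
  ∃ δ : ℝ, 0 < δ ∧ ∃ (K : ℝ≥0) (π : V → V), LipschitzOnWith K π (Metric.cthickening δ N) ∧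
    MapsTo π (Metric.cthickening δ N) N ∧ ∀ x ∈ N, π x = x

lemma norm_sub_le_of_inner_le_quarter {y y' a b : V}
    (h : ⟪y - a, b - a⟫ ≤ 1 / 4 * ‖b - a‖ ^ 2) (h' : ⟪y' - b, a - b⟫ ≤ 1 / 4 * ‖b - a‖ ^ 2) :
    ‖a - b‖ ≤ 2 * ‖y - y'‖ := by
  rw [norm_sub_rev a b, norm_sub_rev y y']
  have hsplit : ⟪y' - y, b - a⟫ = ‖b - a‖ ^ 2 - ⟪y' - b, a - b⟫ - ⟪y - a, b - a⟫ := by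
    have hy : y' - y = (b - a) + (y' - b) - (y - a) := by abel
    rw [← neg_sub b a, inner_neg_right, hy, inner_sub_left, inner_add_left,
      real_inner_self_eq_norm_sq]
    ring
  have hcs := real_inner_le_norm (y' - y) (b - a)
  rcases (norm_nonneg (b - a)).eq_or_lt with h0 | h0
  · rw [← h0]
    positivity
  · refine le_of_mul_le_mul_right ?_ h0
    nlinarith

lemma HasPositiveReach.isLipschitzNhdRetract {N : Set V} (hN : HasPositiveReach N)
    (hNc : IsCompact N) : IsLipschitzNhdRetract N := by
  rcases N.eq_empty_or_nonempty with rfl | hne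
  · exact ⟨1, one_pos, 0, id, by simp, by simp, by simp⟩
  obtain ⟨κ, hκ, hreach⟩ := hN
  choose π hπ using exists_isNearestPoint hNc hne
  have hquarter : ∀ y ∈ Metric.cthickening (1 / (4 * κ)) N, ∀ b ∈ N,
      ⟪y - π y, b - π y⟫ ≤ 1 / 4 * ‖b - π y‖ ^ 2 := fun y hy b hb => by
    refine (hreach y (π y) (hπ y) b hb).trans ?_
    gcongr
    calc κ * ‖y - π y‖ ≤ κ * (1 / (4 * κ)) := by
          gcongr
          exact (hπ y).norm_sub_le_of_mem_cthickening (by positivity) hy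
      _ = 1 / 4 := by field_simp
  refine ⟨1 / (4 * κ), by positivity, 2, π, ?_, fun y _ => (hπ y).1, fun x hx => ?_⟩
  · refine LipschitzOnWith.of_dist_le_mul fun y hy y' hy' => ?_
    rw [dist_eq_norm, dist_eq_norm]
    refine norm_sub_le_of_inner_le_quarter (hquarter y hy _ (hπ y').1) ?_
    rw [norm_sub_rev (π y')]
    exact hquarter y' hy' _ (hπ y).1
  · have h := (hπ x).2 x hx
    rw [sub_self, norm_zero, norm_le_zero_iff, sub_eq_zero] at h
    exact h.symm

end NearestPoint

section Submanifold

open scoped ContDiff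

variable {m d : ℕ} {N : Set (E m)}

lemma IsNearestPoint.inner_fderiv_symm_nonpos {Φ : OpenPartialHomeomorph (E m) (E m)}
    (hflat : ∀ z ∈ Φ.source, z ∈ N ↔ ∀ i : Fin m, d ≤ (i : ℕ) → Φ z i = 0) {s : Set (E m)}
    (hs : Convex ℝ s) (hst : s ⊆ Φ.target) {y a b : E m} (ha : IsNearestPoint N y a) (hb : b ∈ N)
    (has : a ∈ Φ.source) (hbs : b ∈ Φ.source) (hΦa : Φ a ∈ s) (hΦb : Φ b ∈ s)
    (hd : DifferentiableAt ℝ Φ.symm (Φ a)) :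
    ⟪y - a, fderiv ℝ Φ.symm (Φ a) (Φ b - Φ a)⟫ ≤ 0 := by
  have hline : HasDerivAt (fun t : ℝ => Φ a + t • (Φ b - Φ a)) (Φ b - Φ a) 0 := by
    simpa using ((hasDerivAt_id (0 : ℝ)).smul_const (Φ b - Φ a)).const_add (Φ a)
  have hcurve : HasDerivAt (fun t : ℝ => Φ.symm (Φ a + t • (Φ b - Φ a)))
      (fderiv ℝ Φ.symm (Φ a) (Φ b - Φ a)) 0 :=
    HasFDerivAt.comp_hasDerivAt_of_eq 0 hd.hasFDerivAt hline (by simp)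
  have hmem : ∀ t ∈ Icc (0 : ℝ) 1, Φ.symm (Φ a + t • (Φ b - Φ a)) ∈ N := fun t ht => by
    have htgt := hst (hs.add_smul_sub_mem hΦa hΦb ht)
    rw [hflat _ (Φ.map_target htgt), Φ.right_inv htgt]
    intro i hi
    simp [(hflat a has).1 ha.1 i hi, (hflat b hbs).1 hb i hi]
  simpa [Φ.left_inv has] using inner_nonpos_of_hasDerivAt_of_forall_norm_le hcurve fun t ht => by
    simpa [Φ.left_inv has] using ha.2 _ (hmem t ht)

lemma IsSmoothSubmanifold.exists_nhds_inner_le (hN : IsSmoothSubmanifold d N) {x : E m}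
    (hx : x ∈ N) :
    ∃ U ∈ 𝓝 x, ∃ κ : ℝ, 0 < κ ∧ ∀ y, ∀ a ∈ U, IsNearestPoint N y a → ∀ b ∈ N ∩ U,
      ⟪y - a, b - a⟫ ≤ κ * ‖y - a‖ * ‖b - a‖ ^ 2 := by
  obtain ⟨Φ, hxs, hΦ, hΨ, hflat⟩ := hN x hx
  have htgt : Φ.target ∈ 𝓝 (Φ x) := Φ.open_target.mem_nhds (Φ.map_source hxs)
  have hΦx : ContDiffAt ℝ ∞ Φ x := hΦ.contDiffAt (Φ.open_source.mem_nhds hxs)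
  obtain ⟨κ₁, t₁, ht₁, hL₁⟩ := ((hΨ.contDiffAt htgt).fderiv_right
    (m := 1) (by norm_cast)).exists_lipschitzOnWith
  obtain ⟨κ₂, t₂, ht₂, hL₂⟩ := (hΦx.of_le (m := 1) (by norm_cast)).exists_lipschitzOnWith
  obtain ⟨r, hr, hball⟩ := Metric.mem_nhds_iff.1 (inter_mem ht₁ htgt)
  have hdiff : ∀ z ∈ Metric.ball (Φ x) r, DifferentiableAt ℝ Φ.symm z := fun z hz =>
    (hΨ.contDiffAt (Φ.open_target.mem_nhds (hball hz).2)).differentiableAt (by simp)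
  refine ⟨t₂ ∩ (Φ.source ∩ Φ ⁻¹' Metric.ball (Φ x) r), inter_mem ht₂
    (inter_mem (Φ.open_source.mem_nhds hxs)
      (hΦx.continuousAt.preimage_mem_nhds (Metric.ball_mem_nhds _ hr))),
    κ₁ * κ₂ ^ 2 + 1, by positivity, ?_⟩
  rintro y a ⟨ha₂, has, haB⟩ ha b ⟨hbN, hb₂, hbs, hbB⟩
  set v := fderiv ℝ Φ.symm (Φ a) (Φ b - Φ a)
  have htangent : ⟪y - a, v⟫ ≤ 0 := ha.inner_fderiv_symm_nonpos hflat (convex_ball _ r)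
    (fun z hz => (hball hz).2) hbN has hbs haB hbB (hdiff _ haB)
  have hremainder : ‖b - a - v‖ ≤ (κ₁ * κ₂ ^ 2 + 1) * ‖b - a‖ ^ 2 := by
    have h := norm_image_sub_sub_fderiv_le_of_lipschitzOnWith (convex_ball _ r) hdiff
      (hL₁.mono fun z hz => (hball hz).1) haB hbB
    rw [Φ.left_inv has, Φ.left_inv hbs] at h
    calc ‖b - a - v‖ ≤ κ₁ * ‖Φ b - Φ a‖ ^ 2 := h
      _ ≤ κ₁ * (κ₂ * ‖b - a‖) ^ 2 := by
        gcongr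
        exact hL₂.norm_sub_le hb₂ ha₂
      _ ≤ (κ₁ * κ₂ ^ 2 + 1) * ‖b - a‖ ^ 2 := by linarith [sq_nonneg ‖b - a‖]
  calc ⟪y - a, b - a⟫ = ⟪y - a, v⟫ + ⟪y - a, b - a - v⟫ := by
        rw [← inner_add_right, add_sub_cancel]
    _ ≤ ‖y - a‖ * ‖b - a - v‖ := by linarith [real_inner_le_norm (y - a) (b - a - v)]
    _ ≤ ‖y - a‖ * ((κ₁ * κ₂ ^ 2 + 1) * ‖b - a‖ ^ 2) := by gcongr
    _ = (κ₁ * κ₂ ^ 2 + 1) * ‖y - a‖ * ‖b - a‖ ^ 2 := by ring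

lemma inner_le_inv_mul_of_le_norm {V : Type*} [NormedAddCommGroup V] [InnerProductSpace ℝ V]
    {r : ℝ} (hr : 0 < r) {v w : V} (h : r ≤ ‖w‖) : ⟪v, w⟫ ≤ r⁻¹ * ‖v‖ * ‖w‖ ^ 2 :=
  calc ⟪v, w⟫ ≤ ‖v‖ * ‖w‖ := real_inner_le_norm v w
    _ ≤ ‖v‖ * ‖w‖ * (r⁻¹ * ‖w‖) := le_mul_of_one_le_right (by positivity) <| by
        rwa [inv_mul_eq_div, one_le_div hr]
    _ = r⁻¹ * ‖v‖ * ‖w‖ ^ 2 := by ring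

theorem IsSmoothSubmanifold.hasPositiveReach (hN : IsSmoothSubmanifold d N) (hNc : IsCompact N) :
    HasPositiveReach N := by
  suffices h : ∃ κ : ℝ, 0 < κ ∧ ∀ q ∈ N ×ˢ N, ∀ y, IsNearestPoint N y q.1 →
      ⟪y - q.1, q.2 - q.1⟫ ≤ κ * ‖y - q.1‖ * ‖q.2 - q.1‖ ^ 2 by
    obtain ⟨κ, hκ, h⟩ := h
    exact ⟨κ, hκ, fun y a ha b hb => h (a, b) ⟨ha.1, hb⟩ y ha⟩
  refine (hNc.prod hNc).induction_on (p := fun S : Set (E m × E m) => ∃ κ : ℝ, 0 < κ ∧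
    ∀ q ∈ S, ∀ y, IsNearestPoint N y q.1 →
      ⟪y - q.1, q.2 - q.1⟫ ≤ κ * ‖y - q.1‖ * ‖q.2 - q.1‖ ^ 2) ⟨1, one_pos, by simp⟩ ?_ ?_ ?_
  · rintro S T hST ⟨κ, hκ, h⟩
    exact ⟨κ, hκ, fun q hq => h q (hST hq)⟩
  · rintro S T ⟨κ, hκ, hS⟩ ⟨κ', hκ', hT⟩
    refine ⟨κ + κ', by positivity, ?_⟩
    rintro q (hq | hq) y hy
    · exact (hS q hq y hy).trans (by gcongr; linarith)
    · exact (hT q hq y hy).trans (by gcongr; linarith)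
  · rintro ⟨a₀, b₀⟩ ⟨ha₀, -⟩
    rcases eq_or_ne a₀ b₀ with rfl | hne
    · obtain ⟨U, hU, κ, hκ, h⟩ := hN.exists_nhds_inner_le ha₀
      refine ⟨N ×ˢ N ∩ U ×ˢ U, inter_mem self_mem_nhdsWithin
        (mem_nhdsWithin_of_mem_nhds (prod_mem_nhds hU hU)), κ, hκ, ?_⟩
      rintro ⟨a, b⟩ ⟨⟨-, hb⟩, haU, hbU⟩ y hy
      exact h y a haU hy b ⟨hb, hbU⟩
    · have hpos : 0 < ‖b₀ - a₀‖ / 2 := half_pos (norm_pos_iff.2 (sub_ne_zero.2 hne.symm))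
      have hfar : {q : E m × E m | ‖b₀ - a₀‖ / 2 < ‖q.2 - q.1‖} ∈ 𝓝 (a₀, b₀) :=
        (isOpen_lt (by fun_prop) (by fun_prop)).mem_nhds
          (half_lt_self (norm_pos_iff.2 (sub_ne_zero.2 hne.symm)))
      exact ⟨_, mem_nhdsWithin_of_mem_nhds hfar, _, inv_pos.2 hpos,
        fun q hq y _ => inner_le_inv_mul_of_le_norm hpos (le_of_lt hq)⟩

end Submanifold

/-! ### The homogeneous retraction onto the skeleton of the grid `2 ℤⁿ + [-1, 1]ⁿ` -/

section Grid

/-- The truncation of a real number to `[-1, 1]`. -/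
def clamp (x : ℝ) : ℝ := max (-1) (min 1 x)

lemma clamp_le_one (x : ℝ) : clamp x ≤ 1 := max_le (by norm_num) (min_le_left _ _)

lemma neg_one_le_clamp (x : ℝ) : -1 ≤ clamp x := le_max_left _ _

lemma clamp_of_one_le {x : ℝ} (h : 1 ≤ x) : clamp x = 1 := by simp [clamp, h]

lemma clamp_of_le_neg_one {x : ℝ} (h : x ≤ -1) : clamp x = -1 := by
  rw [clamp, min_eq_right (by linarith), max_eq_left h]

lemma clamp_of_abs_le {x : ℝ} (h : |x| ≤ 1) : clamp x = x := by
  rw [clamp, min_eq_right (abs_le.1 h).2, max_eq_right (abs_le.1 h).1]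

lemma clamp_neg (x : ℝ) : clamp (-x) = -clamp x := by
  rcases le_total |x| 1 with h | h
  · rw [clamp_of_abs_le h, clamp_of_abs_le (by rwa [abs_neg])]
  rcases le_abs.1 h with h | h
  · rw [clamp_of_one_le h, clamp_of_le_neg_one (by linarith)]
  · rw [clamp_of_one_le h, clamp_of_le_neg_one (by linarith), neg_neg]

lemma clamp_div_eq_div_max {x t : ℝ} (ht : 0 < t) : clamp (x / t) = x / max t |x| := by
  rcases le_total |x| t with h | h
  · rw [max_eq_left h, clamp_of_abs_le (by rwa [abs_div, abs_of_pos ht, div_le_one ht])]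
  have hx : x ≠ 0 := abs_pos.1 (ht.trans_le h)
  rw [max_eq_right h]
  rcases le_abs.1 h with h | h
  · rw [clamp_of_one_le ((one_le_div ht).2 h), abs_of_pos (ht.trans_le h), div_self hx]
  · rw [clamp_of_le_neg_one (by rw [div_le_iff₀ ht]; linarith), abs_of_neg (by linarith), div_neg,
      div_self hx]

lemma abs_clamp_sub_clamp_le (x y : ℝ) : |clamp x - clamp y| ≤ |x - y| := by
  unfold clamp
  refine (abs_max_sub_max_le_max _ _ _ _).trans ?_
  rw [sub_self, abs_zero]
  refine max_le (abs_nonneg _) ((abs_min_sub_min_le_max _ _ _ _).trans ?_)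
  simp

lemma clamp_div_eq_sign {x t : ℝ} (ht : 0 < t) (h : t ≤ |x|) :
    clamp (x / t) = (SignType.sign x : ℝ) := by
  have hx : |x| ≠ 0 := (ht.trans_le h).ne'
  rw [clamp_div_eq_div_max ht, max_eq_right h, div_eq_iff hx, sign_mul_abs]

lemma one_sub_clamp_div_le {x t : ℝ} (ht : 0 < t) (ht1 : t ≤ 1) (hx : x ≤ 1) :
    1 - clamp (x / t) ≤ (1 - x) / t := by
  have hmin : min 1 (x / t) ≤ clamp (x / t) := le_max_right _ _
  have hone : 1 - 1 ≤ (1 - x) / t := by rw [sub_self]; exact div_nonneg (by linarith) ht.le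
  have hdiv : 1 - x / t ≤ (1 - x) / t := by
    rw [sub_div]
    gcongr
    exact (one_le_div ht).2 ht1
  rcases min_choice 1 (x / t) with h | h <;> rw [h] at hmin <;> linarith

lemma abs_clamp_div_sub_clamp_div_le {x t r : ℝ} (ht : 0 < t) (hr : 0 < r) :
    |clamp (x / t) - clamp (x / r)| ≤ |t - r| / r := by
  rw [clamp_div_eq_div_max ht, clamp_div_eq_div_max hr]
  set a := max t |x|
  set b := max r |x|
  have ha : 0 < a := lt_max_of_lt_left ht
  have hb : 0 < b := lt_max_of_lt_left hr
  have hba : |b - a| ≤ |t - r| := by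
    simpa [a, b, abs_sub_comm] using abs_max_sub_max_le_max r |x| t |x|
  calc |x / a - x / b| = |x| / a * (|b - a| / b) := by
        rw [div_sub_div _ _ ha.ne' hb.ne', mul_comm a x, ← mul_sub, abs_div, abs_mul,
          abs_of_pos (mul_pos ha hb), mul_div_mul_comm]
    _ ≤ 1 * (|t - r| / r) := by
        gcongr
        · exact (div_le_one ha).2 (le_max_right _ _)
        · exact le_max_left _ _
    _ = |t - r| / r := one_mul _

/-- The distance to the even integers, i.e. to the centres of the intervals of the grid
`2 ℤ + [-1, 1]`. -/
def evenDist (a : ℝ) : ℝ := |a - 2 * round (a / 2)|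

lemma evenDist_le (a : ℝ) (k : ℤ) : evenDist a ≤ |a - 2 * k| := by
  have h := round_le (a / 2) k
  unfold evenDist
  have e : ∀ c : ℝ, a - 2 * c = 2 * (a / 2 - c) := fun c => by ring
  rw [e, e, abs_mul, abs_mul]
  gcongr

lemma evenDist_nonneg (a : ℝ) : 0 ≤ evenDist a := abs_nonneg _

lemma evenDist_le_one (a : ℝ) : evenDist a ≤ 1 := by
  have h := abs_sub_round (a / 2)
  unfold evenDist
  rw [show a - 2 * (round (a / 2) : ℝ) = 2 * (a / 2 - round (a / 2)) by ring, abs_mul,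
    abs_two]
  linarith

lemma evenDist_le_add (a b : ℝ) : evenDist a ≤ evenDist b + |a - b| := by
  refine (evenDist_le a (round (b / 2))).trans ?_
  unfold evenDist
  have := abs_add_le (b - 2 * round (b / 2)) (a - b)
  rwa [show b - 2 * (round (b / 2) : ℝ) + (a - b) = a - 2 * round (b / 2) by ring] at this

lemma evenDist_eq {a : ℝ} {k : ℤ} (h : |a - 2 * k| ≤ 1) : evenDist a = |a - 2 * k| := by
  refine le_antisymm (evenDist_le a k) ?_
  by_cases hk : k = round (a / 2)
  · rw [hk]; rfl
  have hround : (1 : ℝ) ≤ |(k : ℝ) - round (a / 2)| := by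
    have : (1 : ℤ) ≤ |k - round (a / 2)| := Int.one_le_abs (sub_ne_zero.2 hk)
    exact_mod_cast this
  have htri := abs_sub_abs_le_abs_sub (2 * ((k : ℝ) - round (a / 2))) (-(a - 2 * k))
  rw [show 2 * ((k : ℝ) - round (a / 2)) - -(a - 2 * k) = a - 2 * round (a / 2) by ring, abs_neg,
    abs_mul, abs_two] at htri
  unfold evenDist
  linarith

lemma evenDist_add (a : ℝ) (k : ℤ) : evenDist (a + 2 * k) = evenDist a := by
  unfold evenDist
  rw [show (a + 2 * k) / 2 = a / 2 + k by ring, round_add_intCast]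
  push_cast
  congr 1
  ring

/-- On each interval `2k + [-1, 1]`, the dilation with centre `2k` and factor `t⁻¹`, truncated to
take values in the same interval. -/
def gridStretch (t a : ℝ) : ℝ := 2 * round (a / 2) + clamp ((a - 2 * round (a / 2)) / t)

lemma gridStretch_add (t a : ℝ) (k : ℤ) : gridStretch t (a + 2 * k) = gridStretch t a + 2 * k := by
  unfold gridStretch
  rw [show (a + 2 * k) / 2 = a / 2 + k by ring, round_add_intCast]
  push_cast
  rw [show a + 2 * (k : ℝ) - 2 * (round (a / 2) + k) = a - 2 * round (a / 2) by ring]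
  ring

lemma gridStretch_eq {t a : ℝ} (ht : 0 < t) (ht1 : t ≤ 1) {k : ℤ} (h : |a - 2 * k| ≤ 1) :
    gridStretch t a = 2 * k + clamp ((a - 2 * k) / t) := by
  have h' : |a - 2 * (round (a / 2) : ℝ)| ≤ 1 := evenDist_le_one a
  unfold gridStretch
  generalize round (a / 2) = l at h'
  rw [abs_le] at h h'
  have hlk : l ≤ k + 1 := by
    have : (l : ℝ) ≤ k + 1 := by linarith
    exact_mod_cast this
  have hkl : k ≤ l + 1 := by
    have : (k : ℝ) ≤ l + 1 := by linarith
    exact_mod_cast this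
  have hp : clamp (1 / t) = 1 := clamp_of_one_le ((one_le_div ht).2 ht1)
  have hm : clamp (-1 / t) = -1 := by rw [neg_div, clamp_neg, hp]
  obtain rfl | rfl | rfl : l = k ∨ l = k + 1 ∨ k = l + 1 := by omega
  · rfl
  · push_cast at *
    rw [show a - 2 * ((k : ℝ) + 1) = -1 by linarith, show a - 2 * (k : ℝ) = 1 by linarith, hp, hm]
    ring
  · push_cast at *
    rw [show a - 2 * ((l : ℝ) + 1) = -1 by linarith, show a - 2 * (l : ℝ) = 1 by linarith, hp, hm]
    ring

lemma abs_gridStretch_sub_self_le {t : ℝ} (ht : 0 ≤ t) (ht1 : t ≤ 1) (a : ℝ) :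
    |gridStretch t a - a| ≤ 1 := by
  have h' : |a - 2 * (round (a / 2) : ℝ)| ≤ 1 := evenDist_le_one a
  unfold gridStretch
  generalize round (a / 2) = l at h'
  rw [show 2 * (l : ℝ) + clamp ((a - 2 * l) / t) - a = clamp ((a - 2 * l) / t) - (a - 2 * l) by
    ring]
  generalize a - 2 * (l : ℝ) = x at h'
  rcases ht.eq_or_lt with rfl | ht
  · rw [div_zero, clamp_of_abs_le (by simp), zero_sub, abs_neg]
    exact h'
  rw [abs_le] at h'
  rcases le_total 0 x with hx | hx
  · have hsign : 0 ≤ clamp (x / t) := by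
      have := div_nonneg hx ht.le
      simp [clamp, this]
    have hclamp := clamp_le_one (x / t)
    rw [abs_le]; constructor <;> linarith
  · have hsign : clamp (x / t) ≤ 0 := by
      have := div_nonpos_of_nonpos_of_nonneg hx ht.le
      simp [clamp, this]
    have hclamp := neg_one_le_clamp (x / t)
    rw [abs_le]; constructor <;> linarith

lemma abs_gridStretch_sub_le_left {t r : ℝ} (ht : 0 < t) (hr : 0 < r) (a : ℝ) :
    |gridStretch t a - gridStretch r a| ≤ |t - r| / r := by
  unfold gridStretch
  rw [add_sub_add_left_eq_sub]
  exact abs_clamp_div_sub_clamp_div_le ht hr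

lemma abs_gridStretch_sub_le_right {t : ℝ} (ht : 0 < t) (ht1 : t ≤ 1) (a b : ℝ) :
    |gridStretch t a - gridStretch t b| ≤ |a - b| / t := by
  have ha : |a - 2 * (round (a / 2) : ℝ)| ≤ 1 := evenDist_le_one a
  have hb : |b - 2 * (round (b / 2) : ℝ)| ≤ 1 := evenDist_le_one b
  unfold gridStretch
  generalize round (a / 2) = k at ha
  generalize round (b / 2) = l at hb
  wlog hkl : k ≤ l generalizing a b k l
  · rw [abs_sub_comm, abs_sub_comm a b]
    exact this b a l hb k ha (by omega)
  rcases hkl.eq_or_lt with rfl | hkl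
  · rw [add_sub_add_left_eq_sub]
    refine (abs_clamp_sub_clamp_le _ _).trans_eq ?_
    rw [← sub_div, abs_div, abs_of_pos ht]
    congr 2
    ring
  have hkl' : (k : ℝ) + 1 ≤ l := by exact_mod_cast hkl
  rw [abs_le] at ha hb
  have hleft := one_sub_clamp_div_le ht ht1 ha.2
  have hright := one_sub_clamp_div_le (x := -(b - 2 * l)) ht ht1 (by linarith)
  rw [neg_div, clamp_neg] at hright
  have hle := clamp_le_one ((a - 2 * k) / t)
  have hge := neg_one_le_clamp ((b - 2 * l) / t)
  rw [abs_sub_comm, abs_sub_comm a b, abs_of_nonneg (by linarith : 0 ≤ b - a), abs_of_nonneg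
    (by linarith)]
  have hgap : 2 * (l : ℝ) - 2 * k - 2 ≤ (2 * (l : ℝ) - 2 * k - 2) / t := by
    rw [le_div_iff₀ ht]
    exact mul_le_of_le_one_right (by linarith) ht1
  calc _ = (1 - clamp ((a - 2 * k) / t)) + (1 - -clamp ((b - 2 * l) / t)) +
      (2 * (l : ℝ) - 2 * k - 2) := by ring
    _ ≤ (1 - (a - 2 * k)) / t + (1 - -(b - 2 * l)) / t + (2 * (l : ℝ) - 2 * k - 2) / t := by
      linarith
    _ = _ := by ring

lemma gridStretch_one (a : ℝ) : gridStretch 1 a = a := by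
  rw [gridStretch, div_one, clamp_of_abs_le (evenDist_le_one a), add_sub_cancel]

lemma gridStretch_of_evenDist_eq_one {t a : ℝ} (ht : 0 < t) (ht1 : t ≤ 1) (ha : evenDist a = 1) :
    gridStretch t a = a := by
  have ha' : |a - 2 * round (a / 2)| = 1 := ha
  rw [gridStretch, clamp_div_eq_div_max ht, ha', max_eq_right ht1, div_one, add_sub_cancel]

variable {n : ℕ}

/-- The `(j+1)`-th smallest among the distances of the coordinates to the even integers: the
sup-norm distance to the dual skeleton, of codimension `j+1`. -/
def depth (j : ℕ) (z : Fin n → ℝ) : ℝ :=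
  ⨅ A : {A : Finset (Fin n) // A.card = j + 1}, ⨆ i : A.1, evenDist (z i)

variable {j : ℕ}

lemma depth_le_iff (hj : j < n) {z : Fin n → ℝ} {c : ℝ} :
    depth j z ≤ c ↔ ∃ A : Finset (Fin n), A.card = j + 1 ∧ ∀ i ∈ A, evenDist (z i) ≤ c := by
  have : Nonempty {A : Finset (Fin n) // A.card = j + 1} := by
    obtain ⟨A, -, hA⟩ := Finset.exists_subset_card_eq
      (s := (Finset.univ : Finset (Fin n))) (n := j + 1) (by simpa using hj)
    exact ⟨⟨A, hA⟩⟩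
  constructor
  · intro h
    obtain ⟨A, hA⟩ := exists_eq_ciInf_of_finite
      (f := fun A : {A : Finset (Fin n) // A.card = j + 1} => ⨆ i : A.1, evenDist (z i))
    refine ⟨A.1, A.2, fun i hi => le_trans ?_ (hA.le.trans h)⟩
    exact le_ciSup (f := fun i : A.1 => evenDist (z i)) (Set.finite_range _).bddAbove ⟨i, hi⟩
  · rintro ⟨A, hA, h⟩
    have : Nonempty A := (Finset.card_pos.1 (by omega)).to_subtype
    exact (ciInf_le (Set.finite_range _).bddBelow ⟨A, hA⟩).trans (ciSup_le fun i => h i i.2)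

lemma depth_nonneg (j : ℕ) (z : Fin n → ℝ) : 0 ≤ depth j z :=
  Real.iInf_nonneg fun _ => Real.iSup_nonneg fun _ => evenDist_nonneg _

lemma depth_le_one (hj : j < n) (z : Fin n → ℝ) : depth j z ≤ 1 := by
  obtain ⟨A, -, hA⟩ := Finset.exists_subset_card_eq
    (s := (Finset.univ : Finset (Fin n))) (n := j + 1) (by simpa using hj)
  exact (depth_le_iff hj).2 ⟨A, hA, fun i _ => evenDist_le_one _⟩

lemma depth_le_add (hj : j < n) {y z : Fin n → ℝ} {c : ℝ} (h : ∀ i, |y i - z i| ≤ c) :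
    depth j y ≤ depth j z + c := by
  obtain ⟨A, hA, hz⟩ := (depth_le_iff hj).1 (le_refl (depth j z))
  exact (depth_le_iff hj).2 ⟨A, hA, fun i hi =>
    (evenDist_le_add _ (z i)).trans (add_le_add (hz i hi) (h i))⟩

lemma abs_depth_sub_le (hj : j < n) {y z : Fin n → ℝ} {c : ℝ} (h : ∀ i, |y i - z i| ≤ c) :
    |depth j y - depth j z| ≤ c := by
  have hyz := depth_le_add hj h
  have hzy := depth_le_add hj (y := z) (z := y) (c := c) fun i => abs_sub_comm (y i) (z i) ▸ h i
  rw [abs_le]; constructor <;> linarith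

lemma depth_add (z : Fin n → ℝ) (k : Fin n → ℤ) :
    depth j (fun i => z i + 2 * k i) = depth j z := by
  simp only [depth, evenDist_add]

lemma card_filter_depth_le (hj : j < n) (z : Fin n → ℝ) :
    n - j ≤ (Finset.univ.filter fun i => depth j z ≤ evenDist (z i)).card := by
  by_contra! h
  have hc := Finset.card_filter_add_card_filter_not (s := (Finset.univ : Finset (Fin n)))
    (fun i => depth j z ≤ evenDist (z i))
  rw [Finset.card_univ, Fintype.card_fin] at hc
  obtain ⟨A, hAs, hA⟩ := Finset.exists_subset_card_eq
    (s := Finset.univ.filter fun i => ¬ depth j z ≤ evenDist (z i)) (n := j + 1) (by omega)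
  have hne : A.Nonempty := Finset.card_pos.1 (by omega)
  obtain ⟨i, hi, hmax⟩ := A.exists_max_image (fun i => evenDist (z i)) hne
  have hle : depth j z ≤ evenDist (z i) := (depth_le_iff hj).2 ⟨A, hA, hmax⟩
  have hlt := hAs hi
  simp only [Finset.mem_filter, Finset.mem_univ, true_and] at hlt
  exact hlt hle

lemma depth_eq_one (hj : j < n) {z : Fin n → ℝ} {B : Finset (Fin n)} (hB : n - j ≤ B.card)
    (h : ∀ i ∈ B, evenDist (z i) = 1) : depth j z = 1 := by
  refine le_antisymm (depth_le_one hj z) ?_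
  obtain ⟨A, hA, hz⟩ := (depth_le_iff hj).1 (le_refl (depth j z))
  have : ¬ Disjoint A B := fun hd => by
    have hcard := Finset.card_union_of_disjoint hd
    have huniv := Finset.card_le_univ (A ∪ B)
    rw [Fintype.card_fin] at huniv
    omega
  obtain ⟨i, hiA, hiB⟩ := Finset.not_disjoint_iff.1 this
  exact (h i hiB).ge.trans (hz i hiA)

/-- The retraction onto the `j`-skeleton of the grid `2 ℤⁿ + [-1, 1]ⁿ`. Composing the radial
projections of the faces of dimensions `n, …, j + 1` amounts to stretching all coordinates by the
same factor, the inverse of the depth. -/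
def skelProj (j : ℕ) (z : E n) : E n :=
  WithLp.toLp 2 fun i => gridStretch (depth j z) (z i)

lemma skelProj_apply (z : E n) (i : Fin n) :
    skelProj j z i = gridStretch (depth j z) (z i) := rfl

lemma abs_apply_le_norm (z : E n) (i : Fin n) : |z i| ≤ ‖z‖ := PiLp.norm_apply_le z i

lemma norm_le_sqrt_mul {z : E n} {c : ℝ} (hc : 0 ≤ c) (h : ∀ i, |z i| ≤ c) :
    ‖z‖ ≤ √n * c := by
  rw [EuclideanSpace.norm_eq]
  calc √(∑ i, ‖z i‖ ^ 2) ≤ √(∑ _i : Fin n, c ^ 2) := by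
        gcongr with i
        exact h i
    _ = √n * c := by
        rw [Finset.sum_const, Finset.card_univ, Fintype.card_fin, nsmul_eq_mul,
          Real.sqrt_mul (by positivity), Real.sqrt_sq hc]

lemma norm_skelProj_sub_self_le (hj : j < n) (z : E n) : ‖skelProj j z - z‖ ≤ √n := by
  have := norm_le_sqrt_mul (z := skelProj j z - z) zero_le_one fun i => by
    rw [PiLp.sub_apply, skelProj_apply]
    exact abs_gridStretch_sub_self_le (depth_nonneg _ _) (depth_le_one hj _) _
  simpa using this

lemma norm_skelProj_sub_le (hj : j < n) {y z : E n} (hy : depth j y ≠ 0) (hz : depth j z ≠ 0) :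
    ‖skelProj j y - skelProj j z‖ ≤ 2 * √n * ‖y - z‖ / depth j z := by
  have hy' : 0 < depth j y := (depth_nonneg _ _).lt_of_ne' hy
  have hz' : 0 < depth j z := (depth_nonneg _ _).lt_of_ne' hz
  refine (norm_le_sqrt_mul (c := 2 * ‖y - z‖ / depth j z) (by positivity) fun i => ?_).trans_eq
    (by ring)
  have hi : |y i - z i| ≤ ‖y - z‖ := abs_apply_le_norm (y - z) i
  rw [PiLp.sub_apply, skelProj_apply, skelProj_apply]
  calc _ ≤ |gridStretch (depth j y) (y i) - gridStretch (depth j z) (y i)| +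
        |gridStretch (depth j z) (y i) - gridStretch (depth j z) (z i)| := abs_sub_le _ _ _
    _ ≤ |depth j y - depth j z| / depth j z + |y i - z i| / depth j z :=
        add_le_add (abs_gridStretch_sub_le_left hy' hz' _)
          (abs_gridStretch_sub_le_right hz' (depth_le_one hj _) _ _)
    _ ≤ ‖y - z‖ / depth j z + ‖y - z‖ / depth j z := by
        gcongr
        exact abs_depth_sub_le hj fun i => abs_apply_le_norm (y - z) i
    _ = _ := by ring

lemma skelProj_add (z : E n) (k : Fin n → ℤ) :
    skelProj j (z + WithLp.toLp 2 fun i => 2 * (k i : ℝ)) =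
      skelProj j z + WithLp.toLp 2 fun i => 2 * (k i : ℝ) := by
  ext i
  rw [PiLp.add_apply, skelProj_apply, skelProj_apply]
  have : depth j (z + WithLp.toLp 2 fun i => 2 * (k i : ℝ) : E n) = depth j z := depth_add z k
  rw [this, PiLp.add_apply]
  exact gridStretch_add _ _ _

lemma continuous_depth (hj : j < n) : Continuous fun z : E n => depth j z :=
  LipschitzWith.continuous (K := 1) <| LipschitzWith.of_dist_le_mul fun y z => by
    rw [NNReal.coe_one, one_mul, Real.dist_eq, dist_eq_norm]
    exact abs_depth_sub_le hj fun i => abs_apply_le_norm (y - z) i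

lemma measurable_evenRound : Measurable fun a : ℝ => 2 * (round (a / 2) : ℝ) := by
  simp only [round_eq]
  fun_prop

lemma measurable_skelProj (hj : j < n) : Measurable (skelProj j : E n → E n) := by
  refine (WithLp.measurable_toLp 2 _).comp (measurable_pi_lambda _ fun i => ?_)
  have hdepth : Measurable fun z : E n => depth j z := (continuous_depth hj).measurable
  have hround : Measurable fun z : E n => 2 * (round (z i / 2) : ℝ) :=
    measurable_evenRound.comp (by fun_prop)
  unfold gridStretch clamp
  fun_prop

/-- The retraction onto the `j`-skeleton of the grid `-ε τ + 2 ε ℤⁿ + [-ε, ε]ⁿ`. -/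
def gridProj (j : ℕ) (ε : ℝ) (τ x : E n) : E n := ε • (skelProj j (ε⁻¹ • x + τ) - τ)

lemma gridProj_eq {ε : ℝ} (hε : ε ≠ 0) (τ x : E n) :
    gridProj j ε τ x = x + ε • (skelProj j (ε⁻¹ • x + τ) - (ε⁻¹ • x + τ)) := by
  rw [gridProj, smul_sub, smul_sub, smul_add, smul_inv_smul₀ hε]
  abel

lemma measurable_gridProj {α : Type*} [MeasurableSpace α] (hj : j < n) (ε : ℝ) {f g : α → E n}
    (hf : Measurable f) (hg : Measurable g) : Measurable fun a => gridProj j ε (f a) (g a) :=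
  (((measurable_skelProj hj).comp ((hg.const_smul ε⁻¹).add hf)).sub hf).const_smul ε

lemma measurable_evenDist : Measurable evenDist :=
  measurable_id.sub measurable_evenRound |>.norm

end Grid

/-! ### Piecewise homogeneous maps on a mesh -/

section FaceDilation

variable {n j : ℕ}

/-- In the grid `2 ℤⁿ + [-1, 1]ⁿ`, the point `y` is the image of `z` under the dilation of factor
`r⁻¹` about the centre of a face that contains both. The face lies in the cube with centre `2 k`
and `F` is the set of its free coordinates. -/
structure IsFaceDilation (k : Fin n → ℤ) (F : Finset (Fin n)) (r : ℝ) (z y : Fin n → ℝ) :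
    Prop where
  pos : 0 < r
  le_one : r ≤ 1
  abs_le : ∀ i ∈ F, |z i - 2 * k i| ≤ r
  sub_eq_div : ∀ i ∈ F, y i - 2 * k i = (z i - 2 * k i) / r
  abs_eq_one : ∀ i ∉ F, |z i - 2 * k i| = 1
  apply_eq : ∀ i ∉ F, y i = z i

namespace IsFaceDilation

variable {k : Fin n → ℤ} {F : Finset (Fin n)} {r : ℝ} {z y : Fin n → ℝ}

lemma abs_sub_le_one (h : IsFaceDilation k F r z y) (i : Fin n) : |z i - 2 * k i| ≤ 1 := by
  by_cases hi : i ∈ F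
  · exact (h.abs_le i hi).trans h.le_one
  · exact (h.abs_eq_one i hi).le

lemma abs_image_sub_le_one (h : IsFaceDilation k F r z y) {i : Fin n} (hi : i ∈ F) :
    |y i - 2 * k i| ≤ 1 := by
  rw [h.sub_eq_div i hi, abs_div, abs_of_pos h.pos, div_le_one h.pos]
  exact h.abs_le i hi

lemma evenDist_apply (h : IsFaceDilation k F r z y) (i : Fin n) :
    evenDist (z i) = |z i - 2 * k i| :=
  evenDist_eq (h.abs_sub_le_one i)

lemma evenDist_image (h : IsFaceDilation k F r z y) {i : Fin n} (hi : i ∈ F) :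
    evenDist (y i) = evenDist (z i) / r := by
  rw [evenDist_eq (h.abs_image_sub_le_one hi), h.evenDist_apply, h.sub_eq_div i hi, abs_div,
    abs_of_pos h.pos]

lemma evenDist_eq_one (h : IsFaceDilation k F r z y) {i : Fin n} (hi : i ∉ F) :
    evenDist (z i) = 1 :=
  (h.evenDist_apply i).trans (h.abs_eq_one i hi)

lemma depth_le (h : IsFaceDilation k F r z y) (hj : j < n) (hF : j < F.card) : depth j z ≤ r := by
  obtain ⟨A, hAF, hA⟩ := Finset.exists_subset_card_eq (Nat.succ_le_of_lt hF)
  exact (depth_le_iff hj).2 ⟨A, hA, fun i hi => h.evenDist_apply i ▸ h.abs_le i (hAF hi)⟩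

lemma depth_image (h : IsFaceDilation k F r z y) (hj : j < n) (hF : j < F.card) :
    depth j y = depth j z / r := by
  have hr := h.pos
  apply le_antisymm
  · obtain ⟨A, hA, hz⟩ := (depth_le_iff hj).1 (le_refl (depth j z))
    refine (depth_le_iff hj).2 ⟨A, hA, fun i hi => ?_⟩
    by_cases hiF : i ∈ F
    · rw [h.evenDist_image hiF]
      exact div_le_div_of_nonneg_right (hz i hi) hr.le
    · have hone : 1 ≤ depth j z := h.evenDist_eq_one hiF ▸ hz i hi
      rw [h.apply_eq i hiF, h.evenDist_eq_one hiF, one_le_div hr]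
      exact h.le_one.trans hone
  · rw [div_le_iff₀ hr]
    obtain ⟨A, hA, hy⟩ := (depth_le_iff hj).1 (le_refl (depth j y))
    by_cases hAF : A ⊆ F
    · refine (depth_le_iff hj).2 ⟨A, hA, fun i hi => ?_⟩
      rw [← div_le_iff₀ hr, ← h.evenDist_image (hAF hi)]
      exact hy i hi
    · obtain ⟨i, hi, hiF⟩ := Finset.not_subset.1 hAF
      have hone : 1 ≤ depth j y := by
        rw [← h.evenDist_eq_one hiF, ← h.apply_eq i hiF]
        exact hy i hi
      exact (h.depth_le hj hF).trans (le_mul_of_one_le_left hr.le hone)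

lemma gridStretch_image (h : IsFaceDilation k F r z y) (hj : j < n) (hF : j < F.card)
    (hz : depth j z ≠ 0) (i : Fin n) :
    gridStretch (depth j y) (y i) = gridStretch (depth j z) (z i) := by
  have hz0 : 0 < depth j z := (depth_nonneg _ _).lt_of_ne' hz
  have hy0 : 0 < depth j y := h.depth_image hj hF ▸ div_pos hz0 h.pos
  by_cases hi : i ∈ F
  · rw [gridStretch_eq hz0 (depth_le_one hj _) (h.abs_sub_le_one i),
      gridStretch_eq hy0 (depth_le_one hj _) (h.abs_image_sub_le_one hi), h.sub_eq_div i hi,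
      h.depth_image hj hF, div_div_div_cancel_right₀ h.pos.ne']
  · rw [h.apply_eq i hi,
      gridStretch_of_evenDist_eq_one hz0 (depth_le_one hj _) (h.evenDist_eq_one hi),
      gridStretch_of_evenDist_eq_one hy0 (depth_le_one hj _) (h.evenDist_eq_one hi)]

end IsFaceDilation

end FaceDilation

lemma abs_coe_signType_of_ne_zero {a : SignType} (h : a ≠ 0) : |(a : ℝ)| = 1 := by
  cases a <;> simp_all

namespace Mesh

variable {n m j : ℕ} (M : Mesh n)

/-- The position of the grid of the mesh after rescaling to cubes of half side length `1`. -/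
def phase : E n := -(M.ε⁻¹ • M.T)

/-- Coordinates in which the grid of the mesh is `2 ℤⁿ + [-1, 1]ⁿ`. -/
def coord (x : E n) : E n := M.ε⁻¹ • x + M.phase

/-- The retraction onto the `j`-skeleton of the grid of the mesh. -/
def proj (j : ℕ) (x : E n) : E n := gridProj j M.ε M.phase x

lemma coord_apply (x : E n) (i : Fin n) : M.coord x i = (x i - M.T i) / M.ε := by
  simp only [coord, phase, PiLp.add_apply, PiLp.smul_apply, PiLp.neg_apply, smul_eq_mul]
  ring

lemma coord_proj (x : E n) : M.coord (M.proj j x) = skelProj j (M.coord x) := by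
  rw [coord, proj, gridProj, inv_smul_smul₀ M.ε_pos.ne', sub_add_cancel, coord]

lemma coord_sub_coord (x y : E n) : M.coord x - M.coord y = M.ε⁻¹ • (x - y) := by
  rw [coord, coord, add_sub_add_right_eq_sub, smul_sub]

lemma coord_injective : Function.Injective M.coord := fun x y h => by
  rw [← sub_eq_zero, coord_sub_coord, smul_eq_zero_iff_right (inv_ne_zero M.ε_pos.ne')] at h
  exact sub_eq_zero.1 h

lemma coord_faceCenter (K : Fin n → ℤ) (e : Fin n → SignType) (i : Fin n) :
    M.coord (M.faceCenter K e) i = 2 * K i + (e i : ℝ) := by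
  have := M.ε_pos.ne'
  rw [coord_apply, faceCenter]
  field_simp
  ring

lemma mem_face_iff {K : Fin n → ℤ} {e : Fin n → SignType} {x : E n} :
    x ∈ M.face K e ↔ ∀ i, if e i = 0 then |M.coord x i - 2 * K i| ≤ 1
      else M.coord x i - 2 * K i = (e i : ℝ) := by
  have hε := M.ε_pos
  refine forall_congr' fun i => ?_
  have hsub : x i - M.faceCenter K e i = M.ε * (M.coord x i - 2 * K i - (e i : ℝ)) := by
    have h := M.coord_faceCenter K e i
    rw [coord_apply] at h ⊢
    field_simp at h ⊢
    linarith
  split_ifs with he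
  · rw [hsub, he, abs_mul, abs_of_pos hε, SignType.coe_zero, sub_zero,
      mul_le_iff_le_one_right hε]
  · rw [← sub_eq_zero, hsub, mul_eq_zero, or_iff_right hε.ne', sub_eq_zero]

lemma coord_sub_eq_of_mem_face {K : Fin n → ℤ} {e : Fin n → SignType} {x : E n}
    (hx : x ∈ M.face K e) {i : Fin n} (hi : e i ≠ 0) : M.coord x i - 2 * K i = (e i : ℝ) := by
  simpa only [hi, if_false] using M.mem_face_iff.1 hx i

lemma abs_coord_sub_le_one {K : Fin n → ℤ} {e : Fin n → SignType} {x : E n}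
    (hx : x ∈ M.face K e) (i : Fin n) : |M.coord x i - 2 * K i| ≤ 1 := by
  by_cases hi : e i = 0
  · simpa only [hi, if_true] using M.mem_face_iff.1 hx i
  · exact (M.coord_sub_eq_of_mem_face hx hi ▸ abs_coe_signType_of_ne_zero hi).le

lemma face_subset (K : Fin n → ℤ) (e : Fin n → SignType) : M.face K e ⊆ M.face K 0 := fun x hx =>
  M.mem_face_iff.2 fun i => by simpa using M.abs_coord_sub_le_one hx i

lemma skeleton_subset_carrier (j : ℕ) : M.skeleton j ⊆ M.carrier :=
  iUnion₂_mono fun K _ => iUnion₂_subset fun e _ => M.face_subset K e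

lemma faceDim_le (e : Fin n → SignType) : faceDim e ≤ n := by
  simpa [faceDim] using Finset.card_filter_le (Finset.univ : Finset (Fin n)) fun i => e i = 0

lemma exists_evenDist_eq_one_of_mem_skeleton {x : E n} (hx : x ∈ M.skeleton j) :
    ∃ B : Finset (Fin n), B.card = n - j ∧ ∀ i ∈ B, evenDist (M.coord x i) = 1 := by
  simp only [skeleton, mem_iUnion, mem_ofPred_eq, exists_prop] at hx
  obtain ⟨K, -, e, he, hxe⟩ := hx
  refine ⟨Finset.univ.filter fun i => ¬ e i = 0, ?_, fun i hi => ?_⟩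
  · have hc := Finset.card_filter_add_card_filter_not (s := (Finset.univ : Finset (Fin n)))
      (fun i => e i = 0)
    rw [Finset.card_univ, Fintype.card_fin] at hc
    unfold faceDim at he
    omega
  · have hi0 : e i ≠ 0 := (Finset.mem_filter.1 hi).2
    rw [evenDist_eq (M.abs_coord_sub_le_one hxe i), M.coord_sub_eq_of_mem_face hxe hi0,
      abs_coe_signType_of_ne_zero hi0]

lemma depth_coord_of_mem_skeleton (hj : j < n) {x : E n} (hx : x ∈ M.skeleton j) :
    depth j (M.coord x) = 1 := by
  obtain ⟨B, hB, h⟩ := M.exists_evenDist_eq_one_of_mem_skeleton hx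
  exact depth_eq_one hj hB.ge h

lemma proj_of_mem_skeleton (hj : j < n) {x : E n} (hx : x ∈ M.skeleton j) : M.proj j x = x := by
  apply M.coord_injective
  ext i
  rw [coord_proj, skelProj_apply, M.depth_coord_of_mem_skeleton hj hx, gridStretch_one]

lemma proj_mem_skeleton (hj : j < n) {x : E n} (hx : x ∈ M.carrier)
    (hd : depth j (M.coord x) ≠ 0) : M.proj j x ∈ M.skeleton j := by
  obtain ⟨K, hK, hxK⟩ := mem_iUnion₂.1 hx
  have hd0 : 0 < depth j (M.coord x) := (depth_nonneg _ _).lt_of_ne' hd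
  obtain ⟨B, hBs, hB⟩ := Finset.exists_subset_card_eq (card_filter_depth_le hj (M.coord x))
  classical
  have hlow : ∀ i ∈ B, depth j (M.coord x) ≤ |M.coord x i - 2 * K i| := fun i hi => by
    rw [← evenDist_eq (M.abs_coord_sub_le_one hxK i)]
    exact (Finset.mem_filter.1 (hBs hi)).2
  let e : Fin n → SignType := fun i => if i ∈ B then SignType.sign (M.coord x i - 2 * K i) else 0
  have he : ∀ i, e i = 0 ↔ i ∉ B := fun i => by
    by_cases hi : i ∈ B
    · simpa [e, hi] using abs_pos.1 (hd0.trans_le (hlow i hi))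
    · simp [e, hi]
  have hdim : faceDim e = j := by
    have : (Finset.univ.filter fun i => e i = 0) = Bᶜ := by ext i; simp [he]
    rw [faceDim, this, Finset.card_compl, hB, Fintype.card_fin]
    omega
  have hface : M.proj j x ∈ M.face K e := M.mem_face_iff.2 fun i => by
    rw [coord_proj, skelProj_apply,
      gridStretch_eq hd0 (depth_le_one hj _) (M.abs_coord_sub_le_one hxK i), add_sub_cancel_left]
    split_ifs with h
    · exact abs_le.2 ⟨neg_one_le_clamp _, clamp_le_one _⟩
    · have hi : i ∈ B := not_not.1 (mt (he i).2 h)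
      simp only [e, hi, if_true]
      exact clamp_div_eq_sign hd0 (hlow i hi)
  exact mem_iUnion₂.2 ⟨K, hK, mem_iUnion₂.2 ⟨e, hdim, hface⟩⟩

lemma coord_radialProj (K : Fin n → ℤ) (e : Fin n → SignType) (x : E n) :
    M.coord (M.radialProj K e x) = M.coord (M.faceCenter K e) +
      ‖WithLp.ofLp (M.coord x - M.coord (M.faceCenter K e))‖⁻¹ •
        (M.coord x - M.coord (M.faceCenter K e)) := by
  have hε := M.ε_pos
  rw [← sub_eq_iff_eq_add', coord_sub_coord, coord_sub_coord, radialProj, add_sub_cancel_left,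
    WithLp.ofLp_smul, norm_smul, norm_inv, Real.norm_of_nonneg hε.le, smul_smul, smul_smul]
  congr 1
  field_simp

lemma isFaceDilation_radialProj {K : Fin n → ℤ} {e : Fin n → SignType} {x : E n}
    (hx : x ∈ M.face K e) (hxc : x ≠ M.faceCenter K e) :
    ∃ r, IsFaceDilation K (Finset.univ.filter fun i => e i = 0) r (M.coord x)
      (M.coord (M.radialProj K e x)) := by
  set v := M.coord x - M.coord (M.faceCenter K e) with hv
  have hvi : ∀ i, v i = M.coord x i - 2 * K i - (e i : ℝ) := fun i => by
    rw [hv, PiLp.sub_apply, coord_faceCenter, sub_sub]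
  have hrad : ∀ i, M.coord (M.radialProj K e x) i = 2 * K i + e i + ‖v.ofLp‖⁻¹ * v i := fun i => by
    rw [coord_radialProj, PiLp.add_apply, coord_faceCenter, PiLp.smul_apply, smul_eq_mul]
  have hfree : ∀ i, e i = 0 → v i = M.coord x i - 2 * K i := fun i hi => by
    rw [hvi, hi, SignType.coe_zero, sub_zero]
  have hfixed : ∀ i, e i ≠ 0 → v i = 0 := fun i hi => by
    rw [hvi, M.coord_sub_eq_of_mem_face hx hi, sub_self]
  refine ⟨‖v.ofLp‖, ?_, ?_, fun i hi => ?_, fun i hi => ?_, fun i hi => ?_, fun i hi => ?_⟩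
  · refine norm_pos_iff.2 fun h => hxc (M.coord_injective (sub_eq_zero.1 ?_))
    exact (WithLp.ofLp_eq_zero 2).1 h
  · refine (pi_norm_le_iff_of_nonneg zero_le_one).2 fun i => ?_
    by_cases hi : e i = 0
    · rw [hfree i hi]
      exact M.abs_coord_sub_le_one hx i
    · rw [hfixed i hi, norm_zero]
      exact zero_le_one
  all_goals simp only [Finset.mem_filter, Finset.mem_univ, true_and] at hi
  · rw [← hfree i hi]
    exact norm_le_pi_norm v.ofLp i
  · rw [hrad, hi, ← hfree i hi, SignType.coe_zero, add_zero, add_sub_cancel_left,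
      inv_mul_eq_div]
  · rw [M.coord_sub_eq_of_mem_face hx hi, abs_coe_signType_of_ne_zero hi]
  · rw [hrad, hfixed i hi, mul_zero, add_zero, ← M.coord_sub_eq_of_mem_face hx hi,
      add_sub_cancel]

/-- The piecewise `j`-homogeneous map that agrees with `g` on the `j`-skeleton of the mesh. It
takes the value `o` on the dual skeleton, where the successive radial projections are undefined. -/
def homogeneousExt (j : ℕ) (o : E m) (g : E n → E m) (x : E n) : E m :=
  if depth j (M.coord x) = 0 then o else g (M.proj j x)

variable {M}

lemma homogeneousExt_of_depth_ne_zero {o : E m} {g : E n → E m} {x : E n}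
    (hx : depth j (M.coord x) ≠ 0) : M.homogeneousExt j o g x = g (M.proj j x) :=
  if_neg hx

lemma homogeneousExt_of_mem_skeleton (hj : j < n) {o : E m} {g : E n → E m} {x : E n}
    (hx : x ∈ M.skeleton j) : M.homogeneousExt j o g x = g x := by
  rw [homogeneousExt_of_depth_ne_zero (by simp [M.depth_coord_of_mem_skeleton hj hx]),
    M.proj_of_mem_skeleton hj hx]

lemma homogeneousExt_mem (hj : j < n) {o : E m} {g : E n → E m} {s : Set (E m)} (ho : o ∈ s)
    (hg : MapsTo g (M.skeleton j) s) {x : E n} (hx : x ∈ M.carrier) :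
    M.homogeneousExt j o g x ∈ s := by
  unfold homogeneousExt
  split_ifs with h
  · exact ho
  · exact hg (M.proj_mem_skeleton hj hx h)

variable (M)

theorem isPiecewiseHomogeneous_homogeneousExt (j : ℕ) (o : E m) (g : E n → E m) :
    M.IsPiecewiseHomogeneous j (M.homogeneousExt j o g) := by
  intro K _ e he x hx hxc
  have hj : j < n := he.trans_le (faceDim_le e)
  obtain ⟨r, hr⟩ := M.isFaceDilation_radialProj hx hxc
  have hdepth := hr.depth_image hj he
  by_cases h0 : depth j (M.coord x) = 0
  · have h0' : depth j (M.coord (M.radialProj K e x)) = 0 := by rw [hdepth, h0, zero_div]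
    simp only [homogeneousExt, h0, h0', if_true]
  rw [homogeneousExt_of_depth_ne_zero h0,
    homogeneousExt_of_depth_ne_zero (hdepth ▸ div_ne_zero h0 hr.pos.ne')]
  congr 1
  apply M.coord_injective
  ext i
  rw [coord_proj, coord_proj, skelProj_apply, skelProj_apply, hr.gridStretch_image hj he h0]

lemma norm_sub_le_of_mem_face {K : Fin n → ℤ} {x y : E n} (hx : x ∈ M.face K 0)
    (hy : y ∈ M.face K 0) : ‖x - y‖ ≤ √n * (2 * M.ε) := by
  have hε := M.ε_pos
  refine norm_le_sqrt_mul (by positivity) fun i => ?_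
  have hx := hx i
  have hy := hy i
  simp only [Pi.zero_apply, if_true] at hx hy
  rw [PiLp.sub_apply]
  rw [abs_le] at hx hy ⊢
  constructor <;> linarith

lemma isCompact_face (K : Fin n → ℤ) (e : Fin n → SignType) : IsCompact (M.face K e) := by
  refine Metric.isCompact_of_isClosed_isBounded ?_ ?_
  · simp only [face, Set.ofPred_forall]
    refine isClosed_iInter fun i => ?_
    split_ifs
    · exact isClosed_le (by fun_prop) continuous_const
    · exact isClosed_eq (by fun_prop) continuous_const
  · refine Metric.isBounded_iff.2 ⟨√n * (2 * M.ε), fun x hx y hy => ?_⟩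
    rw [dist_eq_norm]
    exact M.norm_sub_le_of_mem_face (M.face_subset K e hx) (M.face_subset K e hy)

lemma isCompact_carrier : IsCompact M.carrier :=
  M.cells.isCompact_biUnion fun K _ => M.isCompact_face K 0

lemma mem_face_round (x : E n) : x ∈ M.face (fun i => round (M.coord x i / 2)) 0 :=
  M.mem_face_iff.2 fun i => by
    rw [Pi.zero_apply, if_pos rfl]
    exact evenDist_le_one (M.coord x i)

lemma finite_setOf_face_inter_nonempty {S : Set (E n)} (hS : Bornology.IsBounded S) :
    {K : Fin n → ℤ | (M.face K 0 ∩ S).Nonempty}.Finite := by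
  obtain ⟨R, hR⟩ := (Metric.isBounded_iff_subset_closedBall M.T).1 hS
  refine (Set.Finite.pi' fun _ : Fin n =>
    (Int.isClosedEmbedding_coe_real.isCompact_preimage
      (isCompact_closedBall (0 : ℝ) (R / M.ε + 1))).finite_of_discrete).subset ?_
  rintro K ⟨x, hx, hxS⟩ i
  have hcell := abs_le.1 (M.abs_coord_sub_le_one hx i)
  have hcoord : |M.coord x i| ≤ R / M.ε := by
    rw [coord_apply, abs_div, abs_of_pos M.ε_pos]
    gcongr
    · exact M.ε_pos.le
    · exact (abs_apply_le_norm (x - M.T) i).trans (mem_closedBall_iff_norm.1 (hR hxS))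
  rw [mem_preimage, mem_closedBall_zero_iff, Real.norm_eq_abs]
  rw [abs_le] at hcoord ⊢
  constructor <;> linarith

lemma exists_covering (τ : E n) {ε : ℝ} (hε : 0 < ε) {S : Set (E n)}
    (hS : Bornology.IsBounded S) :
    ∃ M : Mesh n, M.ε = ε ∧ M.phase = τ ∧ S ⊆ M.carrier ∧
      M.carrier ⊆ Metric.cthickening (√n * (2 * ε)) S := by
  let M₀ : Mesh n := ⟨-(ε • τ), ε, hε, ∅⟩
  have hfin := M₀.finite_setOf_face_inter_nonempty hS
  refine ⟨⟨-(ε • τ), ε, hε, hfin.toFinset⟩, rfl, ?_, fun x hx => ?_, fun x hx => ?_⟩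
  · rw [phase, smul_neg, neg_neg, inv_smul_smul₀ hε.ne']
  · exact mem_iUnion₂.2 ⟨_, hfin.mem_toFinset.2 ⟨x, M₀.mem_face_round x, hx⟩, M₀.mem_face_round x⟩
  · obtain ⟨K, hK, hxK⟩ := mem_iUnion₂.1 hx
    obtain ⟨y, hy, hyS⟩ := hfin.mem_toFinset.1 hK
    refine Metric.mem_cthickening_of_dist_le x y _ S hyS ?_
    rw [dist_eq_norm]
    exact M₀.norm_sub_le_of_mem_face hxK hy

lemma measurable_proj (hj : j < n) : Measurable (M.proj j) :=
  measurable_gridProj hj M.ε measurable_const measurable_id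

end Mesh

/-! ### Integrals of powers of the norm -/

section Kernel

variable {V : Type*} [NormedAddCommGroup V]

lemma enorm_rpow_eq_ofReal {x : V} (hx : x ≠ 0) (a : ℝ) :
    ‖x‖ₑ ^ a = ENNReal.ofReal (‖x‖ ^ a) := by
  rw [← ofReal_norm, ENNReal.ofReal_rpow_of_pos (norm_pos_iff.2 hx)]

variable [NormedSpace ℝ V]

lemma enorm_smul_rpow {r : ℝ} (hr : r ≠ 0) (x : V) (a : ℝ) :
    ‖r • x‖ₑ ^ a = ‖r‖ₑ ^ a * ‖x‖ₑ ^ a := by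
  rw [enorm_smul, ENNReal.mul_rpow_eq_ite]
  simp [hr]

variable [MeasurableSpace V] [BorelSpace V] [FiniteDimensional ℝ V] (μ : Measure V)
  [μ.IsAddHaarMeasure]

lemma lintegral_eq_mul_lintegral_comp_smul {r : ℝ} (hr : 0 < r) (g : V → ℝ≥0∞) :
    ∫⁻ x, g x ∂μ = ENNReal.ofReal r ^ Module.finrank ℝ V * ∫⁻ x, g (r • x) ∂μ := by
  rw [← (measurableEmbedding_const_smul₀ hr.ne').lintegral_map, Measure.map_addHaar_smul μ hr.ne',
    lintegral_smul_measure, smul_eq_mul, abs_of_pos (by positivity), ← mul_assoc,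
    ENNReal.ofReal_inv_of_pos (by positivity), ENNReal.ofReal_pow hr.le, ENNReal.mul_inv_cancel,
    one_mul]
  · exact pow_ne_zero _ (by simpa using hr)
  · exact ENNReal.pow_ne_top ENNReal.ofReal_ne_top

lemma lintegral_one_le_norm_rpow_lt_top {a : ℝ} (ha : (Module.finrank ℝ V : ℝ) < a) :
    ∫⁻ x in {x | 1 ≤ ‖x‖}, ‖x‖ₑ ^ (-a) ∂μ < ∞ := by
  have : 0 < a := (Nat.cast_nonneg _).trans_lt ha
  have hle : ∀ x : V, 1 ≤ ‖x‖ →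
      ‖x‖ₑ ^ (-a) ≤ ENNReal.ofReal (2 ^ a) * ENNReal.ofReal ((1 + ‖x‖) ^ (-a)) := fun x hx => by
    rw [enorm_rpow_eq_ofReal (norm_pos_iff.1 (by linarith)), ← ENNReal.ofReal_mul (by positivity)]
    refine ENNReal.ofReal_le_ofReal ?_
    calc ‖x‖ ^ (-a) = 2 ^ a * (2 * ‖x‖) ^ (-a) := by
          rw [Real.mul_rpow (by norm_num) (norm_nonneg _), ← mul_assoc,
            ← Real.rpow_add (by norm_num), add_neg_cancel, Real.rpow_zero, one_mul]
      _ ≤ 2 ^ a * (1 + ‖x‖) ^ (-a) := by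
          gcongr ?_ * ?_
          exact Real.rpow_le_rpow_of_nonpos (by positivity) (by linarith) (by linarith)
  calc ∫⁻ x in {x | 1 ≤ ‖x‖}, ‖x‖ₑ ^ (-a) ∂μ
      ≤ ∫⁻ x, ENNReal.ofReal (2 ^ a) * ENNReal.ofReal ((1 + ‖x‖) ^ (-a)) ∂μ :=
        (setLIntegral_mono' (measurableSet_le measurable_const measurable_norm) hle).trans
          (setLIntegral_le_lintegral _ _)
    _ < ∞ := by
        rw [lintegral_const_mul' _ _ ENNReal.ofReal_ne_top]
        exact ENNReal.mul_lt_top ENNReal.ofReal_lt_top (finite_integral_one_add_norm ha)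

lemma setLIntegral_le_norm_rpow {r : ℝ} (hr : 0 < r) (a : ℝ) :
    ∫⁻ x in {x | r ≤ ‖x‖}, ‖x‖ₑ ^ (-(Module.finrank ℝ V + a)) ∂μ =
      (∫⁻ x in {x | 1 ≤ ‖x‖}, ‖x‖ₑ ^ (-(Module.finrank ℝ V + a)) ∂μ) *
        ENNReal.ofReal r ^ (-a) := by
  have hms : ∀ t : ℝ, MeasurableSet {x : V | t ≤ ‖x‖} := fun t =>
    measurableSet_le measurable_const measurable_norm
  have hr0 : ENNReal.ofReal r ≠ 0 := by simpa using hr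
  set b : ℝ := -(Module.finrank ℝ V + a)
  have hpre : ∀ x : V, {x : V | r ≤ ‖x‖}.indicator (fun x => ‖x‖ₑ ^ b) (r • x) =
      ENNReal.ofReal r ^ b * {x : V | 1 ≤ ‖x‖}.indicator (fun x => ‖x‖ₑ ^ b) x := fun x => by
    have hiff : r ≤ ‖r • x‖ ↔ 1 ≤ ‖x‖ := by
      rw [norm_smul, Real.norm_of_nonneg hr.le, le_mul_iff_one_le_right hr]
    simp only [indicator, mem_ofPred_eq, hiff, mul_ite, mul_zero, enorm_smul_rpow hr.ne',
      Real.enorm_of_nonneg hr.le]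
  rw [← lintegral_indicator (hms r), ← lintegral_indicator (hms 1),
    lintegral_eq_mul_lintegral_comp_smul μ hr]
  simp_rw [hpre]
  rw [lintegral_const_mul' _ _ (ENNReal.rpow_ne_top_of_ne_zero hr0 ENNReal.ofReal_ne_top),
    ← mul_assoc, ← ENNReal.rpow_natCast, ← ENNReal.rpow_add _ _ hr0 ENNReal.ofReal_ne_top,
    show (Module.finrank ℝ V : ℝ) + b = -a by simp [b], mul_comm]

lemma exists_lintegral_tail_le {σ : ℝ} (hσ : 0 < σ) :
    ∃ κ : ℝ≥0∞, κ ≠ ∞ ∧ ∀ r : ℝ, 0 < r →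
      ∫⁻ x in {x | r ≤ ‖x‖}, ‖x‖ₑ ^ (-(Module.finrank ℝ V + σ)) ∂μ ≤
        κ * ENNReal.ofReal r ^ (-σ) :=
  ⟨_, (lintegral_one_le_norm_rpow_lt_top μ (by linarith)).ne, fun _ hr =>
    (setLIntegral_le_norm_rpow μ hr σ).le⟩

lemma integrableOn_ball_norm_rpow [Nontrivial V] {a : ℝ}
    (ha : -(Module.finrank ℝ V : ℝ) < a) (r : ℝ) :
    IntegrableOn (fun x : V => ‖x‖ ^ a) (Metric.ball 0 r) μ := by
  have hradial : IntegrableOn (fun y : ℝ => y ^ ((Module.finrank ℝ V : ℝ) - 1 + a)) (Ioo 0 r) := by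
    rcases le_total r 0 with hr | hr
    · rw [Ioo_eq_empty (by simpa using hr)]; exact integrableOn_empty
    exact ((intervalIntegrable_iff_integrableOn_Ioc_of_le hr).1
      (intervalIntegral.intervalIntegrable_rpow' (by linarith))).mono_set Ioo_subset_Ioc_self
  rw [integrableOn_fun_norm_addHaar μ (f := fun y => y ^ a)]
  refine hradial.congr_fun (fun y hy => ?_) measurableSet_Ioo
  simp only
  rw [smul_eq_mul, Real.rpow_add hy.1, ← Real.rpow_natCast, Nat.cast_sub Module.finrank_pos,
    Nat.cast_one]

lemma lintegral_ball_enorm_rpow_lt_top [Nontrivial V] {a : ℝ}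
    (ha : -(Module.finrank ℝ V : ℝ) < a) (r : ℝ) :
    ∫⁻ x in Metric.ball 0 r, ‖x‖ₑ ^ a ∂μ < ∞ := by
  refine lt_of_le_of_lt (lintegral_mono_ae ?_)
    (integrableOn_ball_norm_rpow μ ha r).lintegral_lt_top
  have hne : ∀ᵐ x ∂μ, x ≠ 0 := by simp [ae_iff]
  filter_upwards [ae_restrict_of_ae hne] with x hx using (enorm_rpow_eq_ofReal hx a).le

end Kernel

/-! ### Averages over a period cell of the grid -/

section PeriodCell

variable {n j : ℕ}

/-- The period cell `[0, 2)ⁿ` of the lattice `2 ℤⁿ`. -/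
def cell (n : ℕ) : Set (E n) := {z | ∀ i, z i ∈ Ico (0 : ℝ) 2}

lemma cell_eq_preimage : cell n = WithLp.ofLp ⁻¹' (univ.pi fun _ : Fin n => Ico (0 : ℝ) 2) := by
  ext z; simp [cell]

lemma volume_cell : volume (cell n) = 2 ^ n := by
  rw [cell_eq_preimage, (PiLp.volume_preserving_ofLp (Fin n)).measure_preimage
    (MeasurableSet.univ_pi fun _ => measurableSet_Ico).nullMeasurableSet, volume_pi_pi]
  simp

lemma volume_cell_ne_zero : volume (cell n) ≠ 0 := by
  rw [volume_cell]; simp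

lemma volume_cell_ne_top : volume (cell n) ≠ ∞ := by
  rw [volume_cell]; simp

/-- The basis `2 eᵢ` of the period lattice `2 ℤⁿ` of the grid. -/
def doubleBasis (n : ℕ) : Module.Basis (Fin n) ℝ (E n) :=
  (EuclideanSpace.basisFun (Fin n) ℝ).toBasis.isUnitSMul (w := fun _ => (2 : ℝ))
    fun _ => isUnit_iff_ne_zero.2 two_ne_zero

lemma doubleBasis_repr (z : E n) (i : Fin n) : (doubleBasis n).repr z i = z i / 2 := by
  rw [doubleBasis, Module.Basis.repr_isUnitSMul, Units.smul_def, Units.val_inv_eq_inv_val,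
    IsUnit.unit_spec, smul_eq_mul, div_eq_inv_mul]
  rfl

lemma fundamentalDomain_doubleBasis : ZSpan.fundamentalDomain (doubleBasis n) = cell n := by
  ext z
  simp only [ZSpan.mem_fundamentalDomain, doubleBasis_repr, cell, mem_ofPred_eq, mem_Ico]
  refine forall_congr' fun i => and_congr ?_ ?_
  · constructor <;> intro h <;> linarith
  · constructor <;> intro h <;> linarith

lemma exists_eq_two_mul_of_mem_span {g : E n}
    (hg : g ∈ Submodule.span ℤ (range (doubleBasis n))) :
    ∃ k : Fin n → ℤ, g = WithLp.toLp 2 fun i => 2 * (k i : ℝ) := by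
  choose k hk using (Module.Basis.mem_span_iff_repr_mem ℤ (doubleBasis n) g).1 hg
  refine ⟨k, ?_⟩
  ext i
  have h := hk i
  rw [doubleBasis_repr, algebraMap_int_eq, eq_intCast] at h
  simp only
  linarith

open scoped Pointwise in
lemma lintegral_cell_comp_add {Φ : E n → ℝ≥0∞}
    (hΦ : ∀ (z : E n) (k : Fin n → ℤ), Φ (z + WithLp.toLp 2 fun i => 2 * (k i : ℝ)) = Φ z)
    (a : E n) : ∫⁻ z in cell n, Φ (a + z) = ∫⁻ z in cell n, Φ z := by
  have hD := ZSpan.isAddFundamentalDomain' (doubleBasis n) (volume : Measure (E n))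
  rw [fundamentalDomain_doubleBasis] at hD
  have hD' : IsAddFundamentalDomain (Submodule.span ℤ (range (doubleBasis n))).toAddSubgroup
      (a +ᵥ cell n) volume := hD.vadd_of_comm a
  have : Countable (Submodule.span ℤ (range (doubleBasis n))).toAddSubgroup :=
    inferInstanceAs (Countable (Submodule.span ℤ (range (doubleBasis n))))
  rw [hD.setLIntegral_eq hD' Φ]
  · exact (measurePreserving_add_left volume a).setLIntegral_comp_emb
      (measurableEmbedding_addLeft a) Φ (cell n)
  · rintro ⟨g, hg⟩ x
    obtain ⟨k, rfl⟩ := exists_eq_two_mul_of_mem_span hg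
    change Φ (WithLp.toLp 2 (fun i => 2 * (k i : ℝ)) + x) = Φ x
    rw [add_comm, hΦ]

/-- Averaging over the translates of the grid decouples the grid from the space variable. -/
lemma lintegral_cell_lintegral_comp {Φ : E n → E n → ℝ≥0∞}
    (hm : Measurable (Function.uncurry Φ))
    (hΦ : ∀ (x z : E n) (k : Fin n → ℤ),
      Φ x (z + WithLp.toLp 2 fun i => 2 * (k i : ℝ)) = Φ x z) (ε : ℝ) :
    ∫⁻ τ in cell n, ∫⁻ x, Φ x (ε⁻¹ • x + τ) = ∫⁻ z in cell n, ∫⁻ x, Φ x z := by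
  rw [lintegral_lintegral_swap (f := fun τ x => Φ x (ε⁻¹ • x + τ)),
    lintegral_lintegral_swap (f := fun z x => Φ x z)]
  · exact lintegral_congr fun x => lintegral_cell_comp_add (hΦ x) _
  · exact (hm.comp measurable_swap).aemeasurable
  · exact (Measurable.comp (f := fun p : E n × E n => (p.2, ε⁻¹ • p.2 + p.1)) hm
      (by fun_prop)).aemeasurable

lemma ae_apply_ne (i : Fin n) (c : ℝ) : ∀ᵐ x : E n, x i ≠ c := by
  have h := Measure.pi_hyperplane (fun _ : Fin n => (volume : Measure ℝ)) i c
  have hpre := (PiLp.volume_preserving_ofLp (Fin n)).measure_preimage (s := {f | f i = c})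
    (measurableSet_eq_fun (measurable_pi_apply i) measurable_const).nullMeasurableSet
  rw [ae_iff]
  simp only [ne_eq, not_not]
  exact hpre.trans h

lemma exists_eq_two_mul_of_evenDist_eq_zero {a : ℝ} (h : evenDist a = 0) : ∃ k : ℤ, a = 2 * k :=
  ⟨round (a / 2), sub_eq_zero.1 (abs_eq_zero.1 h)⟩

lemma ae_evenDist_ne_zero : ∀ᵐ z : E n, ∀ i, evenDist (z i) ≠ 0 := by
  have : ∀ᵐ z : E n, ∀ i, ∀ k : ℤ, z i ≠ 2 * k :=
    ae_all_iff.2 fun i => ae_all_iff.2 fun k => ae_apply_ne i _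
  filter_upwards [this] with z hz i h
  obtain ⟨k, hk⟩ := exists_eq_two_mul_of_evenDist_eq_zero h
  exact hz i k hk

lemma depth_ne_zero_of_forall (hj : j < n) {z : Fin n → ℝ} (h : ∀ i, evenDist (z i) ≠ 0) :
    depth j z ≠ 0 := fun h0 => by
  obtain ⟨A, hA, hz⟩ := (depth_le_iff hj).1 h0.le
  obtain ⟨i, hi⟩ : A.Nonempty := Finset.card_pos.1 (by omega)
  exact h i (le_antisymm (hz i hi) (evenDist_nonneg _))

lemma ae_depth_ne_zero (hj : j < n) : ∀ᵐ z : E n, depth j z ≠ 0 := by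
  filter_upwards [ae_evenDist_ne_zero] with z hz using depth_ne_zero_of_forall hj hz

lemma ae_depth_smul_add_ne_zero (hj : j < n) {c : ℝ} (hc : c ≠ 0) (a : E n) :
    ∀ᵐ x : E n, depth j (c • x + a) ≠ 0 :=
  ((measurePreserving_add_right volume a).quasiMeasurePreserving.comp
    (Measure.quasiMeasurePreserving_smul volume hc)).ae (ae_depth_ne_zero hj)

lemma ae_depth_coord_ne_zero (hj : j < n) (M : Mesh n) : ∀ᵐ x : E n, depth j (M.coord x) ≠ 0 :=
  ae_depth_smul_add_ne_zero hj (inv_ne_zero M.ε_pos.ne') M.phase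

lemma evenDist_rpow_neg_le {t : ℝ} (h0 : 0 ≤ t) (h2 : t ≤ 2) (a : ℝ) :
    evenDist t ^ (-a) ≤ |t| ^ (-a) + |t - 2| ^ (-a) := by
  rcases le_total t 1 with h | h
  · rw [evenDist_eq (k := 0) (by simpa using abs_le.2 ⟨by linarith, h⟩)]
    simpa using Real.rpow_nonneg (abs_nonneg (t - 2)) (-a)
  · rw [evenDist_eq (k := 1) (by
      simpa using abs_le.2 ⟨by linarith, by linarith⟩)]
    simpa using Real.rpow_nonneg (abs_nonneg t) (-a)

lemma integrableOn_evenDist_rpow {a : ℝ} (ha : a < 1) :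
    IntegrableOn (fun t => evenDist t ^ (-a)) (Ico 0 2) := by
  have habs : IntervalIntegrable (fun t : ℝ => |t| ^ (-a)) volume (-2) 2 := by
    refine (intervalIntegrable_iff_integrableOn_Ioc_of_le (by norm_num)).2
      ((integrableOn_ball_norm_rpow volume (by simpa using ha) 3).mono_set fun t ht => ?_)
    rw [mem_ball_zero_iff, Real.norm_eq_abs, abs_lt]
    constructor <;> linarith [ht.1, ht.2]
  have habs2 : IntervalIntegrable (fun t : ℝ => |t - 2| ^ (-a)) volume 0 4 := by
    convert habs.comp_sub_right 2 using 1 <;> norm_num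
  have hsum : IntervalIntegrable (fun t : ℝ => |t| ^ (-a) + |t - 2| ^ (-a)) volume 0 2 := by
    refine (habs.mono_set ?_).add (habs2.mono_set ?_) <;>
      rw [uIcc_of_le (by norm_num), uIcc_of_le (by norm_num)] <;>
      exact Icc_subset_Icc (by norm_num) (by norm_num)
  refine ((intervalIntegrable_iff_integrableOn_Ico_of_le zero_le_two).1 hsum).mono'
    (measurable_evenDist.pow_const _).aestronglyMeasurable ?_
  filter_upwards [ae_restrict_mem measurableSet_Ico] with t ht
  rw [Real.norm_of_nonneg (Real.rpow_nonneg (evenDist_nonneg t) _)]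
  exact evenDist_rpow_neg_le ht.1 ht.2.le a

lemma depth_rpow_neg_le_sum (hj : j < n) {σ : ℝ} (hσ : 0 ≤ σ) {z : Fin n → ℝ}
    (hz : ∀ i, evenDist (z i) ≠ 0) :
    depth j z ^ (-σ) ≤ ∑ A ∈ Finset.powersetCard (j + 1) Finset.univ,
      ∏ i, if i ∈ A then evenDist (z i) ^ (-(σ / (j + 1))) else 1 := by
  have hd : 0 < depth j z := (depth_nonneg _ _).lt_of_ne' (depth_ne_zero_of_forall hj hz)
  obtain ⟨A, hA, hAz⟩ := (depth_le_iff hj).1 (le_refl (depth j z))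
  calc depth j z ^ (-σ) = ∏ _i ∈ A, depth j z ^ (-(σ / (j + 1))) := by
        rw [Finset.prod_const, hA, ← Real.rpow_natCast, ← Real.rpow_mul hd.le]
        congr 1
        push_cast
        field_simp
    _ ≤ ∏ i ∈ A, evenDist (z i) ^ (-(σ / (j + 1))) := by
        refine Finset.prod_le_prod (fun _ _ => by positivity) fun i hi => ?_
        exact Real.rpow_le_rpow_of_nonpos ((evenDist_nonneg _).lt_of_ne' (hz i)) (hAz i hi)
          (neg_nonpos.2 (div_nonneg hσ (by positivity)))
    _ = ∏ i, if i ∈ A then evenDist (z i) ^ (-(σ / (j + 1))) else 1 := by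
        rw [Finset.prod_ite_mem, Finset.univ_inter]
    _ ≤ _ := by
        refine Finset.single_le_sum (f := fun B =>
          ∏ i, if i ∈ B then evenDist (z i) ^ (-(σ / (j + 1))) else 1)
          (fun _ _ => Finset.prod_nonneg fun _ _ => ?_)
          (Finset.mem_powersetCard.2 ⟨Finset.subset_univ A, hA⟩)
        split_ifs
        · exact Real.rpow_nonneg (evenDist_nonneg _) _
        · exact zero_le_one

lemma lintegral_cell_depth_rpow_lt_top (hj : j < n) {σ : ℝ} (hσ0 : 0 ≤ σ) (hσ : σ < j + 1) :
    ∫⁻ z in cell n, ENNReal.ofReal (depth j z) ^ (-σ) < ∞ := by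
  have hprod : ∀ A : Finset (Fin n), IntegrableOn (fun z : Fin n → ℝ =>
      ∏ i, if i ∈ A then evenDist (z i) ^ (-(σ / (j + 1))) else 1)
      (univ.pi fun _ : Fin n => Ico (0 : ℝ) 2) := fun A => by
    rw [IntegrableOn, volume_pi, Measure.restrict_pi_pi]
    refine Integrable.fintype_prod
      (f := fun i t => if i ∈ A then evenDist t ^ (-(σ / (j + 1))) else 1) fun i => ?_
    by_cases hi : i ∈ A
    · simp only [hi, if_true]
      exact integrableOn_evenDist_rpow ((div_lt_one (by positivity)).2 hσ)
    · simp only [hi, if_false]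
      exact integrable_const _
  have hsum : IntegrableOn (fun z : E n => ∑ A ∈ Finset.powersetCard (j + 1) Finset.univ,
      ∏ i, if i ∈ A then evenDist (z i) ^ (-(σ / (j + 1))) else 1) (cell n) := by
    refine integrable_finsetSum _ fun A _ => ?_
    rw [cell_eq_preimage]
    exact ((PiLp.volume_preserving_ofLp (Fin n)).integrableOn_comp_preimage
      (MeasurableEquiv.toLp 2 (Fin n → ℝ)).symm.measurableEmbedding).2 (hprod A)
  refine lt_of_le_of_lt (lintegral_mono_ae ?_) hsum.lintegral_lt_top
  filter_upwards [ae_restrict_of_ae ae_evenDist_ne_zero] with z hz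
  rw [ENNReal.ofReal_rpow_of_pos
    ((depth_nonneg _ _).lt_of_ne' (depth_ne_zero_of_forall hj hz))]
  exact ENNReal.ofReal_le_ofReal (depth_rpow_neg_le_sum hj hσ0 hz)

/-- The points with `n - j` coordinates close to the odd integers, a neighbourhood of the
`j`-skeleton of the grid. -/
def nearSkel (j : ℕ) (r : ℝ) : Set (E n) :=
  {z | ∃ B : Finset (Fin n), B.card = n - j ∧ ∀ i ∈ B, 1 - r ≤ evenDist (z i)}

lemma measurableSet_nearSkel (j : ℕ) (r : ℝ) : MeasurableSet (nearSkel j r : Set (E n)) := by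
  have : (nearSkel j r : Set (E n)) = ⋃ B ∈ {B : Finset (Fin n) | B.card = n - j},
      ⋂ i ∈ B, {z | 1 - r ≤ evenDist (z i)} := by
    ext z; simp [nearSkel]
  rw [this]
  refine MeasurableSet.biUnion (Set.to_countable _) fun B _ =>
    MeasurableSet.biInter (Set.to_countable _) fun i _ => ?_
  exact measurableSet_le measurable_const (measurable_evenDist.comp (by fun_prop))

lemma nearSkel_add (j : ℕ) (r : ℝ) (z : E n) (k : Fin n → ℤ) :
    z + (WithLp.toLp 2 fun i => 2 * (k i : ℝ)) ∈ nearSkel j r ↔ z ∈ nearSkel j r := by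
  simp only [nearSkel, mem_ofPred_eq, PiLp.add_apply, evenDist_add]

lemma mem_Icc_of_le_evenDist {t r : ℝ} (ht : t ∈ Ico (0 : ℝ) 2) (h : 1 - r ≤ evenDist t) :
    t ∈ Icc (1 - r) (1 + r) := by
  have h0 := evenDist_le t 0
  have h1 := evenDist_le t 1
  rw [Int.cast_zero, mul_zero, sub_zero, abs_of_nonneg ht.1] at h0
  rw [Int.cast_one, mul_one, abs_sub_comm, abs_of_nonneg (by linarith [ht.2])] at h1
  constructor <;> linarith

lemma volume_box (B : Finset (Fin n)) (r : ℝ) :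
    volume {z : E n | ∀ i, z i ∈ if i ∈ B then Icc (1 - r) (1 + r) else Ico (0 : ℝ) 2} =
      2 ^ n * ENNReal.ofReal r ^ B.card := by
  have hpi : {z : E n | ∀ i, z i ∈ if i ∈ B then Icc (1 - r) (1 + r) else Ico (0 : ℝ) 2} =
      WithLp.ofLp ⁻¹' univ.pi fun i => if i ∈ B then Icc (1 - r) (1 + r) else Ico (0 : ℝ) 2 := by
    ext z; simp
  have hside : ∀ i, volume (if i ∈ B then Icc (1 - r) (1 + r) else Ico (0 : ℝ) 2) =
      2 * if i ∈ B then ENNReal.ofReal r else 1 := fun i => by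
    split_ifs
    · rw [Real.volume_Icc, show 1 + r - (1 - r) = 2 * r by ring,
        ENNReal.ofReal_mul (by norm_num), ENNReal.ofReal_ofNat]
    · simp
  rw [hpi, (PiLp.volume_preserving_ofLp (Fin n)).measure_preimage (MeasurableSet.univ_pi fun i => by
    split_ifs <;> measurability).nullMeasurableSet, volume_pi_pi]
  simp_rw [hside]
  rw [Finset.prod_mul_distrib, Finset.prod_const, Finset.card_univ, Fintype.card_fin,
    Finset.prod_ite_mem, Finset.univ_inter, Finset.prod_const]

lemma volume_cell_inter_nearSkel_le (j : ℕ) (r : ℝ) :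
    volume (cell n ∩ nearSkel j r) ≤
      n.choose (n - j) * (2 ^ n * ENNReal.ofReal r ^ (n - j)) := by
  have hsub : cell n ∩ nearSkel j r ⊆
      ⋃ B ∈ Finset.powersetCard (n - j) (Finset.univ : Finset (Fin n)),
        {z | ∀ i, z i ∈ if i ∈ B then Icc (1 - r) (1 + r) else Ico (0 : ℝ) 2} := by
    rintro z ⟨hz, B, hB, hzB⟩
    refine mem_iUnion₂.2 ⟨B, Finset.mem_powersetCard.2 ⟨Finset.subset_univ _, hB⟩, fun i => ?_⟩
    split_ifs with hi
    exacts [mem_Icc_of_le_evenDist (hz i) (hzB i hi), hz i]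
  have hcard : (Finset.powersetCard (n - j) (Finset.univ : Finset (Fin n))).card =
      n.choose (n - j) := by
    rw [Finset.card_powersetCard, Finset.card_univ, Fintype.card_fin]
  refine (measure_mono hsub).trans ((measure_biUnion_finset_le _ _).trans ?_)
  rw [← hcard, ← nsmul_eq_mul]
  refine Finset.sum_le_card_nsmul _ _ _ fun B hB => ?_
  rw [volume_box, (Finset.mem_powersetCard.1 hB).2]

end PeriodCell

/-! ### Increments and localized fractional energies -/

section Increment

lemma enorm_add_rpow_le {V : Type*} [NormedAddCommGroup V] {p : ℝ} (hp : 1 ≤ p) (a b : V) :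
    ‖a + b‖ₑ ^ p ≤ 2 ^ (p - 1) * (‖a‖ₑ ^ p + ‖b‖ₑ ^ p) :=
  (ENNReal.rpow_le_rpow (enorm_add_le a b) (by linarith)).trans
    (ENNReal.rpow_add_le_mul_rpow_add_rpow _ _ hp)

lemma enorm_sub_rpow_le {V : Type*} [NormedAddCommGroup V] {p : ℝ} (hp : 1 ≤ p) (a b : V) :
    ‖a - b‖ₑ ^ p ≤ 2 ^ (p - 1) * (‖a‖ₑ ^ p + ‖b‖ₑ ^ p) := by
  simpa [sub_eq_add_neg] using enorm_add_rpow_le hp a (-b)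

variable {n m : ℕ} {p σ : ℝ}

/-- The `p`-th power of the `L^p` norm of the increments of `u` with step `v`. -/
def lpIncrement (p : ℝ) (u : E n → E m) (v : E n) : ℝ≥0∞ := ∫⁻ x, ‖u (x + v) - u x‖ₑ ^ p

lemma measurable_lpIncrement {u : E n → E m} (hu : Measurable u) :
    Measurable (lpIncrement p u) := by
  unfold lpIncrement
  exact Measurable.lintegral_prod_right' (f := fun q : E n × E n => ‖u (q.2 + q.1) - u q.2‖ₑ ^ p)
    (by fun_prop)

lemma lpIncrement_zero (hp : 1 ≤ p) (u : E n → E m) : lpIncrement p u 0 = 0 := by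
  simp [lpIncrement, ENNReal.zero_rpow_of_pos (by linarith : 0 < p)]

lemma lpIncrement_mul_rpow_add (hp : 1 ≤ p) (u : E n → E m) (w : E n) (a b : ℝ) :
    lpIncrement p u w * ‖w‖ₑ ^ (a + b) = lpIncrement p u w * ‖w‖ₑ ^ a * ‖w‖ₑ ^ b := by
  rcases eq_or_ne w 0 with rfl | hw
  · simp [lpIncrement_zero hp]
  · rw [ENNReal.rpow_add _ _ (by simpa using hw) enorm_ne_top, mul_assoc]

lemma lpIncrement_add_le (hp : 1 ≤ p) {u : E n → E m} (hu : Measurable u) (v w : E n) :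
    lpIncrement p u (v + w) ≤ 2 ^ (p - 1) * (lpIncrement p u v + lpIncrement p u w) := by
  have hshift : lpIncrement p u w = ∫⁻ x, ‖u (x + v + w) - u (x + v)‖ₑ ^ p :=
    (lintegral_add_right_eq_self (fun x => ‖u (x + w) - u x‖ₑ ^ p) v).symm
  rw [hshift]
  unfold lpIncrement
  rw [← lintegral_add_left (by fun_prop), ← lintegral_const_mul' _ _ (by simp)]
  refine lintegral_mono fun x => ?_
  have h := enorm_add_rpow_le hp (u (x + v) - u x) (u (x + v + w) - u (x + v))
  rw [sub_add_sub_cancel'] at h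
  rwa [← add_assoc]

/-- Averages `u (x + v) - u x = (u (x + v) - u (x + w)) + (u (x + w) - u x)` over the points `w`
of the ball with diameter `[0, v]`. -/
lemma volume_mul_lpIncrement_le (hp : 1 ≤ p) {u : E n → E m} (hu : Measurable u) (v : E n) :
    volume (Metric.closedBall (0 : E n) (‖v‖ * 2⁻¹)) * lpIncrement p u v ≤
      2 ^ p * ∫⁻ w in Metric.closedBall 0 ‖v‖, lpIncrement p u w := by
  set B := Metric.closedBall ((2 : ℝ)⁻¹ • v) (‖v‖ * 2⁻¹)
  have hsub : B ⊆ Metric.closedBall 0 ‖v‖ := by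
    refine Metric.closedBall_subset_closedBall' ?_
    rw [dist_zero_right, norm_smul, norm_inv, Real.norm_ofNat]
    linarith
  have hrefl : (v - ·) ⁻¹' B = B := by
    ext w
    rw [mem_preimage, Metric.mem_closedBall, Metric.mem_closedBall, dist_eq_norm, dist_eq_norm,
      ← norm_neg, show -(v - w - (2 : ℝ)⁻¹ • v) = w - (2 : ℝ)⁻¹ • v by module]
  have hinc := measurable_lpIncrement (p := p) hu
  have hswap : ∫⁻ w in B, lpIncrement p u (v - w) = ∫⁻ w in B, lpIncrement p u w := by
    nth_rewrite 1 [← hrefl]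
    exact (volume.measurePreserving_sub_left v).setLIntegral_comp_preimage
      measurableSet_closedBall hinc
  rw [← Measure.addHaar_closedBall_center volume ((2 : ℝ)⁻¹ • v)]
  calc volume B * lpIncrement p u v = ∫⁻ _w in B, lpIncrement p u v := by
        rw [setLIntegral_const, mul_comm]
    _ ≤ ∫⁻ w in B, 2 ^ (p - 1) * (lpIncrement p u w + lpIncrement p u (v - w)) := by
        refine lintegral_mono fun w => ?_
        simpa using lpIncrement_add_le hp hu w (v - w)
    _ = 2 ^ (p - 1) * (2 ^ (1 : ℝ) * ∫⁻ w in B, lpIncrement p u w) := by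
        rw [lintegral_const_mul' _ _ (by simp), lintegral_add_left hinc, hswap, ENNReal.rpow_one,
          two_mul]
    _ = 2 ^ p * ∫⁻ w in B, lpIncrement p u w := by
        rw [← mul_assoc, ← ENNReal.rpow_add _ _ two_ne_zero (by simp), sub_add_cancel]
    _ ≤ _ := by gcongr

lemma rpow_neg_le_rpow_neg_of_norm_le {V : Type*} [NormedAddCommGroup V] {v w : V}
    (h : ‖w‖ ≤ ‖v‖) {a : ℝ} (ha : 0 ≤ a) : ‖v‖ₑ ^ (-a) ≤ ‖w‖ₑ ^ (-a) := by
  rw [ENNReal.rpow_neg, ENNReal.rpow_neg, ENNReal.inv_le_inv]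
  exact ENNReal.rpow_le_rpow (enorm_le_iff_norm_le.2 h) ha

lemma exists_lpIncrement_le (n m : ℕ) (hp : 1 ≤ p) :
    ∃ κ : ℝ≥0∞, κ ≠ ∞ ∧ ∀ {u : E n → E m}, Measurable u → ∀ v : E n,
      lpIncrement p u v ≤
        κ * ∫⁻ w in Metric.closedBall 0 ‖v‖, lpIncrement p u w * ‖w‖ₑ ^ (-(n : ℝ)) := by
  set c := volume (Metric.closedBall (0 : E n) 2⁻¹)
  have hc0 : c ≠ 0 := (Metric.measure_closedBall_pos _ _ (by norm_num)).ne'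
  have hct : c ≠ ∞ := measure_closedBall_lt_top.ne
  refine ⟨c⁻¹ * 2 ^ p, ENNReal.mul_ne_top (ENNReal.inv_ne_top.2 hc0) (by simp),
    fun {u} hu v => ?_⟩
  rcases eq_or_ne v 0 with rfl | hv
  · simp [lpIncrement_zero hp]
  have hv0 : ‖v‖ₑ ^ n ≠ 0 := pow_ne_zero _ (by simpa using hv)
  have hvt : ‖v‖ₑ ^ n ≠ ∞ := ENNReal.pow_ne_top enorm_ne_top
  have hle := volume_mul_lpIncrement_le hp hu v
  rw [Measure.addHaar_closedBall_mul _ _ (norm_nonneg v) (by norm_num),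
    finrank_euclideanSpace_fin, ENNReal.ofReal_pow (norm_nonneg v), ofReal_norm] at hle
  calc lpIncrement p u v
      = c⁻¹ * (‖v‖ₑ ^ n)⁻¹ * (‖v‖ₑ ^ n * c * lpIncrement p u v) := by
        rw [show c⁻¹ * (‖v‖ₑ ^ n)⁻¹ * (‖v‖ₑ ^ n * c * lpIncrement p u v) =
          (c⁻¹ * c) * ((‖v‖ₑ ^ n)⁻¹ * ‖v‖ₑ ^ n) * lpIncrement p u v by ring,
          ENNReal.inv_mul_cancel hc0 hct, ENNReal.inv_mul_cancel hv0 hvt, one_mul, one_mul]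
    _ ≤ c⁻¹ * (‖v‖ₑ ^ n)⁻¹ * (2 ^ p * ∫⁻ w in Metric.closedBall 0 ‖v‖, lpIncrement p u w) := by
        gcongr
    _ = c⁻¹ * 2 ^ p * ∫⁻ w in Metric.closedBall 0 ‖v‖, lpIncrement p u w * ‖v‖ₑ ^ (-(n : ℝ)) := by
        rw [lintegral_mul_const _ (measurable_lpIncrement hu), ENNReal.rpow_neg,
          ENNReal.rpow_natCast]
        ring
    _ ≤ _ := by
        gcongr _ * ?_
        refine setLIntegral_mono' measurableSet_closedBall fun w hw => ?_
        gcongr _ * ?_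
        exact rpow_neg_le_rpow_neg_of_norm_le (by simpa using hw) n.cast_nonneg

/-- The `p`-th power of the Gagliardo seminorm on the whole space, restricted to the pairs of
points at distance at most `r`; here `σ = s p`. -/
def localEnergy (p σ : ℝ) (u : E n → E m) (r : ℝ) : ℝ≥0∞ :=
  ∫⁻ w in Metric.closedBall 0 r, lpIncrement p u w * ‖w‖ₑ ^ (-((n : ℝ) + σ))

lemma localEnergy_mono (u : E n → E m) {r r' : ℝ} (h : r ≤ r') :
    localEnergy p σ u r ≤ localEnergy p σ u r' :=
  lintegral_mono_set (Metric.closedBall_subset_closedBall h)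

lemma exists_lpIncrement_le_localEnergy (n m : ℕ) (hp : 1 ≤ p) (hσ : 0 ≤ σ) :
    ∃ κ : ℝ≥0∞, κ ≠ ∞ ∧ ∀ {u : E n → E m}, Measurable u → ∀ v : E n,
      lpIncrement p u v ≤ κ * ‖v‖ₑ ^ σ * localEnergy p σ u ‖v‖ := by
  obtain ⟨κ, hκ, h⟩ := exists_lpIncrement_le n m hp
  refine ⟨κ, hκ, fun {u} hu v => (h hu v).trans ?_⟩
  have := measurable_lpIncrement (p := p) hu
  rw [localEnergy, mul_assoc, ← lintegral_const_mul (‖v‖ₑ ^ σ) (by fun_prop)]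
  gcongr κ * ?_
  refine setLIntegral_mono' measurableSet_closedBall fun w hw => ?_
  rw [mem_closedBall_zero_iff] at hw
  calc lpIncrement p u w * ‖w‖ₑ ^ (-(n : ℝ))
      = lpIncrement p u w * ‖w‖ₑ ^ (-((n : ℝ) + σ)) * ‖w‖ₑ ^ σ := by
        rw [← lpIncrement_mul_rpow_add hp, neg_add, neg_add_cancel_right]
    _ ≤ lpIncrement p u w * ‖w‖ₑ ^ (-((n : ℝ) + σ)) * ‖v‖ₑ ^ σ := by
        gcongr _ * ?_ ^ σ
        exact enorm_le_iff_norm_le.2 hw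
    _ = _ := mul_comm _ _

lemma exists_lpIncrement_mul_lintegral_tail_le (n m : ℕ) (hp : 1 ≤ p) (hσ : 0 < σ) :
    ∃ κ : ℝ≥0∞, κ ≠ ∞ ∧ ∀ (u : E n → E m) (w : E n) {θ : ℝ}, 0 < θ →
      lpIncrement p u w * ‖w‖ₑ ^ (-(n : ℝ)) *
          ∫⁻ h : E n in {h | ‖w‖ * θ ≤ ‖h‖}, ‖h‖ₑ ^ (-((n : ℝ) + σ)) ≤
        κ * ENNReal.ofReal θ ^ (-σ) * (lpIncrement p u w * ‖w‖ₑ ^ (-((n : ℝ) + σ))) := by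
  obtain ⟨κ, hκ, htail⟩ := exists_lintegral_tail_le (volume : Measure (E n)) hσ
  rw [finrank_euclideanSpace_fin] at htail
  refine ⟨κ, hκ, fun u w θ hθ => ?_⟩
  rcases eq_or_ne w 0 with rfl | hw
  · simp [lpIncrement_zero hp]
  have hpos : 0 < ‖w‖ := norm_pos_iff.2 hw
  calc _ ≤ lpIncrement p u w * ‖w‖ₑ ^ (-(n : ℝ)) * (κ * ENNReal.ofReal (‖w‖ * θ) ^ (-σ)) := by
        gcongr
        exact htail _ (by positivity)
    _ = κ * ENNReal.ofReal θ ^ (-σ) *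
          (lpIncrement p u w * ‖w‖ₑ ^ (-(n : ℝ)) * ‖w‖ₑ ^ (-σ)) := by
        rw [ENNReal.ofReal_mul hpos.le,
          ENNReal.mul_rpow_of_ne_top ENNReal.ofReal_ne_top ENNReal.ofReal_ne_top, ofReal_norm]
        ring
    _ = _ := by rw [← lpIncrement_mul_rpow_add hp, neg_add]

lemma exists_lpIncrement_mul_rpow_le (n m : ℕ) (hp : 1 ≤ p) (b : ℝ) :
    ∃ κ : ℝ≥0∞, κ ≠ ∞ ∧ ∀ {u : E n → E m}, Measurable u → ∀ {v h : E n} {θ R : ℝ}, 0 ≤ θ →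
      ‖v‖ * θ ≤ ‖h‖ → ‖v‖ ≤ R →
      lpIncrement p u v * ‖h‖ₑ ^ b ≤ κ * ∫⁻ w in Metric.closedBall 0 R,
        lpIncrement p u w * ‖w‖ₑ ^ (-(n : ℝ)) * {h | ‖w‖ * θ ≤ ‖h‖}.indicator (‖·‖ₑ ^ b) h := by
  obtain ⟨κ, hκ, hinc⟩ := exists_lpIncrement_le n m hp
  refine ⟨κ, hκ, fun {u} hu v h θ R hθ hvh hvR => ?_⟩
  have hum := measurable_lpIncrement (p := p) hu
  calc _ ≤ κ * (∫⁻ w in Metric.closedBall 0 ‖v‖, lpIncrement p u w * ‖w‖ₑ ^ (-(n : ℝ))) *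
        ‖h‖ₑ ^ b := by gcongr; exact hinc hu v
    _ = κ * ∫⁻ w in Metric.closedBall 0 ‖v‖, lpIncrement p u w * ‖w‖ₑ ^ (-(n : ℝ)) *
          {h | ‖w‖ * θ ≤ ‖h‖}.indicator (‖·‖ₑ ^ b) h := by
        rw [mul_assoc, ← lintegral_mul_const _ (by fun_prop)]
        congr 1
        refine setLIntegral_congr_fun measurableSet_closedBall fun w hw => ?_
        have hwh : ‖w‖ * θ ≤ ‖h‖ := (mul_le_mul_of_nonneg_right (by simpa using hw) hθ).trans hvh
        rw [indicator_of_mem (show h ∈ {h | ‖w‖ * θ ≤ ‖h‖} from hwh)]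
    _ ≤ _ := by gcongr

/-- The energy of the increments with steps `V h` instead of `h`, where `θ⁻¹` is a Lipschitz
constant of `V`. -/
lemma exists_lintegral_lpIncrement_comp_le (n m : ℕ) (hp : 1 ≤ p) (hσ : 0 < σ) :
    ∃ κ : ℝ≥0∞, κ ≠ ∞ ∧ ∀ {u : E n → E m}, Measurable u → ∀ {V : E n → E n} {θ δ r : ℝ}, 0 < θ →
      (∀ᵐ h, ‖V h‖ * θ ≤ ‖h‖) → (∀ h, ‖V h‖ ≤ ‖h‖ + r) →
      ∫⁻ h in Metric.closedBall 0 δ, lpIncrement p u (V h) * ‖h‖ₑ ^ (-((n : ℝ) + σ)) ≤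
        κ * ENNReal.ofReal θ ^ (-σ) * localEnergy p σ u (δ + r) := by
  obtain ⟨κ₁, hκ₁, hinc⟩ := exists_lpIncrement_mul_rpow_le n m hp (-((n : ℝ) + σ))
  obtain ⟨κ₂, hκ₂, htail⟩ := exists_lpIncrement_mul_lintegral_tail_le n m hp hσ
  refine ⟨κ₁ * κ₂, ENNReal.mul_ne_top hκ₁ hκ₂, fun {u} hu V θ δ r hθ hVθ hVr => ?_⟩
  have hum := measurable_lpIncrement (p := p) hu
  let S : E n → Set (E n) := fun w => {h | ‖w‖ * θ ≤ ‖h‖}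
  have hS : ∀ w, MeasurableSet (S w) := fun w => measurableSet_le measurable_const measurable_norm
  let G : E n → E n → ℝ≥0∞ := fun h w => lpIncrement p u w * ‖w‖ₑ ^ (-(n : ℝ)) *
    (S w).indicator (‖·‖ₑ ^ (-((n : ℝ) + σ))) h
  have hG : Measurable (Function.uncurry G) := by
    have hind : Measurable ({x : E n × E n | ‖x.2‖ * θ ≤ ‖x.1‖}.indicator
        fun x => ‖x.1‖ₑ ^ (-((n : ℝ) + σ))) :=
      Measurable.indicator (by fun_prop) (measurableSet_le (by fun_prop) (by fun_prop))
    exact Measurable.mul (by fun_prop) hind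
  calc _ ≤ ∫⁻ h in Metric.closedBall 0 δ, κ₁ * ∫⁻ w in Metric.closedBall 0 (δ + r), G h w := by
        refine lintegral_mono_ae ?_
        filter_upwards [ae_restrict_mem measurableSet_closedBall, ae_restrict_of_ae hVθ]
          with h hh hVh
        rw [mem_closedBall_zero_iff] at hh
        exact hinc hu hθ.le hVh (by linarith [hVr h])
    _ ≤ ∫⁻ h, κ₁ * ∫⁻ w in Metric.closedBall 0 (δ + r), G h w := setLIntegral_le_lintegral _ _
    _ = κ₁ * ∫⁻ w in Metric.closedBall 0 (δ + r), ∫⁻ h, G h w := by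
        rw [lintegral_const_mul' _ _ hκ₁, lintegral_lintegral_swap hG.aemeasurable]
    _ ≤ κ₁ * ∫⁻ w in Metric.closedBall 0 (δ + r), κ₂ * ENNReal.ofReal θ ^ (-σ) *
          (lpIncrement p u w * ‖w‖ₑ ^ (-((n : ℝ) + σ))) := by
        gcongr with w
        rw [lintegral_const_mul _ (Measurable.indicator (by fun_prop) (hS w)),
          lintegral_indicator (hS w)]
        exact htail u w hθ
    _ = _ := by
        rw [lintegral_const_mul _ (by fun_prop), localEnergy]
        ring

end Increment

/-! ### Means over balls -/

section BallMean

lemma enorm_average_rpow_le {α V : Type*} [MeasurableSpace α] [NormedAddCommGroup V]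
    [NormedSpace ℝ V] {p : ℝ} (hp : 1 ≤ p) (μ : Measure α) [IsFiniteMeasure μ] [NeZero μ]
    {G : α → V} (hG : AEStronglyMeasurable G μ) :
    ‖⨍ t, G t ∂μ‖ₑ ^ p ≤ ⨍⁻ t, ‖G t‖ₑ ^ p ∂μ := by
  have hp0 : 0 < p := by linarith
  rw [average, laverage]
  set ν := (μ univ)⁻¹ • μ
  have hle : ‖∫ t, G t ∂ν‖ₑ ≤ eLpNorm G (ENNReal.ofReal p) ν := by
    refine (enorm_integral_le_lintegral_enorm G).trans ?_
    rw [← eLpNorm_one_eq_lintegral_enorm]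
    exact eLpNorm_le_eLpNorm_of_exponent_le (by simpa using hp) (hG.smul_measure _)
  refine (ENNReal.rpow_le_rpow hle hp0.le).trans_eq ?_
  rw [eLpNorm_eq_lintegral_rpow_enorm_toReal (by simpa using hp0) ENNReal.ofReal_ne_top,
    ENNReal.toReal_ofReal hp0.le, ← ENNReal.rpow_mul, one_div, inv_mul_cancel₀ hp0.ne',
    ENNReal.rpow_one]

lemma norm_setIntegral_sub_setIntegral_le {α V : Type*} [MeasurableSpace α]
    [NormedAddCommGroup V] [NormedSpace ℝ V] {μ : Measure α} {A B : Set α} (hA : MeasurableSet A)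
    (hB : MeasurableSet B) (hAμ : μ A ≠ ∞) (hBμ : μ B ≠ ∞) {G : α → V}
    (hG : AEStronglyMeasurable G μ) {M : ℝ} (hM : ∀ x, ‖G x‖ ≤ M) :
    ‖∫ x in A, G x ∂μ - ∫ x in B, G x ∂μ‖ ≤ M * (μ.real (A \ B) + μ.real (B \ A)) := by
  have hint : ∀ S, μ S ≠ ∞ → IntegrableOn G S μ := fun S hS =>
    IntegrableOn.of_bound hS.lt_top hG.restrict M (.of_forall hM)
  have hdiff : ∀ S T : Set α, μ S ≠ ∞ → ‖∫ x in S \ T, G x ∂μ‖ ≤ M * μ.real (S \ T) :=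
    fun S T hS => norm_setIntegral_le_of_norm_le_const
      ((measure_mono sdiff_subset).trans_lt hS.lt_top) fun x _ => hM x
  rw [← integral_inter_add_sdiff hB (hint A hAμ), ← integral_inter_add_sdiff hA (hint B hBμ),
    inter_comm B A, add_sub_add_left_eq_sub, mul_add]
  exact (norm_sub_le _ _).trans (add_le_add (hdiff A B hAμ) (hdiff B A hBμ))

variable {n m : ℕ} {p σ ρ : ℝ} {F : E n → E m} {M : ℝ}

lemma volume_real_ball (x : E n) {r : ℝ} (hr : 0 < r) :
    volume.real (Metric.ball x r) = r ^ n * volume.real (Metric.ball (0 : E n) 1) := by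
  rw [measureReal_def, Measure.addHaar_ball_of_pos volume x hr, finrank_euclideanSpace_fin,
    ENNReal.toReal_mul, ENNReal.toReal_ofReal (pow_nonneg hr.le n), measureReal_def]

lemma volume_real_ball_diff_ball_le (hρ : 0 < ρ) (x y : E n) :
    volume.real (Metric.ball x ρ \ Metric.ball y ρ) ≤
      volume.real (Metric.ball (0 : E n) ρ) * ((n + 1) / ρ * dist x y) := by
  have hV : 0 ≤ volume.real (Metric.ball (0 : E n) ρ) := measureReal_nonneg
  rw [div_mul_eq_mul_div]
  rcases le_or_gt ρ (dist x y) with hd | hd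
  · refine (measureReal_mono sdiff_subset measure_ball_lt_top.ne).trans ?_
    rw [Measure.addHaar_real_ball_center]
    refine le_mul_of_one_le_right hV ((one_le_div hρ).2 ?_)
    nlinarith [(n.cast_nonneg : (0 : ℝ) ≤ n), dist_nonneg (x := x) (y := y)]
  have hsub : Metric.ball x (ρ - dist x y) ⊆ Metric.ball y ρ := Metric.ball_subset_ball' (by simp)
  have hbern : 1 - n * (dist x y / ρ) ≤ (1 - dist x y / ρ) ^ n := by
    have := one_add_mul_le_pow (a := -(dist x y / ρ))
      (by linarith [(div_le_one hρ).2 hd.le]) n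
    rwa [mul_neg, ← sub_eq_add_neg, ← sub_eq_add_neg] at this
  calc _ ≤ volume.real (Metric.ball x ρ \ Metric.ball x (ρ - dist x y)) :=
        measureReal_mono (sdiff_subset_sdiff_right hsub)
          ((measure_mono sdiff_subset).trans_lt measure_ball_lt_top).ne
    _ = volume.real (Metric.ball (0 : E n) ρ) * (1 - (1 - dist x y / ρ) ^ n) := by
        rw [measureReal_sdiff (Metric.ball_subset_ball (by simp)) measurableSet_ball
          measure_ball_lt_top.ne, volume_real_ball x hρ, volume_real_ball x (by linarith),
          volume_real_ball 0 hρ, show ρ - dist x y = ρ * (1 - dist x y / ρ) by field_simp,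
          mul_pow]
        ring
    _ ≤ _ := by
        gcongr
        rw [add_mul, add_div, mul_div_assoc, one_mul]
        linarith [div_nonneg (dist_nonneg (x := x) (y := y)) hρ.le]

/-- The mean of `F` over the ball of radius `ρ` centred at `x`, which is a mollification of `F`
at scale `ρ`. -/
def ballMean (ρ : ℝ) (F : E n → E m) (x : E n) : E m := ⨍ y in Metric.ball x ρ, F y

lemma exists_lipschitzWith_ballMean (hρ : 0 < ρ) (hF : Measurable F) (hM : ∀ x, ‖F x‖ ≤ M) :
    ∃ L, LipschitzWith L (ballMean ρ F) := by
  have hM0 : 0 ≤ M := (norm_nonneg _).trans (hM 0)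
  have hV : 0 < volume.real (Metric.ball (0 : E n) ρ) := ENNReal.toReal_pos
    (Metric.measure_ball_pos _ _ hρ).ne' measure_ball_lt_top.ne
  refine ⟨Real.toNNReal (M * (2 * ((n + 1) / ρ))), LipschitzWith.of_dist_le_mul fun x y => ?_⟩
  have hint := norm_setIntegral_sub_setIntegral_le (μ := volume)
    (measurableSet_ball (x := x) (ε := ρ)) (measurableSet_ball (x := y) (ε := ρ))
    measure_ball_lt_top.ne measure_ball_lt_top.ne hF.aestronglyMeasurable hM
  rw [Real.coe_toNNReal _ (by positivity), dist_eq_norm, ballMean, ballMean, setAverage_eq,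
    setAverage_eq, Measure.addHaar_real_ball_center, Measure.addHaar_real_ball_center volume y,
    ← smul_sub, norm_smul, norm_inv, Real.norm_of_nonneg hV.le, inv_mul_le_iff₀ hV]
  have hxy := volume_real_ball_diff_ball_le hρ x y
  have hyx := volume_real_ball_diff_ball_le hρ y x
  rw [dist_comm y x] at hyx
  calc _ ≤ M * (_ + _) := hint.trans (mul_le_mul_of_nonneg_left (add_le_add hxy hyx) hM0)
    _ = _ := by ring

lemma ballMean_eq_setAverage_add (ρ : ℝ) (F : E n → E m) (x : E n) :
    ballMean ρ F x = ⨍ t in Metric.ball 0 ρ, F (x + t) := by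
  have hpre : (x + ·) ⁻¹' Metric.ball x ρ = Metric.ball 0 ρ := by rw [preimage_add_ball, sub_self]
  rw [ballMean, setAverage_eq, setAverage_eq, Measure.addHaar_real_ball_center, ← hpre,
    (measurePreserving_add_left volume x).setIntegral_preimage_emb
      (Homeomorph.addLeft x).measurableEmbedding]

instance isFiniteMeasure_restrict_ball (x : E n) (r : ℝ) :
    IsFiniteMeasure (volume.restrict (Metric.ball x r)) :=
  isFiniteMeasure_restrict.2 measure_ball_lt_top.ne

lemma neZero_restrict_ball (hρ : 0 < ρ) (x : E n) : NeZero (volume.restrict (Metric.ball x ρ)) :=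
  ⟨by simpa using (Metric.measure_ball_pos volume x hρ).ne'⟩

lemma enorm_ballMean_sub_rpow_le (hp : 1 ≤ p) (hρ : 0 < ρ) (hF : Measurable F)
    (hM : ∀ x, ‖F x‖ ≤ M) (x : E n) (a : E m) :
    ‖ballMean ρ F x - a‖ₑ ^ p ≤ ⨍⁻ y in Metric.ball x ρ, ‖F y - a‖ₑ ^ p ∂volume := by
  have := neZero_restrict_ball hρ x
  have hint : IntegrableOn F (Metric.ball x ρ) :=
    IntegrableOn.of_bound measure_ball_lt_top hF.aestronglyMeasurable M (.of_forall hM)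
  have hsub : ballMean ρ F x - a = ⨍ y in Metric.ball x ρ, (F y - a) := by
    rw [ballMean, average, average, integral_sub hint.to_average (integrable_const a),
      integral_const, probReal_univ, one_smul]
  rw [hsub]
  exact enorm_average_rpow_le hp _ (by fun_prop : Measurable fun y => F y - a).aestronglyMeasurable

lemma lpIncrement_ballMean_le (hp : 1 ≤ p) (hρ : 0 < ρ) (hF : Measurable F)
    (hM : ∀ x, ‖F x‖ ≤ M) (v : E n) : lpIncrement p (ballMean ρ F) v ≤ lpIncrement p F v := by
  have := neZero_restrict_ball hρ (0 : E n)
  calc lpIncrement p (ballMean ρ F) v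
      ≤ ∫⁻ x, ⨍⁻ t in Metric.ball 0 ρ, ‖F (x + v + t) - F (x + t)‖ₑ ^ p ∂volume := by
        refine lintegral_mono fun x => ?_
        have hint : ∀ y, IntegrableOn (fun t => F (y + t)) (Metric.ball 0 ρ) := fun y =>
          IntegrableOn.of_bound measure_ball_lt_top
            (by fun_prop : Measurable fun t => F (y + t)).aestronglyMeasurable M
            (.of_forall fun _ => hM _)
        rw [ballMean_eq_setAverage_add, ballMean_eq_setAverage_add, average, average,
          ← integral_sub (hint _).to_average (hint _).to_average]
        exact enorm_average_rpow_le hp _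
          (by fun_prop : Measurable fun t => F (x + v + t) - F (x + t)).aestronglyMeasurable
    _ = ⨍⁻ t in Metric.ball 0 ρ, (∫⁻ x, ‖F (x + v + t) - F (x + t)‖ₑ ^ p) ∂volume := by
        refine lintegral_lintegral_swap (Measurable.aemeasurable ?_)
        unfold Function.uncurry
        fun_prop
    _ = ⨍⁻ _t in Metric.ball (0 : E n) ρ, lpIncrement p F v ∂volume := by
        refine lintegral_congr fun t => ?_
        rw [lpIncrement, ← lintegral_add_right_eq_self (fun x => ‖F (x + v) - F x‖ₑ ^ p) t]
        simp_rw [add_right_comm]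
    _ = lpIncrement p F v := laverage_const _ _

lemma localEnergy_ballMean_le (hp : 1 ≤ p) (hρ : 0 < ρ) (hF : Measurable F)
    (hM : ∀ x, ‖F x‖ ≤ M) (r : ℝ) : localEnergy p σ (ballMean ρ F) r ≤ localEnergy p σ F r :=
  lintegral_mono fun w => mul_le_mul_left (lpIncrement_ballMean_le hp hρ hF hM w) _

/-- The density at `y` of the energy of the pairs at distance at most `r`. -/
def energyDensity (p σ : ℝ) (F : E n → E m) (r : ℝ) (y : E n) : ℝ≥0∞ :=
  ∫⁻ h in Metric.closedBall 0 r, ‖F (y + h) - F y‖ₑ ^ p * ‖h‖ₑ ^ (-((n : ℝ) + σ))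

lemma measurable_energyDensity (hF : Measurable F) (r : ℝ) :
    Measurable (energyDensity p σ F r) := by
  unfold energyDensity
  exact Measurable.lintegral_prod_right' (f := fun q : E n × E n =>
    ‖F (q.1 + q.2) - F q.1‖ₑ ^ p * ‖q.2‖ₑ ^ (-((n : ℝ) + σ))) (by fun_prop)

lemma lintegral_energyDensity (hF : Measurable F) (r : ℝ) :
    ∫⁻ y, energyDensity p σ F r y = localEnergy p σ F r := by
  unfold energyDensity localEnergy lpIncrement
  rw [lintegral_lintegral_swap (f := fun y h : E n =>
    ‖F (y + h) - F y‖ₑ ^ p * ‖h‖ₑ ^ (-((n : ℝ) + σ)))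
    (Measurable.aemeasurable (by unfold Function.uncurry; fun_prop))]
  exact lintegral_congr fun h => lintegral_mul_const _ (by fun_prop)

lemma setLIntegral_ball_enorm_sub_rpow_le (hσ : 0 ≤ σ) (hρ : 0 < ρ) (F : E n → E m) {x y : E n}
    (hy : y ∈ Metric.ball x ρ) :
    ∫⁻ z in Metric.ball x ρ, ‖F z - F y‖ₑ ^ p ≤
      ENNReal.ofReal (2 * ρ) ^ ((n : ℝ) + σ) * energyDensity p σ F (2 * ρ) y := by
  have hq : 0 ≤ (n : ℝ) + σ := by positivity
  have hpre : (y + ·) ⁻¹' Metric.ball x ρ ⊆ Metric.closedBall 0 (2 * ρ) := fun h hh => by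
    rw [mem_preimage, Metric.mem_ball] at hh
    rw [mem_closedBall_zero_iff, ← dist_self_add_left]
    linarith [dist_triangle_right (y + h) y x, Metric.mem_ball.1 hy]
  have hker : ∀ h ∈ Metric.closedBall (0 : E n) (2 * ρ),
      1 ≤ ENNReal.ofReal (2 * ρ) ^ ((n : ℝ) + σ) * ‖h‖ₑ ^ (-((n : ℝ) + σ)) := fun h hh => by
    have hle : ‖h‖ₑ ^ ((n : ℝ) + σ) ≤ ENNReal.ofReal (2 * ρ) ^ ((n : ℝ) + σ) := by
      rw [← ofReal_norm]
      gcongr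
      simpa using hh
    rwa [ENNReal.rpow_neg, ← div_eq_mul_inv, ENNReal.le_div_iff_mul_le
      (.inr (ENNReal.rpow_pos (by simpa using hρ) ENNReal.ofReal_ne_top).ne')
      (.inr (ENNReal.rpow_ne_top_of_nonneg hq ENNReal.ofReal_ne_top)), one_mul]
  rw [energyDensity, ← lintegral_const_mul' _ _
      (ENNReal.rpow_ne_top_of_nonneg hq ENNReal.ofReal_ne_top),
    ← (measurePreserving_add_left volume y).setLIntegral_comp_preimage_emb
      (Homeomorph.addLeft y).measurableEmbedding]
  refine (lintegral_mono_set hpre).trans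
    (setLIntegral_mono' measurableSet_closedBall fun h hh => ?_)
  rw [mul_left_comm]
  exact le_mul_of_one_le_right' (hker h hh)

lemma infEDist_ballMean_rpow_le (hp : 1 ≤ p) (hρ : 0 < ρ) (hF : Measurable F)
    (hM : ∀ x, ‖F x‖ ≤ M) {N : Set (E m)} {x : E n}
    (hN : ∀ᵐ y, y ∈ Metric.ball x ρ → F y ∈ N) :
    Metric.infEDist (ballMean ρ F x) N ^ p ≤
      ⨍⁻ y in Metric.ball x ρ, (⨍⁻ z in Metric.ball x ρ, ‖F z - F y‖ₑ ^ p ∂volume) ∂volume := by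
  have := neZero_restrict_ball hρ x
  rw [← laverage_const (volume.restrict (Metric.ball x ρ))
    (Metric.infEDist (ballMean ρ F x) N ^ p)]
  refine lintegral_mono_ae (Measure.ae_smul_measure ?_ _)
  filter_upwards [(ae_restrict_iff' measurableSet_ball).2 hN] with y hy
  refine (ENNReal.rpow_le_rpow (Metric.infEDist_le_edist_of_mem hy) (by linarith)).trans ?_
  rw [edist_eq_enorm_sub]
  exact enorm_ballMean_sub_rpow_le hp hρ hF hM x (F y)

lemma exists_infEDist_ballMean_rpow_le (n : ℕ) (hp : 1 ≤ p) (hσ : 0 ≤ σ) :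
    ∃ κ : ℝ≥0∞, κ ≠ ∞ ∧ ∀ {m : ℕ} {F : E n → E m} {M ρ : ℝ} {N : Set (E m)} {x : E n},
      Measurable F → (∀ x, ‖F x‖ ≤ M) → 0 < ρ → (∀ᵐ y, y ∈ Metric.ball x ρ → F y ∈ N) →
      Metric.infEDist (ballMean ρ F x) N ^ p ≤ κ * ENNReal.ofReal ρ ^ (σ - n) *
        ∫⁻ y in Metric.ball x ρ, energyDensity p σ F (2 * ρ) y := by
  set V := volume (Metric.ball (0 : E n) 1)
  have hV0 : V ≠ 0 := (Metric.measure_ball_pos _ _ one_pos).ne'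
  have hVt : V ≠ ∞ := measure_ball_lt_top.ne
  have hq : 0 ≤ (n : ℝ) + σ := by positivity
  refine ⟨V⁻¹ ^ 2 * 2 ^ ((n : ℝ) + σ), ENNReal.mul_ne_top (by simpa using hV0)
    (ENNReal.rpow_ne_top_of_nonneg hq ENNReal.ofNat_ne_top), fun {m F M ρ N x} hF hM hρ hN => ?_⟩
  have hρ0 : ENNReal.ofReal ρ ≠ 0 := by simpa using hρ
  calc Metric.infEDist (ballMean ρ F x) N ^ p
      ≤ ⨍⁻ y in Metric.ball x ρ, (⨍⁻ z in Metric.ball x ρ, ‖F z - F y‖ₑ ^ p ∂volume) ∂volume :=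
        infEDist_ballMean_rpow_le hp hρ hF hM hN
    _ ≤ (volume (Metric.ball x ρ))⁻¹ * ∫⁻ y in Metric.ball x ρ, (volume (Metric.ball x ρ))⁻¹ *
          (ENNReal.ofReal (2 * ρ) ^ ((n : ℝ) + σ) * energyDensity p σ F (2 * ρ) y) := by
        simp_rw [setLAverage_eq, div_eq_mul_inv, mul_comm _ (volume _)⁻¹]
        exact mul_le_mul_right (setLIntegral_mono' measurableSet_ball fun y hy =>
          mul_le_mul_right (setLIntegral_ball_enorm_sub_rpow_le hσ hρ F hy) _) _
    _ = _ := by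
        have hexp : ENNReal.ofReal ρ ^ (σ - n) =
            (ENNReal.ofReal ρ ^ n)⁻¹ ^ 2 * ENNReal.ofReal ρ ^ ((n : ℝ) + σ) := by
          rw [show σ - n = -n + (-n + (n + σ)) by ring,
            ENNReal.rpow_add _ _ hρ0 ENNReal.ofReal_ne_top,
            ENNReal.rpow_add _ _ hρ0 ENNReal.ofReal_ne_top, ENNReal.rpow_neg,
            ENNReal.rpow_natCast, sq, mul_assoc]
        rw [lintegral_const_mul _ ((measurable_energyDensity hF _).const_mul _),
          lintegral_const_mul _ (measurable_energyDensity hF _),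
          Measure.addHaar_ball_of_pos volume x hρ, finrank_euclideanSpace_fin,
          ENNReal.mul_inv (.inr hVt) (.inr hV0), ENNReal.ofReal_pow hρ.le,
          ENNReal.ofReal_mul two_pos.le, ENNReal.ofReal_ofNat, ENNReal.mul_rpow_of_nonneg _ _ hq,
          hexp]
        ring

end BallMean

/-! ### Averages over the translations of the grid -/

section Average

variable {n m j : ℕ} {p σ ε : ℝ} {u F : E n → E m}

lemma gridProj_add_eq (hε : ε ≠ 0) (τ x h : E n) :
    gridProj j ε τ (x + h) =
      x + ε • (skelProj j (ε⁻¹ • x + τ + ε⁻¹ • h) - (ε⁻¹ • x + τ)) := by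
  rw [gridProj, smul_sub, smul_sub, smul_add ε _ τ, smul_inv_smul₀ hε,
    show ε⁻¹ • (x + h) + τ = ε⁻¹ • x + τ + ε⁻¹ • h by rw [smul_add]; abel]
  abel

lemma lintegral_cell_lpIncrement_comp_gridProj (hj : j < n) (hε : ε ≠ 0) (hu : Measurable u)
    (h : E n) :
    ∫⁻ τ in cell n, lpIncrement p (u ∘ gridProj j ε τ) h =
      ∫⁻ z in cell n, lpIncrement p u (ε • (skelProj j (z + ε⁻¹ • h) - skelProj j z)) := by
  have hsk := measurable_skelProj (n := n) hj
  let Φ : E n → E n → ℝ≥0∞ := fun x z =>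
    ‖u (x + ε • (skelProj j (z + ε⁻¹ • h) - z)) - u (x + ε • (skelProj j z - z))‖ₑ ^ p
  have hΦ : Measurable (Function.uncurry Φ) := by
    unfold Function.uncurry
    fun_prop
  calc _ = ∫⁻ τ in cell n, ∫⁻ x, Φ x (ε⁻¹ • x + τ) := by
        refine lintegral_congr fun τ => lintegral_congr fun x => ?_
        simp only [Φ, Function.comp_apply]
        rw [gridProj_add_eq hε, gridProj_eq hε]
    _ = ∫⁻ z in cell n, ∫⁻ x, Φ x z := lintegral_cell_lintegral_comp hΦ (fun x z k => by
        simp only [Φ]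
        rw [add_right_comm, skelProj_add, skelProj_add, add_sub_add_right_eq_sub,
          add_sub_add_right_eq_sub]) ε
    _ = _ := by
        refine lintegral_congr fun z => ?_
        rw [lpIncrement, ← lintegral_add_right_eq_self (fun x => ‖u (x + ε •
          (skelProj j (z + ε⁻¹ • h) - skelProj j z)) - u x‖ₑ ^ p) (ε • (skelProj j z - z))]
        refine lintegral_congr fun x => ?_
        simp only [Φ]
        rw [add_assoc x, ← smul_add, sub_add_sub_cancel']

lemma norm_smul_skelProj_sub_le (hj : j < n) (hε : 0 < ε) (z h : E n) :
    ‖ε • (skelProj j (z + ε⁻¹ • h) - skelProj j z)‖ ≤ ‖h‖ + 2 * √n * ε := by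
  have hsplit : skelProj j (z + ε⁻¹ • h) - skelProj j z =
      (skelProj j (z + ε⁻¹ • h) - (z + ε⁻¹ • h)) - (skelProj j z - z) + ε⁻¹ • h := by abel
  rw [hsplit, smul_add, smul_inv_smul₀ hε.ne', add_comm ‖h‖]
  refine (norm_add_le _ _).trans (add_le_add_left ?_ _)
  rw [norm_smul, Real.norm_of_nonneg hε.le, mul_comm]
  gcongr
  linarith [norm_sub_le (skelProj j (z + ε⁻¹ • h) - (z + ε⁻¹ • h)) (skelProj j z - z),
    norm_skelProj_sub_self_le hj (z + ε⁻¹ • h), norm_skelProj_sub_self_le hj z]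

lemma norm_smul_skelProj_sub_mul_le (hj : j < n) (hε : 0 < ε) {z h : E n} (hz : depth j z ≠ 0)
    (hzh : depth j (z + ε⁻¹ • h : E n) ≠ 0) :
    ‖ε • (skelProj j (z + ε⁻¹ • h) - skelProj j z)‖ * ((2 * √n)⁻¹ * depth j z) ≤ ‖h‖ := by
  have hn : 0 < √(n : ℝ) := Real.sqrt_pos.2 (Nat.cast_pos.2 (by omega))
  have hz0 : 0 < depth j z := (depth_nonneg _ _).lt_of_ne' hz
  have hle := norm_skelProj_sub_le hj hzh hz
  rw [add_sub_cancel_left, norm_smul, norm_inv, Real.norm_of_nonneg hε.le, le_div_iff₀ hz0] at hle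
  rw [norm_smul, Real.norm_of_nonneg hε.le]
  calc ε * ‖skelProj j (z + ε⁻¹ • h) - skelProj j z‖ * ((2 * √n)⁻¹ * depth j z)
      = ε * (2 * √n)⁻¹ * (‖skelProj j (z + ε⁻¹ • h) - skelProj j z‖ * depth j z) := by ring
    _ ≤ ε * (2 * √n)⁻¹ * (2 * √n * (ε⁻¹ * ‖h‖)) := by gcongr
    _ = ‖h‖ := by field_simp

lemma measurable_lpIncrement_comp_gridProj (hj : j < n) (ε : ℝ) (hu : Measurable u) :
    Measurable fun q : E n × E n => lpIncrement p (u ∘ gridProj j ε q.1) q.2 := by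
  have hadd : Measurable fun y : (E n × E n) × E n => gridProj j ε y.1.1 (y.2 + y.1.2) :=
    measurable_gridProj hj ε (by fun_prop) (by fun_prop)
  have hid : Measurable fun y : (E n × E n) × E n => gridProj j ε y.1.1 y.2 :=
    measurable_gridProj hj ε (by fun_prop) (by fun_prop)
  exact Measurable.lintegral_prod_right' (f := fun y : (E n × E n) × E n =>
    ‖u (gridProj j ε y.1.1 (y.2 + y.1.2)) - u (gridProj j ε y.1.1 y.2)‖ₑ ^ p) (by fun_prop)

lemma measurable_localEnergy_comp_gridProj (hj : j < n) (ε : ℝ) (hu : Measurable u) (δ : ℝ) :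
    Measurable fun τ : E n => localEnergy p σ (u ∘ gridProj j ε τ) δ :=
  ((measurable_lpIncrement_comp_gridProj hj ε hu).mul
    (by fun_prop : Measurable fun q : E n × E n =>
      ‖q.2‖ₑ ^ (-((n : ℝ) + σ)))).lintegral_prod_right'

lemma lintegral_cell_localEnergy_comp_gridProj (hj : j < n) (hε : ε ≠ 0) (hu : Measurable u)
    (δ : ℝ) :
    ∫⁻ τ in cell n, localEnergy p σ (u ∘ gridProj j ε τ) δ =
      ∫⁻ z in cell n, ∫⁻ h in Metric.closedBall 0 δ,
        lpIncrement p u (ε • (skelProj j (z + ε⁻¹ • h) - skelProj j z)) *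
          ‖h‖ₑ ^ (-((n : ℝ) + σ)) := by
  have hsk := measurable_skelProj (n := n) hj
  have hinc := measurable_lpIncrement (p := p) hu
  have hcomp := measurable_lpIncrement_comp_gridProj (p := p) hj ε hu
  have hker : Measurable fun q : E n × E n => ‖q.2‖ₑ ^ (-((n : ℝ) + σ)) := by fun_prop
  unfold localEnergy
  rw [lintegral_lintegral_swap (hcomp.mul hker).aemeasurable,
    lintegral_lintegral_swap (f := fun z h => lpIncrement p u _ * _)
    (Measurable.aemeasurable (by unfold Function.uncurry; fun_prop))]
  refine lintegral_congr fun h => ?_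
  have hτ : Measurable fun τ => lpIncrement p (u ∘ gridProj j ε τ) h :=
    hcomp.comp (f := fun τ => (τ, h)) (by fun_prop)
  rw [lintegral_mul_const _ hτ, lintegral_mul_const _ (by fun_prop),
    lintegral_cell_lpIncrement_comp_gridProj hj hε hu]

lemma exists_lintegral_cell_localEnergy_comp_gridProj_le (m : ℕ) (hj : j < n) (hp : 1 ≤ p)
    (hσ : 0 < σ) (hσj : σ < j + 1) :
    ∃ κ : ℝ≥0∞, κ ≠ ∞ ∧ ∀ {u : E n → E m}, Measurable u → ∀ {ε : ℝ}, 0 < ε → ∀ δ : ℝ,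
      ∫⁻ τ in cell n, localEnergy p σ (u ∘ gridProj j ε τ) δ ≤
        κ * localEnergy p σ u (δ + 2 * √n * ε) := by
  obtain ⟨κ, hκ, hcomp⟩ := exists_lintegral_lpIncrement_comp_le n m hp hσ
  have hc : 0 < (2 * √(n : ℝ))⁻¹ :=
    inv_pos.2 (mul_pos two_pos (Real.sqrt_pos.2 (Nat.cast_pos.2 (by omega))))
  have hd := (continuous_depth (n := n) hj).measurable
  set I : ℝ≥0∞ := ∫⁻ z : E n in cell n, ENNReal.ofReal (depth j z) ^ (-σ)
  refine ⟨κ * ENNReal.ofReal (2 * √n)⁻¹ ^ (-σ) * I, ENNReal.mul_ne_top (ENNReal.mul_ne_top hκ ?_)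
    (lintegral_cell_depth_rpow_lt_top hj hσ.le hσj).ne, fun {u} hu ε hε δ => ?_⟩
  · rw [ENNReal.ofReal_rpow_of_pos hc]
    exact ENNReal.ofReal_ne_top
  rw [lintegral_cell_localEnergy_comp_gridProj hj hε.ne' hu]
  calc _ ≤ ∫⁻ z in cell n, κ * ENNReal.ofReal ((2 * √n)⁻¹ * depth j z) ^ (-σ) *
          localEnergy p σ u (δ + 2 * √n * ε) := by
        refine lintegral_mono_ae ?_
        filter_upwards [ae_restrict_of_ae (ae_depth_ne_zero hj)] with z hz
        refine hcomp hu (mul_pos hc ((depth_nonneg _ _).lt_of_ne' hz)) ?_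
          (norm_smul_skelProj_sub_le hj hε z)
        filter_upwards [ae_depth_smul_add_ne_zero hj (inv_ne_zero hε.ne') z] with h hh
        exact norm_smul_skelProj_sub_mul_le hj hε hz (by rwa [add_comm])
    _ = ∫⁻ z in cell n, κ * ENNReal.ofReal (2 * √n)⁻¹ ^ (-σ) *
          localEnergy p σ u (δ + 2 * √n * ε) * ENNReal.ofReal (depth j z) ^ (-σ) := by
        refine lintegral_congr fun z => ?_
        rw [ENNReal.ofReal_mul hc.le, ENNReal.mul_rpow_of_ne_top ENNReal.ofReal_ne_top
          ENNReal.ofReal_ne_top]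
        ring
    _ = _ := by
        rw [lintegral_const_mul _ (by fun_prop)]
        ring

lemma lintegral_cell_lintegral_comp_gridProj_sub_le (hj : j < n) (hε : 0 < ε) (hu : Measurable u)
    (hF : Measurable F) {b : ℝ≥0∞}
    (hb : ∀ v : E n, ‖v‖ ≤ √n * ε → ∫⁻ x, ‖u (x + v) - F x‖ₑ ^ p ≤ b) :
    ∫⁻ τ in cell n, ∫⁻ x, ‖u (gridProj j ε τ x) - F x‖ₑ ^ p ≤ b * volume (cell n) := by
  have hsk := measurable_skelProj (n := n) hj
  let Φ : E n → E n → ℝ≥0∞ := fun x z => ‖u (x + ε • (skelProj j z - z)) - F x‖ₑ ^ p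
  have hΦ : Measurable (Function.uncurry Φ) := by
    unfold Function.uncurry
    fun_prop
  calc _ = ∫⁻ τ in cell n, ∫⁻ x, Φ x (ε⁻¹ • x + τ) := by simp only [Φ, gridProj_eq hε.ne']
    _ = ∫⁻ z in cell n, ∫⁻ x, Φ x z := lintegral_cell_lintegral_comp hΦ (fun x z k => by
        simp only [Φ]
        rw [skelProj_add, add_sub_add_right_eq_sub]) ε
    _ ≤ ∫⁻ _z in cell n, b := by
        refine lintegral_mono fun z => hb _ ?_
        rw [norm_smul, Real.norm_of_nonneg hε.le, mul_comm]
        gcongr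
        exact norm_skelProj_sub_self_le hj z
    _ = _ := setLIntegral_const _ _

lemma lintegral_cell_setLIntegral_nearSkel {g : E n → ℝ≥0∞} (hg : Measurable g) (j : ℕ)
    (r ε : ℝ) :
    ∫⁻ τ in cell n, ∫⁻ y in {y | ε⁻¹ • y + τ ∈ nearSkel j r}, g y =
      (∫⁻ y, g y) * volume (cell n ∩ nearSkel j r) := by
  have hS := measurableSet_nearSkel (n := n) j r
  let Φ : E n → E n → ℝ≥0∞ := fun y z => (nearSkel j r).indicator (fun _ => g y) z
  have hΦ : Measurable (Function.uncurry Φ) :=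
    Measurable.indicator (f := fun x : E n × E n => g x.1) (by fun_prop) (measurable_snd hS)
  calc _ = ∫⁻ τ in cell n, ∫⁻ y, Φ y (ε⁻¹ • y + τ) := by
        refine lintegral_congr fun τ => ?_
        exact (lintegral_indicator
          ((by fun_prop : Measurable fun y : E n => ε⁻¹ • y + τ) hS) g).symm
    _ = ∫⁻ z in cell n, ∫⁻ y, Φ y z := lintegral_cell_lintegral_comp hΦ (fun y z k =>
        indicator_eq_indicator (nearSkel_add j r z k) rfl) ε
    _ = ∫⁻ z in cell n, (nearSkel j r).indicator (fun _ => ∫⁻ y, g y) z := by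
        refine lintegral_congr fun z => ?_
        by_cases hz : z ∈ nearSkel j r
        · simp only [Φ, indicator_of_mem hz]
        · simp only [Φ, indicator_of_notMem hz, lintegral_zero]
    _ = _ := by rw [lintegral_indicator_const hS, Measure.restrict_apply hS, inter_comm]

end Average

/-! ### Extension by a cutoff -/

section Extension

variable {n m : ℕ} {p σ r M : ℝ} {U : Set (E n)} {g : E n → E m}

lemma enorm_smul_sub_smul_rpow_le (hp : 1 ≤ p) {χ : E n → ℝ} {K : ℝ≥0} (hχ : LipschitzWith K χ)
    (hχ1 : ∀ x, ‖χ x‖ₑ ≤ 1) (hM : ∀ x, ‖g x‖ ≤ M) (x h : E n) :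
    ‖χ (x + h) • g (x + h) - χ x • g x‖ₑ ^ p ≤
      2 ^ (p - 1) * (‖g (x + h) - g x‖ₑ ^ p + (K * ENNReal.ofReal M) ^ p * ‖h‖ₑ ^ p) := by
  have hp0 : 0 ≤ p := by linarith
  have hsplit : χ (x + h) • g (x + h) - χ x • g x =
      χ (x + h) • (g (x + h) - g x) + (χ (x + h) - χ x) • g x := by
    rw [smul_sub, sub_smul]
    abel
  have hinc : ‖χ (x + h) - χ x‖ₑ ≤ K * ‖h‖ₑ := by
    simpa [edist_eq_enorm_sub] using hχ (x + h) x
  have hg : ‖g x‖ₑ ≤ ENNReal.ofReal M := by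
    rw [← ofReal_norm]
    exact ENNReal.ofReal_le_ofReal (hM x)
  rw [hsplit]
  refine (enorm_add_rpow_le hp _ _).trans ?_
  rw [← ENNReal.mul_rpow_of_nonneg _ _ hp0, enorm_smul, enorm_smul, mul_right_comm]
  gcongr
  exact mul_le_of_le_one_left' (hχ1 _)

lemma smul_sub_smul_eq_zero {χ : E n → ℝ} (hU : ∀ x y, χ x ≠ 0 → dist x y ≤ r → y ∈ U)
    {x h : E n} (hh : ‖h‖ ≤ r) (hx : x ∉ U ∨ x + h ∉ U) :
    χ (x + h) • g (x + h) - χ x • g x = 0 := by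
  have hr := (norm_nonneg h).trans hh
  have hχx : χ x = 0 := by
    by_contra hne
    exact hx.elim (· (hU x x hne (by simpa using hr))) (· (hU x _ hne (by simpa using hh)))
  have hχxh : χ (x + h) = 0 := by
    by_contra hne
    exact hx.elim (· (hU _ x hne (by simpa using hh))) (· (hU _ _ hne (by simpa using hr)))
  rw [hχx, hχxh, zero_smul, zero_smul, sub_zero]

lemma energyDensity_smul_le (hp : 1 ≤ p) {χ : E n → ℝ} {K : ℝ≥0} (hχ : LipschitzWith K χ)
    (hχ1 : ∀ x, ‖χ x‖ₑ ≤ 1) (hUm : MeasurableSet U)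
    (hU : ∀ x y, χ x ≠ 0 → dist x y ≤ r → y ∈ U) (hM : ∀ x, ‖g x‖ ≤ M)
    (x : E n) :
    energyDensity p σ (fun x => χ x • g x) r x ≤ 2 ^ (p - 1) *
      ((∫⁻ y in U, ‖g x - g y‖ₑ ^ p / ‖x - y‖ₑ ^ ((n : ℝ) + σ)) + (K * ENNReal.ofReal M) ^ p *
        ∫⁻ h in Metric.closedBall (0 : E n) r, ‖h‖ₑ ^ p * ‖h‖ₑ ^ (-((n : ℝ) + σ))) := by
  have hp0 : 0 < p := by linarith
  set q : ℝ := n + σ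
  have hk : Measurable fun h : E n => ‖h‖ₑ ^ p * ‖h‖ₑ ^ (-q) := by fun_prop
  rw [← lintegral_indicator hUm, ← lintegral_add_left_eq_self _ x]
  calc energyDensity p σ (fun x => χ x • g x) r x
      ≤ ∫⁻ h in Metric.closedBall 0 r, 2 ^ (p - 1) *
        (U.indicator (fun y => ‖g x - g y‖ₑ ^ p / ‖x - y‖ₑ ^ q) (x + h) +
          (K * ENNReal.ofReal M) ^ p * (‖h‖ₑ ^ p * ‖h‖ₑ ^ (-q))) := by
        refine setLIntegral_mono' measurableSet_closedBall fun h hh => ?_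
        beta_reduce
        by_cases hxh : x + h ∈ U
        · rw [indicator_of_mem hxh, sub_add_cancel_left, enorm_neg, div_eq_mul_inv,
            ← ENNReal.rpow_neg, enorm_sub_rev (g x), ← mul_assoc _ _ (‖h‖ₑ ^ (-q)), ← add_mul,
            ← mul_assoc]
          exact mul_le_mul_left (enorm_smul_sub_smul_rpow_le hp hχ hχ1 hM x h) _
        · rw [smul_sub_smul_eq_zero hU (mem_closedBall_zero_iff.1 hh) (.inr hxh), enorm_zero,
            ENNReal.zero_rpow_of_pos hp0, zero_mul]
          exact zero_le
    _ = 2 ^ (p - 1) * ((∫⁻ h in Metric.closedBall 0 r,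
          U.indicator (fun y => ‖g x - g y‖ₑ ^ p / ‖x - y‖ₑ ^ q) (x + h)) +
          (K * ENNReal.ofReal M) ^ p *
            ∫⁻ h in Metric.closedBall (0 : E n) r, ‖h‖ₑ ^ p * ‖h‖ₑ ^ (-q)) := by
        rw [lintegral_const_mul' _ _ (by simp), lintegral_add_right _ (hk.const_mul _),
          lintegral_const_mul _ hk]
    _ ≤ _ := by
        gcongr
        exact Measure.restrict_le_self

lemma localEnergy_smul_ne_top [Nontrivial (E n)] {s : ℝ} (hp : 1 ≤ p) (hs1 : s < 1)
    {χ : E n → ℝ} {K : ℝ≥0} (hχ : LipschitzWith K χ) (hχ1 : ∀ x, ‖χ x‖ₑ ≤ 1)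
    (hUm : MeasurableSet U) (hUv : volume U ≠ ∞)
    (hU : ∀ x y, χ x ≠ 0 → dist x y ≤ r → y ∈ U) (hg : Measurable g) (hM : ∀ x, ‖g x‖ ≤ M)
    (hfin : gagliardoEnergy s p U g ≠ ∞) :
    localEnergy p (s * p) (fun x => χ x • g x) r ≠ ∞ := by
  have hp0 : 0 < p := by linarith
  have hI : ∫⁻ h in Metric.closedBall (0 : E n) r, ‖h‖ₑ ^ p * ‖h‖ₑ ^ (-((n : ℝ) + s * p)) ≠ ∞ := by
    refine ne_top_of_le_ne_top (lintegral_ball_enorm_rpow_lt_top volume (a := p - (n + s * p))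
      (by rw [finrank_euclideanSpace_fin]; nlinarith) (r + 1)).ne ?_
    refine (lintegral_mono_set (Metric.closedBall_subset_ball (by linarith))).trans
      (lintegral_mono_ae (ae_restrict_of_ae ?_))
    filter_upwards [Measure.ae_ne volume (0 : E n)] with h hh
    rw [← ENNReal.rpow_add _ _ (by simpa using hh) enorm_ne_top, sub_eq_add_neg]
  have hout : ∀ x ∉ U, energyDensity p (s * p) (fun x => χ x • g x) r x = 0 := fun x hx => by
    refine (setLIntegral_congr_fun measurableSet_closedBall fun h hh => ?_).trans lintegral_zero
    beta_reduce
    rw [smul_sub_smul_eq_zero hU (mem_closedBall_zero_iff.1 hh) (.inl hx), enorm_zero,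
      ENNReal.zero_rpow_of_pos hp0, zero_mul]
  have hc : (K * ENNReal.ofReal M) ^ p ≠ ∞ := ENNReal.rpow_ne_top_of_nonneg hp0.le
    (ENNReal.mul_ne_top ENNReal.coe_ne_top ENNReal.ofReal_ne_top)
  rw [← lintegral_energyDensity (F := fun x => χ x • g x) (hχ.continuous.measurable.smul hg),
    ← setLIntegral_eq_of_support_subset (s := U) (fun x hx => not_not.1 fun h => hx (hout x h))]
  refine ne_top_of_le_ne_top ?_
    (lintegral_mono fun x => energyDensity_smul_le hp hχ hχ1 hUm hU hM x)
  rw [lintegral_const_mul' _ _ (by simp), lintegral_add_right _ measurable_const,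
    setLIntegral_const]
  exact ENNReal.mul_ne_top (by simp)
    (ENNReal.add_ne_top.2 ⟨hfin, ENNReal.mul_ne_top (ENNReal.mul_ne_top hc hI) hUv⟩)

lemma tendsto_localEnergy_zero (hr : 0 < r)
    (hfin : localEnergy p σ g r ≠ ∞) (hp : 1 ≤ p) :
    Tendsto (localEnergy p σ g) (𝓝[>] 0) (𝓝 0) := by
  set ν := (volume : Measure (E n)).withDensity
    fun w => lpIncrement p g w * ‖w‖ₑ ^ (-((n : ℝ) + σ))
  have hν : localEnergy p σ g = ν ∘ Metric.closedBall 0 := by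
    ext r
    exact (withDensity_apply _ measurableSet_closedBall).symm
  have h0 : ν (⋂ r > (0 : ℝ), Metric.closedBall 0 r) = 0 := by
    have : ⋂ r > (0 : ℝ), Metric.closedBall (0 : E n) r = {0} := by
      ext x
      simp only [mem_iInter, mem_closedBall_zero_iff, mem_singleton_iff]
      exact ⟨fun h => norm_le_zero_iff.1 (le_of_forall_gt_imp_ge_of_dense h),
        fun h r hr => by simpa [h] using le_of_lt hr⟩
    rw [this, withDensity_apply _ (measurableSet_singleton _), lintegral_singleton,
      lpIncrement_zero hp]
    simp
  rw [hν] at hfin ⊢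
  rw [← h0]
  exact tendsto_measure_biInter_gt (fun _ _ => measurableSet_closedBall.nullMeasurableSet)
    (fun _ _ _ h => Metric.closedBall_subset_closedBall h) ⟨r, hr, hfin⟩

lemma gagliardoEnergy_congr_ae {s : ℝ} {v w : E n → E m} (h : v =ᵐ[volume.restrict U] w) :
    gagliardoEnergy s p U v = gagliardoEnergy s p U w := by
  refine lintegral_congr_ae ?_
  filter_upwards [h] with x hx
  refine lintegral_congr_ae ?_
  filter_upwards [h] with y hy
  rw [hx, hy]

lemma MemWsp.mono_set {s : ℝ} {ω : Set (E n)} {N : Set (E m)} (hp : 0 ≤ p)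
    (hg : MemWsp s p ω N g) (hU : U ⊆ ω) : MemWsp s p U N g := by
  have hμ : volume.restrict U ≤ volume.restrict ω := Measure.restrict_mono hU le_rfl
  refine ⟨hg.1.mono_measure hμ, lt_of_le_of_lt ?_ hg.2.1, ae_mono hμ hg.2.2⟩
  unfold wspNorm gagliardoEnergy
  gcongr

lemma MemWsp.gagliardoEnergy_ne_top {s : ℝ} {N : Set (E m)} (hp : 0 < p)
    (hg : MemWsp s p U N g) : gagliardoEnergy s p U g ≠ ∞ := fun h => by
  have := hg.2.1
  simp [wspNorm, h, hp] at this

lemma exists_lipschitz_cutoff {X : Type*} [PseudoMetricSpace X] (A : Set X) {b : ℝ} (hb : 0 < b) :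
    ∃ (χ : X → ℝ) (K : ℝ≥0), LipschitzWith K χ ∧ (∀ x, ‖χ x‖ₑ ≤ 1) ∧
      (∀ x ∈ Metric.cthickening (b / 3) A, χ x = 1) ∧
      ∀ x y, χ x ≠ 0 → dist x y ≤ b / 3 → y ∈ Metric.cthickening b A := by
  have hb3 : 0 < b / 3 := by positivity
  set χ := thickenedIndicator hb3 (Metric.cthickening (b / 3) A)
  refine ⟨fun x => χ x, _, fun x y => lipschitzWith_thickenedIndicator hb3 _ x y, fun x => ?_,
    fun x hx => by simp [χ, thickenedIndicator_one hb3 _ hx], fun x y hx hxy => ?_⟩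
  · rw [← ofReal_norm, NNReal.norm_eq]
    exact ENNReal.ofReal_le_one.2 (by exact_mod_cast thickenedIndicator_le_one hb3 _ x)
  have hxt : x ∈ Metric.thickening (b / 3) (Metric.cthickening (b / 3) A) := by
    by_contra hxt
    exact hx (by simp [χ, thickenedIndicator_zero hb3 _ hxt])
  have hx' := (Metric.thickening_subset_cthickening _ _).trans
    (Metric.cthickening_cthickening_subset hb3.le hb3.le _) hxt
  have hy := Metric.mem_cthickening_of_dist_le y x (b / 3) _ hx' (dist_comm x y ▸ hxy)
  exact Metric.cthickening_mono (by linarith) _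
    (Metric.cthickening_cthickening_subset hb3.le (by linarith) _ hy)

lemma exists_extension [Nontrivial (E n)] {s : ℝ} (hs1 : s < 1) (hp : 1 ≤ p) {N : Set (E m)}
    (hN : Bornology.IsBounded N) {Ω ω : Set (E n)} (hΩ : Bornology.IsBounded Ω) (hω : IsOpen ω)
    (hΩω : closure Ω ⊆ ω) {f : E n → E m} (hf : MemWsp s p ω N f) :
    ∃ (F : E n → E m) (M a : ℝ), Measurable F ∧ (∀ x, ‖F x‖ ≤ M) ∧ 0 < a ∧
      Metric.cthickening a Ω ⊆ ω ∧ (∀ᵐ x, x ∈ Metric.cthickening a Ω → F x = f x ∧ F x ∈ N) ∧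
      localEnergy p (s * p) F a ≠ ∞ := by
  have hp0 : 0 < p := by linarith
  obtain ⟨b, hb, hbω⟩ := hΩ.isCompact_closure.exists_cthickening_subset_open hω hΩω
  rw [Metric.cthickening_closure] at hbω
  set U := Metric.cthickening b Ω
  have hUm : MeasurableSet U := Metric.isClosed_cthickening.measurableSet
  obtain ⟨hfm, -, hfN⟩ := hf.mono_set hp0.le hbω
  obtain ⟨M, hM0, hM⟩ := hN.exists_pos_norm_le
  obtain ⟨g, hg, hgM, hfg⟩ := hfm.aemeasurable.exists_ae_eq_range_subset
    (t := Metric.closedBall 0 M) (hfN.mono fun x hx => by simpa using hM _ hx)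
    ⟨0, Metric.mem_closedBall_self hM0.le⟩
  have hgM' : ∀ x, ‖g x‖ ≤ M := fun x => by simpa using hgM (mem_range_self x)
  obtain ⟨χ, K, hχ, hχ_le, hχ_one, hχ_supp⟩ := exists_lipschitz_cutoff Ω hb
  refine ⟨fun x => χ x • g x, M, b / 3, hχ.continuous.measurable.smul hg, fun x => ?_,
    by positivity, (Metric.cthickening_mono (by linarith) Ω).trans hbω, ?_, ?_⟩
  · have hχx : ‖χ x‖ ≤ 1 := by simpa [← ofReal_norm] using hχ_le x
    rw [norm_smul]
    exact (mul_le_of_le_one_left (norm_nonneg _) hχx).trans (hgM' x)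
  · filter_upwards [(ae_restrict_iff' hUm).1 hfg, (ae_restrict_iff' hUm).1 hfN]
      with x hfx hxN hx
    have hxU : x ∈ U := Metric.cthickening_mono (by linarith) Ω hx
    rw [hχ_one x hx, one_smul]
    exact ⟨(hfx hxU).symm, hfx hxU ▸ hxN hxU⟩
  · refine localEnergy_smul_ne_top hp hs1 hχ hχ_le hUm hΩ.cthickening.measure_lt_top.ne hχ_supp
      hg hgM' ?_
    rw [← gagliardoEnergy_congr_ae hfg]
    exact (hf.mono_set hp0.le hbω).gagliardoEnergy_ne_top hp0

end Extension

/-! ### Choice of the grid -/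

section GridChoice

variable {n m j : ℕ} {p σ M : ℝ} {F : E n → E m}

lemma exists_forall_le_of_lintegral_le {α ι : Type*} [Fintype ι] [Nonempty ι]
    [MeasurableSpace α] {μ : Measure α} {D : Set α} (hD0 : μ D ≠ 0) (hDt : μ D ≠ ∞)
    {X : ι → α → ℝ≥0∞} (hX : ∀ i, AEMeasurable (X i) (μ.restrict D)) {b : ι → ℝ≥0∞}
    (hb0 : ∀ i, b i ≠ 0) (hbt : ∀ i, b i ≠ ∞)
    (h : ∀ i, ∫⁻ x in D, X i x ∂μ ≤ b i * (μ D / Fintype.card ι)) :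
    ∃ x ∈ D, ∀ i, X i x ≤ b i := by
  obtain ⟨x, hxD, hx⟩ := exists_le_setLAverage hD0 hDt
    (Finset.aemeasurable_fun_sum Finset.univ fun i _ => (hX i).mul_const (b i)⁻¹)
  have hmean : ⨍⁻ x in D, ∑ i, X i x * (b i)⁻¹ ∂μ ≤ 1 := by
    rw [setLAverage_eq, lintegral_finsetSum' _ fun i _ => (hX i).mul_const (b i)⁻¹]
    refine ENNReal.div_le_of_le_mul ?_
    calc ∑ i, ∫⁻ x in D, X i x * (b i)⁻¹ ∂μ ≤ ∑ _i : ι, μ D / Fintype.card ι := by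
          refine Finset.sum_le_sum fun i _ => ?_
          rw [lintegral_mul_const' _ _ (ENNReal.inv_ne_top.2 (hb0 i)), ← div_eq_mul_inv]
          exact ENNReal.div_le_of_le_mul (mul_comm (b i) _ ▸ h i)
      _ = 1 * μ D := by
          rw [Finset.sum_const, Finset.card_univ, nsmul_eq_mul, one_mul,
            ENNReal.mul_div_cancel (by simp) (ENNReal.natCast_ne_top _)]
  refine ⟨x, hxD, fun i => ?_⟩
  have hi : X i x * (b i)⁻¹ ≤ 1 :=
    (Finset.single_le_sum_of_canonicallyOrdered (f := fun i => X i x * (b i)⁻¹)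
      (Finset.mem_univ i)).trans (hx.trans hmean)
  rwa [← div_eq_mul_inv, ENNReal.div_le_iff (hb0 i) (hbt i), one_mul] at hi

lemma measurable_ballMean {ρ : ℝ} (hρ : 0 < ρ) (hF : Measurable F) (hM : ∀ x, ‖F x‖ ≤ M) :
    Measurable (ballMean ρ F) :=
  let ⟨_, hL⟩ := exists_lipschitzWith_ballMean hρ hF hM
  hL.continuous.measurable

lemma lintegral_enorm_ballMean_add_sub_rpow_le {ρ : ℝ} (hp : 1 ≤ p) (hρ : 0 < ρ)
    (hF : Measurable F) (hM : ∀ x, ‖F x‖ ≤ M) {v : E n} {b : ℝ≥0∞}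
    (hb : ∀ w, ‖w‖ ≤ ‖v‖ + ρ → lpIncrement p F w ≤ b) :
    ∫⁻ x, ‖ballMean ρ F (x + v) - F x‖ₑ ^ p ≤ b := by
  have := neZero_restrict_ball hρ (0 : E n)
  calc ∫⁻ x, ‖ballMean ρ F (x + v) - F x‖ₑ ^ p
      ≤ ∫⁻ x, ⨍⁻ t in Metric.ball 0 ρ, ‖F (x + v + t) - F x‖ₑ ^ p ∂volume := by
        refine lintegral_mono fun x => ?_
        have htrans : ballMean ρ F (x + v) = ballMean ρ (fun t => F (x + v + t)) 0 :=
          ballMean_eq_setAverage_add ρ F (x + v)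
        rw [htrans]
        exact enorm_ballMean_sub_rpow_le hp hρ (by fun_prop) (fun _ => hM _) 0 (F x)
    _ = ⨍⁻ t in Metric.ball 0 ρ, (∫⁻ x, ‖F (x + v + t) - F x‖ₑ ^ p) ∂volume := by
        refine lintegral_lintegral_swap (Measurable.aemeasurable ?_)
        unfold Function.uncurry
        fun_prop
    _ ≤ ⨍⁻ _t in Metric.ball (0 : E n) ρ, b ∂volume := by
        refine lintegral_mono_ae (Measure.ae_smul_measure
          ((ae_restrict_mem measurableSet_ball).mono fun t ht => ?_) _)
        simp_rw [add_assoc]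
        exact hb _ ((norm_add_le v t).trans
          (add_le_add_right (mem_ball_zero_iff.1 ht).le _))
    _ = b := laverage_const _ _

lemma exists_mul_localEnergy_le (h0 : Tendsto (localEnergy p σ F) (𝓝[>] 0) (𝓝 0)) {κ b : ℝ≥0∞}
    (hκ : κ ≠ ∞) (hb : b ≠ 0) : ∃ r > 0, κ * localEnergy p σ F r ≤ b := by
  have hlim := ENNReal.Tendsto.const_mul h0 (.inr hκ)
  rw [mul_zero] at hlim
  exact ((hlim.eventually_le_const (pos_iff_ne_zero.2 hb)).and self_mem_nhdsWithin).exists.imp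
    fun _ h => h.symm

lemma exists_forall_lpIncrement_le (hp : 1 ≤ p) (hσ : 0 ≤ σ) (hF : Measurable F)
    (h0 : Tendsto (localEnergy p σ F) (𝓝[>] 0) (𝓝 0)) {b : ℝ≥0∞} (hb : b ≠ 0) :
    ∃ r > 0, ∀ v, ‖v‖ ≤ r → lpIncrement p F v ≤ b := by
  obtain ⟨κ, hκ, hinc⟩ := exists_lpIncrement_le_localEnergy n m hp hσ
  obtain ⟨r, hr, hrb⟩ := exists_mul_localEnergy_le h0 hκ hb
  refine ⟨min r 1, lt_min hr one_pos, fun v hv => ?_⟩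
  have hv1 : ‖v‖ₑ ^ σ ≤ 1 := by
    refine ENNReal.rpow_le_one ?_ hσ
    rw [← ofReal_norm]
    exact ENNReal.ofReal_le_one.2 (hv.trans (min_le_right _ _))
  calc lpIncrement p F v ≤ κ * ‖v‖ₑ ^ σ * localEnergy p σ F ‖v‖ := hinc hF v
    _ ≤ κ * 1 * localEnergy p σ F r := by
        gcongr
        exact localEnergy_mono F (hv.trans (min_le_left _ _))
    _ ≤ b := by rwa [mul_one]

lemma eventually_lintegral_cell_localEnergy_ballMean_le (hj : j < n) (hp : 1 ≤ p) (hσ : 0 < σ)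
    (hσj : σ < j + 1) (hF : Measurable F) (hM : ∀ x, ‖F x‖ ≤ M)
    (h0 : Tendsto (localEnergy p σ F) (𝓝[>] 0) (𝓝 0)) {b : ℝ≥0∞} (hb : b ≠ 0) :
    ∀ᶠ δ in 𝓝[>] (0 : ℝ), ∀ᶠ ε in 𝓝[>] (0 : ℝ), ∀ ρ > 0,
      ∫⁻ τ in cell n, localEnergy p σ (ballMean ρ F ∘ gridProj j ε τ) δ ≤ b := by
  obtain ⟨κ, hκ, hcell⟩ := exists_lintegral_cell_localEnergy_comp_gridProj_le m hj hp hσ hσj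
  obtain ⟨r, hr, hrb⟩ := exists_mul_localEnergy_le h0 hκ hb
  have hn : 0 < 2 * √(n : ℝ) := mul_pos two_pos (Real.sqrt_pos.2 (Nat.cast_pos.2 (by omega)))
  filter_upwards [Ioo_mem_nhdsGT hr] with δ hδ
  filter_upwards [Ioo_mem_nhdsGT (div_pos (sub_pos.2 hδ.2) hn)] with ε hε ρ hρ
  have hεr : δ + 2 * √n * ε ≤ r := by
    linarith [(lt_div_iff₀' hn).1 hε.2]
  calc _ ≤ κ * localEnergy p σ (ballMean ρ F) (δ + 2 * √n * ε) :=
        hcell (measurable_ballMean hρ hF hM) hε.1 δ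
    _ ≤ κ * localEnergy p σ F r := by
        gcongr
        exact (localEnergy_ballMean_le hp hρ hF hM _).trans (localEnergy_mono F hεr)
    _ ≤ b := hrb

lemma eventually_lintegral_cell_ballMean_sub_le (hj : j < n) (hp : 1 ≤ p) (hσ : 0 ≤ σ)
    (hF : Measurable F) (hM : ∀ x, ‖F x‖ ≤ M)
    (h0 : Tendsto (localEnergy p σ F) (𝓝[>] 0) (𝓝 0)) {b : ℝ≥0∞} (hb : b ≠ 0) :
    ∀ᶠ ε in 𝓝[>] (0 : ℝ), ∀ᶠ ρ in 𝓝[>] (0 : ℝ),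
      ∫⁻ τ in cell n, ∫⁻ x, ‖ballMean ρ F (gridProj j ε τ x) - F x‖ₑ ^ p ≤ b := by
  obtain ⟨r, hr, hrb⟩ := exists_forall_lpIncrement_le hp hσ hF h0
    (ENNReal.div_pos hb (volume_cell_ne_top (n := n))).ne'
  have hn : 0 < √(n : ℝ) := Real.sqrt_pos.2 (Nat.cast_pos.2 (by omega))
  filter_upwards [Ioo_mem_nhdsGT (div_pos hr hn)] with ε hε
  have hεr : √n * ε < r := (lt_div_iff₀' hn).1 hε.2
  filter_upwards [Ioo_mem_nhdsGT (sub_pos.2 hεr)] with ρ hρ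
  refine (lintegral_cell_lintegral_comp_gridProj_sub_le hj hε.1 (measurable_ballMean hρ.1 hF hM) hF
    fun v hv => lintegral_enorm_ballMean_add_sub_rpow_le hp hρ.1 hF hM
      fun w hw => hrb w (by linarith [hρ.2])).trans_eq ?_
  exact ENNReal.div_mul_cancel volume_cell_ne_zero volume_cell_ne_top

lemma ofReal_rpow_sub_mul_ofReal_div_pow_le (hj : j ≤ n) (hjσ : j ≤ σ) {ρ : ℝ} (hρ : 0 < ρ)
    (hρ1 : ρ ≤ 1) (ε : ℝ) :
    ENNReal.ofReal ρ ^ (σ - n) * ENNReal.ofReal (ρ / ε) ^ (n - j) ≤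
      ENNReal.ofReal ε⁻¹ ^ (n - j) := by
  have hρ0 : ENNReal.ofReal ρ ≠ 0 := by simpa using hρ
  have hexp : ENNReal.ofReal ρ ^ (σ - n) * ENNReal.ofReal ρ ^ (n - j) =
      ENNReal.ofReal ρ ^ (σ - j) := by
    rw [← ENNReal.rpow_natCast, ← ENNReal.rpow_add _ _ hρ0 ENNReal.ofReal_ne_top,
      Nat.cast_sub hj, sub_add_sub_cancel]
  rw [div_eq_mul_inv, ENNReal.ofReal_mul hρ.le, mul_pow, ← mul_assoc, hexp]
  exact mul_le_of_le_one_left' (ENNReal.rpow_le_one (ENNReal.ofReal_le_one.2 hρ1) (by linarith))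

lemma eventually_lintegral_cell_nearSkel_energyDensity_le (hj : j ≤ n) (hjσ : j ≤ σ)
    (hF : Measurable F) (h0 : Tendsto (localEnergy p σ F) (𝓝[>] 0) (𝓝 0)) {b : ℝ≥0∞}
    (hb : b ≠ 0) (ε : ℝ) :
    ∀ᶠ ρ in 𝓝[>] (0 : ℝ), ∫⁻ τ in cell n, ENNReal.ofReal ρ ^ (σ - n) *
      ∫⁻ y in {y | ε⁻¹ • y + τ ∈ nearSkel j (ρ / ε)}, energyDensity p σ F (2 * ρ) y ≤ b := by
  set κ : ℝ≥0∞ := n.choose (n - j) * (2 ^ n * ENNReal.ofReal ε⁻¹ ^ (n - j))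
  have hκ : κ ≠ ∞ := by finiteness
  obtain ⟨r, hr, hrb⟩ := exists_mul_localEnergy_le h0 hκ hb
  filter_upwards [Ioo_mem_nhdsGT (half_pos hr), Ioo_mem_nhdsGT one_pos] with ρ hρ hρ1
  have hρt : ENNReal.ofReal ρ ^ (σ - n) ≠ ∞ := by
    exact ENNReal.rpow_ne_top_of_ne_zero (ENNReal.ofReal_pos.2 hρ.1).ne' ENNReal.ofReal_ne_top
  rw [lintegral_const_mul' _ _ hρt, lintegral_cell_setLIntegral_nearSkel
    (measurable_energyDensity hF _), lintegral_energyDensity hF]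
  calc _ ≤ ENNReal.ofReal ρ ^ (σ - n) * (localEnergy p σ F r *
          (n.choose (n - j) * (2 ^ n * ENNReal.ofReal (ρ / ε) ^ (n - j)))) := by
        gcongr
        · exact localEnergy_mono F (by linarith [hρ.2])
        · exact volume_cell_inter_nearSkel_le j _
    _ = n.choose (n - j) * (2 ^ n * (ENNReal.ofReal ρ ^ (σ - n) *
          ENNReal.ofReal (ρ / ε) ^ (n - j))) * localEnergy p σ F r := by ring
    _ ≤ κ * localEnergy p σ F r := by
        exact mul_le_mul_left (mul_le_mul_right (mul_le_mul_right
          (ofReal_rpow_sub_mul_ofReal_div_pow_le hj hjσ hρ.1 hρ1.2.le ε) _) _) _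
    _ ≤ b := hrb

lemma measurable_lintegral_comp_gridProj_sub (hj : j < n) (ε : ℝ) {u : E n → E m}
    (hu : Measurable u) (hF : Measurable F) :
    Measurable fun τ : E n => ∫⁻ x, ‖u (gridProj j ε τ x) - F x‖ₑ ^ p := by
  have hgp : Measurable fun q : E n × E n => gridProj j ε q.1 q.2 :=
    measurable_gridProj hj ε measurable_fst measurable_snd
  exact Measurable.lintegral_prod_right' (f := fun q : E n × E n =>
    ‖u (gridProj j ε q.1 q.2) - F q.2‖ₑ ^ p) (by fun_prop)

lemma measurable_setLIntegral_nearSkel {g : E n → ℝ≥0∞} (hg : Measurable g) (j : ℕ) (r ε : ℝ) :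
    Measurable fun τ : E n => ∫⁻ y in {y | ε⁻¹ • y + τ ∈ nearSkel j r}, g y := by
  have hadd : Measurable fun q : E n × E n => ε⁻¹ • q.2 + q.1 := by fun_prop
  have hind : Measurable (({q : E n × E n | ε⁻¹ • q.2 + q.1 ∈ nearSkel j r}).indicator
      fun q => g q.2) := (hg.comp measurable_snd).indicator (hadd (measurableSet_nearSkel j r))
  convert hind.lintegral_prod_right' (ν := volume) using 2 with τ
  exact (lintegral_indicator (μ := volume) ((by fun_prop : Measurable fun y : E n => ε⁻¹ • y + τ)
    (measurableSet_nearSkel j r)) g).symm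

lemma eventually_exists_translation (hj : j < n) (hp : 1 ≤ p) (hσ : 0 < σ) (hjσ : j ≤ σ)
    (hσj : σ < j + 1) (hF : Measurable F) (hM : ∀ x, ‖F x‖ ≤ M)
    (h0 : Tendsto (localEnergy p σ F) (𝓝[>] 0) (𝓝 0)) {b₁ b₃ : ℝ≥0∞} (hb₁ : b₁ ≠ 0)
    (hb₁t : b₁ ≠ ∞) (hb₃ : b₃ ≠ 0) (hb₃t : b₃ ≠ ∞) :
    ∀ᶠ δ in 𝓝[>] (0 : ℝ), ∀ b₂ : ℝ≥0∞, b₂ ≠ 0 → b₂ ≠ ∞ →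
      ∀ᶠ ε in 𝓝[>] (0 : ℝ), ∀ᶠ ρ in 𝓝[>] (0 : ℝ), ∃ τ : E n,
        localEnergy p σ (ballMean ρ F ∘ gridProj j ε τ) δ ≤ b₁ ∧
        ∫⁻ x, ‖ballMean ρ F (gridProj j ε τ x) - F x‖ₑ ^ p ≤ b₂ ∧
        ENNReal.ofReal ρ ^ (σ - n) * ∫⁻ y in {y | ε⁻¹ • y + τ ∈ nearSkel j (ρ / ε)},
          energyDensity p σ F (2 * ρ) y ≤ b₃ := by
  set c : ℝ≥0∞ := volume (cell n) / 3
  have hc0 : c ≠ 0 := (ENNReal.div_pos volume_cell_ne_zero (by simp)).ne'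
  filter_upwards [eventually_lintegral_cell_localEnergy_ballMean_le hj hp hσ hσj hF hM h0
    (mul_ne_zero hb₁ hc0)] with δ hδ b₂ hb₂ hb₂t
  filter_upwards [hδ, eventually_lintegral_cell_ballMean_sub_le hj hp hσ.le hF hM h0
    (mul_ne_zero hb₂ hc0)] with ε hε₁ hε₂
  filter_upwards [hε₂, eventually_lintegral_cell_nearSkel_energyDensity_le hj.le hjσ hF h0
    (mul_ne_zero hb₃ hc0) ε, self_mem_nhdsWithin] with ρ hρ₂ hρ₃ hρ
  have hu := measurable_ballMean hρ hF hM
  let X : Fin 3 → E n → ℝ≥0∞ := ![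
    fun τ => localEnergy p σ (ballMean ρ F ∘ gridProj j ε τ) δ,
    fun τ => ∫⁻ x, ‖ballMean ρ F (gridProj j ε τ x) - F x‖ₑ ^ p,
    fun τ => ENNReal.ofReal ρ ^ (σ - n) * ∫⁻ y in {y | ε⁻¹ • y + τ ∈ nearSkel j (ρ / ε)},
      energyDensity p σ F (2 * ρ) y]
  have hX : ∀ i, Measurable (X i) := Fin.forall_fin_succ.2
    ⟨measurable_localEnergy_comp_gridProj hj ε hu δ, Fin.forall_fin_two.2
      ⟨measurable_lintegral_comp_gridProj_sub hj ε hu hF,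
      (measurable_setLIntegral_nearSkel (measurable_energyDensity hF _) j _ ε).const_mul _⟩⟩
  obtain ⟨τ, -, hτ⟩ := exists_forall_le_of_lintegral_le (X := X) (b := ![b₁, b₂, b₃])
    volume_cell_ne_zero volume_cell_ne_top (fun i => (hX i).aemeasurable)
    (Fin.forall_fin_succ.2 ⟨hb₁, Fin.forall_fin_two.2 ⟨hb₂, hb₃⟩⟩)
    (Fin.forall_fin_succ.2 ⟨hb₁t, Fin.forall_fin_two.2 ⟨hb₂t, hb₃t⟩⟩) (by
      rw [Fintype.card_fin, Nat.cast_ofNat]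
      exact Fin.forall_fin_succ.2 ⟨hε₁ ρ hρ, Fin.forall_fin_two.2 ⟨hρ₂, hρ₃⟩⟩)
  exact ⟨τ, hτ 0, hτ 1, hτ 2⟩

end GridChoice

/-! ### Approximation by piecewise homogeneous maps -/

section Approximation

variable {n m l j : ℕ} {s p σ : ℝ}

lemma wspNorm_le {U : Set (E n)} {w : E n → E m} (hp : 1 ≤ p) {η : ℝ≥0∞}
    (hL : ∫⁻ x in U, ‖w x‖ₑ ^ p ≤ (η / 2) ^ p) (hG : gagliardoEnergy s p U w ≤ (η / 2) ^ p) :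
    wspNorm s p U w ≤ η := by
  have hp0 : 0 < p := by linarith
  have hroot : ∀ {a : ℝ≥0∞}, a ≤ (η / 2) ^ p → a ^ (1 / p) ≤ η / 2 := fun ha =>
    one_div p ▸ (ENNReal.rpow_inv_le_iff hp0).2 ha
  rw [wspNorm, ← ENNReal.add_halves η]
  refine add_le_add ?_ (hroot hG)
  rw [eLpNorm_eq_lintegral_rpow_enorm_toReal (by simpa using hp0) ENNReal.ofReal_ne_top,
    ENNReal.toReal_ofReal hp0.le]
  exact hroot hL

lemma wspNorm_congr_ae {U : Set (E n)} {v w : E n → E m} (h : v =ᵐ[volume.restrict U] w) :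
    wspNorm s p U v = wspNorm s p U w := by
  rw [wspNorm, wspNorm, eLpNorm_congr_ae h, gagliardoEnergy_congr_ae h]

lemma MemWsp.congr_ae {U : Set (E n)} {N : Set (E m)} {v w : E n → E m} (hv : MemWsp s p U N v)
    (h : v =ᵐ[volume.restrict U] w) : MemWsp s p U N w :=
  ⟨hv.1.congr h, wspNorm_congr_ae (s := s) (p := p) h ▸ hv.2.1,
    by filter_upwards [hv.2.2, h] with x hx hvw using hvw ▸ hx⟩

lemma MemWsp.exists_mem {ω : Set (E n)} {N : Set (E m)} {f : E n → E m} (hω : IsOpen ω)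
    (hf : MemWsp s p ω N f) : ∃ o, ω.Nonempty → o ∈ N := by
  by_cases hne : ω.Nonempty
  · have : (ae (volume.restrict ω)).NeBot := by
      simpa [ae_neBot] using (hω.measure_pos volume hne).ne'
    obtain ⟨x, hx⟩ := hf.2.2.exists
    exact ⟨f x, fun _ => hx⟩
  · exact ⟨0, fun h => absurd h hne⟩

lemma localEnergy_sub_le (hp : 1 ≤ p) {v : E n → E m} (hv : Measurable v) (w : E n → E m)
    (r : ℝ) :
    localEnergy p σ (v - w) r ≤ 2 ^ (p - 1) * (localEnergy p σ v r + localEnergy p σ w r) := by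
  have hinc : ∀ h : E n, lpIncrement p (v - w) h ≤
      2 ^ (p - 1) * (lpIncrement p v h + lpIncrement p w h) := fun h => by
    unfold lpIncrement
    rw [← lintegral_add_left (by fun_prop), ← lintegral_const_mul' _ _ (by simp)]
    refine lintegral_mono fun x => ?_
    rw [Pi.sub_apply, Pi.sub_apply, sub_sub_sub_comm]
    exact enorm_sub_rpow_le hp _ _
  have hvm := measurable_lpIncrement (p := p) hv
  unfold localEnergy
  rw [← lintegral_add_left (by fun_prop), ← lintegral_const_mul' _ _ (by simp)]
  refine lintegral_mono fun h => ?_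
  rw [← add_mul, ← mul_assoc]
  gcongr
  exact hinc h

lemma localEnergy_lipschitz_comp_le (hp : 0 ≤ p) {φ : E m → E l} {K : ℝ≥0}
    (hφ : LipschitzWith K φ) (v : E n → E m) (r : ℝ) :
    localEnergy p σ (φ ∘ v) r ≤ (K : ℝ≥0∞) ^ p * localEnergy p σ v r := by
  have hK : (K : ℝ≥0∞) ^ p ≠ ∞ := ENNReal.rpow_ne_top_of_nonneg hp ENNReal.coe_ne_top
  unfold localEnergy lpIncrement
  rw [← lintegral_const_mul' _ _ hK]
  refine lintegral_mono fun h => ?_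
  rw [← mul_assoc, ← lintegral_const_mul' _ _ hK]
  gcongr with x
  rw [← ENNReal.mul_rpow_of_nonneg _ _ hp, ← edist_eq_enorm_sub, ← edist_eq_enorm_sub]
  gcongr
  exact hφ _ _

lemma energyDensity_eq (p σ : ℝ) (w : E n → E m) (r : ℝ) (x : E n) :
    energyDensity p σ w r x =
      ∫⁻ y in Metric.closedBall x r, ‖w x - w y‖ₑ ^ p / ‖x - y‖ₑ ^ ((n : ℝ) + σ) := by
  rw [← (measurePreserving_add_left volume x).setLIntegral_comp_preimage_emb
    (Homeomorph.addLeft x).measurableEmbedding, preimage_add_closedBall, sub_self, energyDensity]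
  refine lintegral_congr fun h => ?_
  rw [sub_add_cancel_left, enorm_neg, enorm_sub_rev, ENNReal.rpow_neg, div_eq_mul_inv]

lemma setLIntegral_div_enorm_sub_le (hp : 1 ≤ p) {q : ℝ} (hq : 0 ≤ n + q) (U : Set (E n))
    (w : E n → E m) {δ : ℝ} (hδ : 0 < δ) (x : E n) :
    ∫⁻ y in U, ‖w x - w y‖ₑ ^ p / ‖x - y‖ₑ ^ (n + q) ≤ energyDensity p q w δ x +
      ENNReal.ofReal δ ^ (-(n + q)) * 2 ^ (p - 1) *
        (‖w x‖ₑ ^ p * volume U + ∫⁻ y in U, ‖w y‖ₑ ^ p) := by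
  set c : ℝ≥0∞ := ENNReal.ofReal δ ^ (-(n + q)) * 2 ^ (p - 1)
  have hc : c ≠ ∞ := by
    refine ENNReal.mul_ne_top ?_ (by simp)
    exact ENNReal.rpow_ne_top_of_ne_zero (ENNReal.ofReal_pos.2 hδ).ne' ENNReal.ofReal_ne_top
  have hfar : ∀ y ∉ Metric.closedBall x δ,
      ‖w x - w y‖ₑ ^ p / ‖x - y‖ₑ ^ (n + q) ≤ c * (‖w x‖ₑ ^ p + ‖w y‖ₑ ^ p) := fun y hy => by
    rw [Metric.mem_closedBall, dist_comm, dist_eq_norm, not_le] at hy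
    rw [ENNReal.div_eq_inv_mul, ← ENNReal.rpow_neg, mul_assoc]
    refine mul_le_mul' ?_ (enorm_sub_rpow_le hp _ _)
    rw [ENNReal.rpow_neg, ENNReal.rpow_neg, ENNReal.inv_le_inv, ← ofReal_norm]
    gcongr
  rw [energyDensity_eq, ← setLIntegral_const, ← lintegral_add_left measurable_const,
    ← lintegral_const_mul' _ _ hc, ← lintegral_add_compl (μ := volume.restrict U) _
      (measurableSet_closedBall (x := x) (ε := δ))]
  refine add_le_add (lintegral_mono' (Measure.restrict_mono_measure Measure.restrict_le_self _)
    le_rfl) ?_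
  exact (setLIntegral_mono' measurableSet_closedBall.compl hfar).trans
    (setLIntegral_le_lintegral _ _)

/-- Only the pairs at distance less than `δ` need the regularity of `w`. -/
lemma gagliardoEnergy_le (hp : 1 ≤ p) (hs : 0 ≤ s) (U : Set (E n)) {w : E n → E m}
    (hw : Measurable w) {δ : ℝ} (hδ : 0 < δ) :
    gagliardoEnergy s p U w ≤ localEnergy p (s * p) w δ +
      ENNReal.ofReal δ ^ (-((n : ℝ) + s * p)) * 2 ^ p * volume U * ∫⁻ x in U, ‖w x‖ₑ ^ p := by
  set c : ℝ≥0∞ := ENNReal.ofReal δ ^ (-((n : ℝ) + s * p))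
  have hc : c * 2 ^ (p - 1) ≠ ∞ := by
    refine ENNReal.mul_ne_top ?_ (by simp)
    exact ENNReal.rpow_ne_top_of_ne_zero (ENNReal.ofReal_pos.2 hδ).ne' ENNReal.ofReal_ne_top
  have htwo : (2 : ℝ≥0∞) ^ (p - 1) * 2 = 2 ^ p := by
    rw [ENNReal.rpow_sub _ _ two_ne_zero ENNReal.ofNat_ne_top, ENNReal.rpow_one,
      ENNReal.div_mul_cancel two_ne_zero ENNReal.ofNat_ne_top]
  calc gagliardoEnergy s p U w
      ≤ ∫⁻ x in U, (energyDensity p (s * p) w δ x +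
          c * 2 ^ (p - 1) * (‖w x‖ₑ ^ p * volume U + ∫⁻ y in U, ‖w y‖ₑ ^ p)) :=
        lintegral_mono (setLIntegral_div_enorm_sub_le hp (by positivity) U w hδ)
    _ = (∫⁻ x in U, energyDensity p (s * p) w δ x) +
          c * (2 ^ (p - 1) * 2) * volume U * ∫⁻ y in U, ‖w y‖ₑ ^ p := by
        rw [lintegral_add_left (measurable_energyDensity hw δ), lintegral_const_mul' _ _ hc,
          lintegral_add_right _ measurable_const, lintegral_mul_const _ (by fun_prop),
          setLIntegral_const]
        ring
    _ ≤ _ := by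
        rw [← lintegral_energyDensity hw, htwo]
        exact add_le_add_left (setLIntegral_le_lintegral _ _) _

end Approximation

section MeshApproximation

variable {n m j : ℕ} {s p σ a : ℝ} {F : E n → E m} {Ω : Set (E n)} {N : Set (E m)}

lemma IsLipschitzNhdRetract.exists_lipschitzWith (hN : IsLipschitzNhdRetract N) :
    ∃ d > 0, ∃ (K : ℝ≥0) (π : E m → E m), LipschitzWith K π ∧
      MapsTo π (Metric.cthickening d N) N ∧ ∀ x ∈ N, π x = x := by
  obtain ⟨d, hd, K, φ, hφ, hφN, hφid⟩ := hN
  obtain ⟨π, hπ, hπφ⟩ := hφ.extend_finite_dimension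
  refine ⟨d, hd, _, π, hπ, hφN.congr hπφ, fun x hx => ?_⟩
  rw [← hπφ (Metric.self_subset_cthickening N hx), hφid x hx]

lemma Mesh.coord_mem_nearSkel (M : Mesh n) {x y : E n} (hx : x ∈ M.skeleton j) {ρ : ℝ}
    (hy : y ∈ Metric.ball x ρ) : M.coord y ∈ nearSkel j (ρ / M.ε) := by
  obtain ⟨B, hB, hBx⟩ := M.exists_evenDist_eq_one_of_mem_skeleton hx
  refine ⟨B, hB, fun i hi => ?_⟩
  have hdist : |M.coord x i - M.coord y i| ≤ ρ / M.ε :=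
    calc |M.coord x i - M.coord y i| ≤ ‖M.coord x - M.coord y‖ :=
          abs_apply_le_norm (M.coord x - M.coord y) i
      _ = ‖x - y‖ / M.ε := by
          rw [M.coord_sub_coord, norm_smul, norm_inv, Real.norm_of_nonneg M.ε_pos.le,
            inv_mul_eq_div]
      _ ≤ ρ / M.ε := by
          have := M.ε_pos
          rw [Metric.mem_ball, dist_comm, dist_eq_norm] at hy
          gcongr
  linarith [evenDist_le_add (M.coord x i) (M.coord y i), hBx i hi]

lemma eventually_exists_mesh (hj : j < n) (hp : 1 ≤ p) (hσ : 0 < σ) (hjσ : j ≤ σ)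
    (hσj : σ < j + 1) (hF : Measurable F) {B : ℝ} (hB : ∀ x, ‖F x‖ ≤ B)
    (h0 : Tendsto (localEnergy p σ F) (𝓝[>] 0) (𝓝 0)) (hΩ : Bornology.IsBounded Ω) (ha : 0 < a)
    (hFN : ∀ᵐ x, x ∈ Metric.cthickening a Ω → F x ∈ N) {d : ℝ} (hd : 0 < d) {θ : ℝ≥0∞}
    (hθ : θ ≠ 0) (hθt : θ ≠ ∞) :
    ∀ᶠ δ in 𝓝[>] (0 : ℝ), ∀ b : ℝ≥0∞, b ≠ 0 → b ≠ ∞ → ∃ (M : Mesh n) (u : E n → E m),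
      closure Ω ⊆ M.carrier ∧ M.carrier ⊆ Metric.cthickening a Ω ∧
      (∃ L, LipschitzWith L u) ∧ MapsTo u (M.skeleton j) (Metric.cthickening d N) ∧
      localEnergy p σ (u ∘ M.proj j) δ ≤ θ ∧ ∫⁻ x, ‖u (M.proj j x) - F x‖ₑ ^ p ≤ b := by
  have hp0 : 0 < p := by linarith
  obtain ⟨κ, hκ, hdist⟩ := exists_infEDist_ballMean_rpow_le n hp hσ.le
  obtain ⟨b₃, hb₃, hκb₃⟩ := ENNReal.exists_nnreal_pos_mul_lt hκ
    (ENNReal.rpow_pos (ENNReal.ofReal_pos.2 hd) ENNReal.ofReal_ne_top).ne'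
  filter_upwards [eventually_exists_translation hj hp hσ hjσ hσj hF hB h0 hθ hθt
    (ENNReal.coe_ne_zero.2 hb₃.ne') ENNReal.coe_ne_top] with δ hδ b hb hbt
  have hn : 0 < √(n : ℝ) := Real.sqrt_pos.2 (Nat.cast_pos.2 (by omega))
  obtain ⟨ε, hε, hε0, hεa⟩ := ((hδ b hb hbt).and
    (Ioo_mem_nhdsGT (div_pos ha (mul_pos hn four_pos)))).exists
  obtain ⟨ρ, ⟨τ, henergy, hLp, hnear⟩, hρ0, hρa⟩ :=
    (hε.and (Ioo_mem_nhdsGT (half_pos ha))).exists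
  have hεa : √n * (2 * ε) ≤ a / 2 := by linarith [(lt_div_iff₀ (mul_pos hn four_pos)).1 hεa]
  obtain ⟨M, rfl, rfl, hΩM, hMΩ⟩ := Mesh.exists_covering τ hε0 hΩ.closure
  have hMΩ : M.carrier ⊆ Metric.cthickening (a / 2) Ω := by
    rw [← Metric.cthickening_closure (s := Ω)]
    exact hMΩ.trans (Metric.cthickening_mono hεa _)
  refine ⟨M, ballMean ρ F, hΩM, hMΩ.trans (Metric.cthickening_mono (by linarith) _),
    exists_lipschitzWith_ballMean hρ0 hF hB, fun x hx => ?_, henergy, hLp⟩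
  have hball : Metric.ball x ρ ⊆ Metric.cthickening a Ω := fun y hy =>
    Metric.cthickening_mono (by linarith) _ (Metric.cthickening_cthickening_subset
      (half_pos ha).le (half_pos ha).le Ω (Metric.mem_cthickening_of_dist_le y x _ _
        (hMΩ (M.skeleton_subset_carrier j hx)) ((Metric.mem_ball.1 hy).le.trans hρa.le)))
  rw [Metric.mem_cthickening_iff, ← ENNReal.rpow_le_rpow_iff hp0]
  calc _ ≤ κ * ENNReal.ofReal ρ ^ (σ - n) *
          ∫⁻ y in Metric.ball x ρ, energyDensity p σ F (2 * ρ) y :=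
        hdist hF hB hρ0 (hFN.mono fun y hy hyx => hy (hball hyx))
    _ ≤ κ * (ENNReal.ofReal ρ ^ (σ - n) * ∫⁻ y in {y | M.ε⁻¹ • y + M.phase ∈ nearSkel j (ρ / M.ε)},
          energyDensity p σ F (2 * ρ) y) := by
        rw [mul_assoc]
        gcongr
        exact fun y hy => M.coord_mem_nearSkel hx hy
    _ ≤ κ * b₃ := by gcongr
    _ ≤ ENNReal.ofReal d ^ p := by rw [mul_comm]; exact hκb₃.le

lemma Mesh.ae_homogeneousExt_eq (hj : j < n) (M : Mesh n) (o : E m) (g : E n → E m) :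
    M.homogeneousExt j o g =ᵐ[volume] g ∘ M.proj j :=
  (ae_depth_coord_ne_zero hj M).mono fun _ hx => homogeneousExt_of_depth_ne_zero hx

lemma memWsp_of_localEnergy_ne_top (hp : 1 ≤ p) (hs : 0 ≤ s) {U : Set (E n)}
    (hU : volume U ≠ ∞) (hN : Bornology.IsBounded N) {w : E n → E m} (hw : Measurable w)
    (hwN : ∀ᵐ x ∂volume.restrict U, w x ∈ N) {δ : ℝ} (hδ : 0 < δ)
    (hfin : localEnergy p (s * p) w δ ≠ ∞) : MemWsp s p U N w := by
  have hp0 : 0 < p := by linarith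
  obtain ⟨R, hR⟩ := hN.exists_norm_le
  have hwR : ∀ᵐ x ∂volume.restrict U, ‖w x‖ ≤ R := hwN.mono fun x hx => hR _ hx
  have : IsFiniteMeasure (volume.restrict U) := ⟨by simpa using hU.lt_top⟩
  have hLp : MemLp w (ENNReal.ofReal p) (volume.restrict U) :=
    .of_bound hw.aestronglyMeasurable R hwR
  have hint : ∫⁻ x in U, ‖w x‖ₑ ^ p ≠ ∞ := by
    have := lintegral_rpow_enorm_lt_top_of_eLpNorm_lt_top (by simpa using hp0)
      ENNReal.ofReal_ne_top hLp.eLpNorm_lt_top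
    rw [ENNReal.toReal_ofReal hp0.le] at this
    exact this.ne
  have hδt : ENNReal.ofReal δ ^ (-((n : ℝ) + s * p)) ≠ ∞ :=
    ENNReal.rpow_ne_top_of_ne_zero (ENNReal.ofReal_pos.2 hδ).ne' ENNReal.ofReal_ne_top
  refine ⟨hw.aestronglyMeasurable, ENNReal.add_lt_top.2 ⟨hLp.eLpNorm_lt_top,
    ENNReal.rpow_lt_top_of_nonneg (by positivity) ?_⟩, hwN⟩
  refine ne_top_of_le_ne_top ?_ (gagliardoEnergy_le hp hs U hw hδ)
  exact ENNReal.add_ne_top.2 ⟨hfin, ENNReal.mul_ne_top (ENNReal.mul_ne_top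
    (ENNReal.mul_ne_top hδt (by simp)) hU) hint⟩

lemma setLIntegral_lipschitz_comp_sub_le (hp : 0 ≤ p) {K : ℝ≥0} {φ : E m → E m}
    (hφ : LipschitzWith K φ) (hφF : ∀ᵐ x ∂volume.restrict Ω, φ (F x) = F x) (v : E n → E m) :
    ∫⁻ x in Ω, ‖φ (v x) - F x‖ₑ ^ p ≤ (K : ℝ≥0∞) ^ p * ∫⁻ x, ‖v x - F x‖ₑ ^ p := by
  rw [← lintegral_const_mul' _ _ (ENNReal.rpow_ne_top_of_nonneg hp ENNReal.coe_ne_top)]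
  refine (lintegral_mono_ae ?_).trans (setLIntegral_le_lintegral Ω _)
  filter_upwards [hφF] with x hx
  rw [← ENNReal.mul_rpow_of_nonneg _ _ hp, ← edist_eq_enorm_sub, ← edist_eq_enorm_sub]
  gcongr
  simpa only [hx] using hφ (v x) (F x)

lemma gagliardoEnergy_lipschitz_comp_sub_le (hp : 1 ≤ p) (hs : 0 ≤ s) {K : ℝ≥0} {φ : E m → E m}
    (hφ : LipschitzWith K φ) (hφF : ∀ᵐ x ∂volume.restrict Ω, φ (F x) = F x) {v : E n → E m}
    (hv : Measurable v) (hF : Measurable F) {δ : ℝ} (hδ : 0 < δ) :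
    gagliardoEnergy s p Ω (φ ∘ v - F) ≤
      2 ^ (p - 1) * (K ^ p * localEnergy p (s * p) v δ + localEnergy p (s * p) F δ) +
      ENNReal.ofReal δ ^ (-((n : ℝ) + s * p)) * 2 ^ p * volume Ω *
        (K ^ p * ∫⁻ x, ‖v x - F x‖ₑ ^ p) := by
  have hφv : Measurable (φ ∘ v) := hφ.continuous.measurable.comp hv
  have hp0 : 0 ≤ p := by linarith
  refine (gagliardoEnergy_le hp hs Ω (hφv.sub hF) hδ).trans ?_
  gcongr ?_ + _ * ?_
  · refine (localEnergy_sub_le hp hφv F δ).trans ?_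
    gcongr
    exact localEnergy_lipschitz_comp_le hp0 hφ v δ
  · exact setLIntegral_lipschitz_comp_sub_le hp0 hφ hφF v

lemma wspNorm_lipschitz_comp_sub_le (hp : 1 ≤ p) (hs : 0 ≤ s) {K : ℝ≥0} {φ : E m → E m}
    (hφ : LipschitzWith K φ) (hφF : ∀ᵐ x ∂volume.restrict Ω, φ (F x) = F x) {v : E n → E m}
    (hv : Measurable v) (hF : Measurable F) {δ : ℝ} (hδ : 0 < δ) {η : ℝ≥0∞}
    (hnear : 2 ^ (p - 1) * (K ^ p * localEnergy p (s * p) v δ + localEnergy p (s * p) F δ) ≤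
      (η / 2) ^ p / 2)
    (hfar : (ENNReal.ofReal δ ^ (-((n : ℝ) + s * p)) * 2 ^ p * volume Ω + 1) *
      (K ^ p * ∫⁻ x, ‖v x - F x‖ₑ ^ p) ≤ (η / 2) ^ p / 2) :
    wspNorm s p Ω (φ ∘ v - F) ≤ η := by
  rw [add_mul, one_mul] at hfar
  refine wspNorm_le hp ?_ ?_
  · exact (setLIntegral_lipschitz_comp_sub_le (by linarith) hφ hφF v).trans
      ((le_add_self.trans hfar).trans ENNReal.half_le_self)
  · exact (gagliardoEnergy_lipschitz_comp_sub_le hp hs hφ hφF hv hF hδ).trans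
      ((add_le_add hnear (le_self_add.trans hfar)).trans_eq (ENNReal.add_halves _))

lemma ae_restrict_of_ae_mem_cthickening {P : E n → Prop}
    (h : ∀ᵐ x, x ∈ Metric.cthickening a Ω → P x) : ∀ᵐ x ∂volume.restrict Ω, P x :=
  ae_restrict_of_ae_restrict_of_subset (Metric.self_subset_cthickening Ω)
    ((ae_restrict_iff' Metric.isClosed_cthickening.measurableSet).2 h)

lemma exists_mesh_wspNorm_le (hs : 0 < s) (hp : 1 ≤ p) (hjσ : j ≤ s * p) (hσj : s * p < j + 1)
    (hj : j < n) (hF : Measurable F) {B : ℝ} (hB : ∀ x, ‖F x‖ ≤ B)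
    (h0 : Tendsto (localEnergy p (s * p) F) (𝓝[>] 0) (𝓝 0)) (hΩ : Bornology.IsBounded Ω)
    (ha : 0 < a) (hFN : ∀ᵐ x, x ∈ Metric.cthickening a Ω → F x ∈ N) {K : ℝ≥0} {φ : E m → E m}
    (hφ : LipschitzWith K φ) (hφN : ∀ y ∈ N, φ y = y) {d : ℝ} (hd : 0 < d) {η : ℝ≥0∞}
    (hη : η ≠ 0) :
    ∃ (M : Mesh n) (u : E n → E m), closure Ω ⊆ M.carrier ∧ M.carrier ⊆ Metric.cthickening a Ω ∧
      (∃ L, LipschitzWith L u) ∧ MapsTo u (M.skeleton j) (Metric.cthickening d N) ∧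
      (∃ δ > 0, localEnergy p (s * p) (u ∘ M.proj j) δ ≠ ∞) ∧
      wspNorm s p Ω (φ ∘ u ∘ M.proj j - F) ≤ η := by
  have hp0 : 0 < p := by linarith
  have hKt : (K : ℝ≥0∞) ^ p ≠ ∞ := ENNReal.rpow_ne_top_of_nonneg hp0.le ENNReal.coe_ne_top
  have hA : (η / 2) ^ p / 2 ≠ 0 := by simp [hη, hp0, hp0.le]
  obtain ⟨θ, hθ, hθA⟩ := ENNReal.exists_nnreal_pos_mul_lt (ENNReal.mul_ne_top
    (by simp : (2 : ℝ≥0∞) ^ (p - 1) ≠ ∞) (ENNReal.add_ne_top.2 ⟨hKt, ENNReal.one_ne_top⟩)) hA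
  obtain ⟨δ, ⟨hmesh, hFθ⟩, hδ⟩ := (((eventually_exists_mesh hj hp (mul_pos hs hp0) hjσ hσj hF hB
    h0 hΩ ha hFN hd (ENNReal.coe_ne_zero.2 hθ.ne') ENNReal.coe_ne_top).and
    (h0.eventually_le_const (ENNReal.coe_pos.2 hθ))).and self_mem_nhdsWithin).exists
  have hδt : ENNReal.ofReal δ ^ (-((n : ℝ) + s * p)) ≠ ∞ :=
    ENNReal.rpow_ne_top_of_ne_zero (ENNReal.ofReal_pos.2 hδ).ne' ENNReal.ofReal_ne_top
  obtain ⟨b, hb, hbA⟩ := ENNReal.exists_nnreal_pos_mul_lt (ENNReal.mul_ne_top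
    (ENNReal.add_ne_top.2 ⟨ENNReal.mul_ne_top (ENNReal.mul_ne_top hδt
      (by simp : (2 : ℝ≥0∞) ^ p ≠ ∞)) (hΩ.measure_lt_top (μ := volume)).ne,
      ENNReal.one_ne_top⟩) hKt) hA
  obtain ⟨M, u, hΩM, hMΩ, ⟨L, hL⟩, hu, huθ, hub⟩ :=
    hmesh b (ENNReal.coe_ne_zero.2 hb.ne') ENNReal.coe_ne_top
  refine ⟨M, u, hΩM, hMΩ, ⟨L, hL⟩, hu, ⟨δ, hδ, ne_top_of_le_ne_top ENNReal.coe_ne_top huθ⟩,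
    wspNorm_lipschitz_comp_sub_le hp hs.le hφ ?_
      (hL.continuous.measurable.comp (M.measurable_proj hj)) hF hδ ?_ ?_⟩
  · exact ae_restrict_of_ae_mem_cthickening (hFN.mono fun x hx hxa => hφN _ (hx hxa))
  · calc _ ≤ 2 ^ (p - 1) * ((K : ℝ≥0∞) ^ p * θ + θ) := by gcongr
      _ = θ * (2 ^ (p - 1) * (K ^ p + 1)) := by ring
      _ ≤ _ := hθA.le
  · rw [← mul_assoc, mul_comm]
    refine le_trans ?_ hbA.le
    gcongr
    exact hub

lemma Mesh.memWsp_homogeneousExt (hj : j < n) (hp : 1 ≤ p) (hs : 0 ≤ s)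
    (hN : Bornology.IsBounded N) (M : Mesh n) {o : E m} {u : E n → E m} (hu : Measurable u)
    (hmaps : MapsTo (M.homogeneousExt j o u) M.carrier N) {δ : ℝ} (hδ : 0 < δ)
    (hfin : localEnergy p (s * p) (u ∘ M.proj j) δ ≠ ∞) :
    MemWsp s p M.carrier N (M.homogeneousExt j o u) := by
  have hext := M.ae_homogeneousExt_eq hj o u
  refine (memWsp_of_localEnergy_ne_top hp hs M.isCompact_carrier.measure_lt_top.ne hN
    (hu.comp (M.measurable_proj hj)) ?_ hδ hfin).congr_ae (ae_restrict_of_ae hext.symm)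
  filter_upwards [ae_restrict_of_ae hext, ae_restrict_mem M.isCompact_carrier.measurableSet]
    with x hx hxM using hx ▸ hmaps hxM

lemma exists_piecewiseHomogeneous_wspNorm_le (hs0 : 0 < s) (hs1 : s < 1) (hp : 1 ≤ p)
    (hspn : s * p < n) (hNb : Bornology.IsBounded N) (hN : IsLipschitzNhdRetract N)
    {ω : Set (E n)} (hΩ : Bornology.IsBounded Ω) (hω : IsOpen ω) (hΩω : closure Ω ⊆ ω)
    {f : E n → E m} (hf : MemWsp s p ω N f) {η : ℝ≥0∞} (hη : η ≠ 0) :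
    ∃ (M : Mesh n) (g : E n → E m), closure Ω ⊆ M.carrier ∧ M.carrier ⊆ ω ∧
      MapsTo g M.carrier N ∧ M.IsPiecewiseHomogeneous ⌊s * p⌋₊ g ∧ MemWsp s p M.carrier N g ∧
      wspNorm s p Ω (g - f) ≤ η ∧ ∃ L, LipschitzOnWith L g (M.skeleton ⌊s * p⌋₊) := by
  have hsp : 0 ≤ s * p := by nlinarith
  have hjσ : (⌊s * p⌋₊ : ℝ) ≤ s * p := Nat.floor_le hsp
  have hj : ⌊s * p⌋₊ < n := Nat.cast_lt.1 (hjσ.trans_lt hspn)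
  have : NeZero n := ⟨by omega⟩
  obtain ⟨F, B, a, hF, hB, ha, haω, hFf, hfin⟩ := exists_extension hs1 hp hNb hΩ hω hΩω hf
  obtain ⟨d, hd, K, π, hπ, hπN, hπid⟩ := hN.exists_lipschitzWith
  obtain ⟨o, ho⟩ := hf.exists_mem hω
  obtain ⟨M, u, hΩM, hMΩ, ⟨L, hL⟩, hu, ⟨δ, hδ, hδt⟩, happrox⟩ := exists_mesh_wspNorm_le hs0 hp hjσ
    (Nat.lt_floor_add_one _) hj hF hB (tendsto_localEnergy_zero ha hfin (by linarith)) hΩ ha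
    (hFf.mono fun x hx hxa => (hx hxa).2) hπ hπid hd hη
  have hMω : M.carrier ⊆ ω := hMΩ.trans haω
  have hmaps : MapsTo (M.homogeneousExt ⌊s * p⌋₊ o (π ∘ u)) M.carrier N := fun x hx =>
    Mesh.homogeneousExt_mem hj (ho ⟨x, hMω hx⟩) (hπN.comp hu) hx
  refine ⟨M, M.homogeneousExt ⌊s * p⌋₊ o (π ∘ u), hΩM, hMω, hmaps,
    M.isPiecewiseHomogeneous_homogeneousExt _ o _, ?_, ?_, K * L, ?_⟩
  · exact M.memWsp_homogeneousExt hj hp hs0.le hNb (hπ.comp hL).continuous.measurable hmaps hδ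
      (ne_top_of_le_ne_top (ENNReal.mul_ne_top (by finiteness) hδt)
        (localEnergy_lipschitz_comp_le (by linarith) hπ _ δ))
  · refine (wspNorm_congr_ae ?_).trans_le happrox
    refine ae_restrict_of_ae_mem_cthickening (a := a) ?_
    filter_upwards [M.ae_homogeneousExt_eq hj o (π ∘ u), hFf] with x hx hxF hxa
    rw [Pi.sub_apply, Pi.sub_apply, hx, (hxF hxa).1]
    rfl
  · intro x hx y hy
    rw [Mesh.homogeneousExt_of_mem_skeleton hj hx, Mesh.homogeneousExt_of_mem_skeleton hj hy]
    exact hπ.comp hL x y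

end MeshApproximation

end FracSobolev

end

theorem theorem1p6_general {n m : ℕ} (s p : ℝ) (hs0 : 0 < s) (hs1 : s < 1) (hp : 1 ≤ p)
    (hspn : s * p < n) (N : Set (FracSobolev.E m)) (hNb : Bornology.IsBounded N)
    (hN : FracSobolev.IsLipschitzNhdRetract N) (Ω ω : Set (FracSobolev.E n))
    (hΩb : Bornology.IsBounded Ω) (hω : IsOpen ω) (hΩω : closure Ω ⊆ ω)
    (f : FracSobolev.E n → FracSobolev.E m) (hf : FracSobolev.MemWsp s p ω N f) :
    ∃ (C : ℕ → FracSobolev.Mesh n) (fk : ℕ → FracSobolev.E n → FracSobolev.E m),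
      (∀ k, closure Ω ⊆ (C k).carrier ∧ (C k).carrier ⊆ ω) ∧
      (∀ k, Set.MapsTo (fk k) (C k).carrier N) ∧
      (∀ k, (C k).IsPiecewiseHomogeneous ⌊s * p⌋₊ (fk k)) ∧
      (∀ k, FracSobolev.MemWsp s p (C k).carrier N (fk k)) ∧
      Filter.Tendsto (fun k => FracSobolev.wspNorm s p Ω (fun x => fk k x - f x))
        Filter.atTop (nhds 0) ∧
      (∀ k, ∃ L : NNReal, LipschitzOnWith L (fk k) ((C k).skeleton ⌊s * p⌋₊)) := by
  choose C fk hΩC hCω hmaps hhom hmem hle hlip using fun k : ℕ =>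
    FracSobolev.exists_piecewiseHomogeneous_wspNorm_le hs0 hs1 hp hspn hNb hN hΩb hω hΩω hf
      (η := (k : ENNReal)⁻¹) (by simp)
  exact ⟨C, fk, fun k => ⟨hΩC k, hCω k⟩, hmaps, hhom, hmem,
    tendsto_of_tendsto_of_tendsto_of_le_of_le tendsto_const_nhds
      ENNReal.tendsto_inv_nat_nhds_zero (fun _ => zero_le) hle, hlip⟩

theorem theorem1p6 {n m d : ℕ} (s p : ℝ) (hs0 : 0 < s) (hs1 : s < 1) (hp : 1 ≤ p)
    (hsp1 : 1 ≤ s * p) (hspn : s * p < n)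
    (N : Set (FracSobolev.E m)) (hNc : IsCompact N) (hN : FracSobolev.IsSmoothSubmanifold d N)
    (Ω ω : Set (FracSobolev.E n)) (hΩ : IsOpen Ω) (hΩb : Bornology.IsBounded Ω)
    (hω : IsOpen ω) (hωb : Bornology.IsBounded ω) (hΩω : closure Ω ⊆ ω)
    (f : FracSobolev.E n → FracSobolev.E m) (hf : FracSobolev.MemWsp s p ω N f) :
    ∃ (C : ℕ → FracSobolev.Mesh n) (fk : ℕ → FracSobolev.E n → FracSobolev.E m),
      (∀ k, closure Ω ⊆ (C k).carrier ∧ (C k).carrier ⊆ ω) ∧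
      (∀ k, Set.MapsTo (fk k) (C k).carrier N) ∧
      (∀ k, (C k).IsPiecewiseHomogeneous ⌊s * p⌋₊ (fk k)) ∧
      (∀ k, FracSobolev.MemWsp s p (C k).carrier N (fk k)) ∧
      Filter.Tendsto (fun k => FracSobolev.wspNorm s p Ω (fun x => fk k x - f x))
        Filter.atTop (nhds 0) ∧
      (∀ k, ∃ L : NNReal, LipschitzOnWith L (fk k) ((C k).skeleton ⌊s * p⌋₊)) :=
  theorem1p6_general s p hs0 hs1 hp hspn N hNc.isBounded
    ((hN.hasPositiveReach hNc).isLipschitzNhdRetract hNc) Ω ω hΩb hω hΩω f hf
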